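/- Let $(Z,\Omega)$ be a $2n$-dimensional symplectic manifold with $k<n$ smooth real functions $F_1,\dots,F_k$ that are pairwise in involution and independent almost everywhere on $Z$ (i.e. the set of points at which $F=(F_1,\dots,F_k):Z\to\mathbb R^k$ fails to be a submersion is nowhere dense). Let $\vartheta_\lambda$ be the Hamiltonian vector field of $F_\lambda$, defined by $\vartheta_\lambda\rfloor\Omega=-dF_\lambda$. Let $W$ be a connected common level surface of the $F_\lambda$ and $U_W$ an open connected neighbourhood of $W$ on which $F$ is a submersion. Suppose that the characteristic foliation of $U_W$, i.e. the foliation tangent to the distribution spanned by $\vartheta_1,\dots,\vartheta_k$, is a fibred manifold $\pi_1:U_W\to S'$ over a manifold $S'$ of dimension $2n-k$: $\pi_1$ is a surjective submersion whose vertical tangent spaces are spanned by the $\vartheta_\lambda$ and whose fibres are connected, hence are the leaves of the foliation. Let $N\subset S'$ be a domain (a nonempty connected open set) such that (i) the fibres of $\pi_1$ over the points of $N$ are mutually diffeomorphic, and (ii) the vector fields $\vartheta_1,\dots,\vartheta_k$ are complete on $\pi_1^{-1}(N)$. Then there is an integer $m$ with $0\le m\le k$ such that every point $r_0\in N$ has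 an open connected neighbourhood $N'\subset N$ for which $\pi_1:\pi_1^{-1}(N')\to N'$ is a trivial principal bundle with structure group $\mathbb R^{k-m}\times T^m$, where $T^m$ is the $m$-dimensional torus; that is, $\mathbb R^{k-m}\times T^m$ acts smoothly on $\pi_1^{-1}(N')$ and there is an equivariant diffeomorphism $N'\times(\mathbb R^{k-m}\times T^m)\cong\pi_1^{-1}(N')$ over $N'$. -/

import Mathlib

open Set Manifold TopologicalSpace
open scoped Manifold ContDiff Topology

namespace PartialIntegrability

noncomputable section

/-! ### Symplectic manifolds -/

/-- The coordinate expression of a 2-form `Ω` in the preferred chart at `x`: the pullback of `Ω`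
along the inverse chart, a 2-form on (the chart's target in) Euclidean space. -/
def coordForm {d : ℕ} {M : Type*} [TopologicalSpace M] [ChartedSpace (EuclideanSpace ℝ (Fin d)) M]
    (Ω : ∀ x : M, TangentSpace (𝓡 d) x [⋀^Fin 2]→L[ℝ] ℝ) (x : M) (y : EuclideanSpace ℝ (Fin d)) :
    EuclideanSpace ℝ (Fin d) [⋀^Fin 2]→L[ℝ] ℝ :=
  (Ω ((extChartAt (𝓡 d) x).symm y)).compContinuousLinearMap
    (mfderiv 𝓘(ℝ, EuclideanSpace ℝ (Fin d)) (𝓡 d) (extChartAt (𝓡 d) x).symm y)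

/-- A symplectic form on a `d`-dimensional manifold `M`: a smooth, closed, nondegenerate 2-form.
Smoothness and closedness are local and chart-independent, and are expressed in charts. -/
structure SymplecticForm (d : ℕ) (M : Type*) [TopologicalSpace M]
    [ChartedSpace (EuclideanSpace ℝ (Fin d)) M] where
  /-- the value of the form at a point -/
  form : ∀ x : M, TangentSpace (𝓡 d) x [⋀^Fin 2]→L[ℝ] ℝ
  smooth : ∀ x : M, ContDiffOn ℝ ∞ (coordForm form x) (extChartAt (𝓡 d) x).target
  closed : ∀ x : M, ∀ y ∈ (extChartAt (𝓡 d) x).target, extDeriv (coordForm form x) y = 0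
  nondegenerate : ∀ (x : M) (v : TangentSpace (𝓡 d) x), (∀ w, form x ![v, w] = 0) → v = 0

namespace SymplecticForm

variable {d : ℕ} {M : Type*} [TopologicalSpace M] [ChartedSpace (EuclideanSpace ℝ (Fin d)) M]

/-- The linear map `v ↦ v ⌋ Ω` from tangent vectors to covectors at `x`. -/
def flat (Ω : SymplecticForm d M) (x : M) :
    TangentSpace (𝓡 d) x →ₗ[ℝ] Module.Dual ℝ (TangentSpace (𝓡 d) x) :=
  LinearMap.mk₂ ℝ (fun v w => Ω.form x ![v, w])
    (fun v v' w => (Ω.form x).toAlternatingMap.map_vecCons_add ![w] v v')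
    (fun c v w => (Ω.form x).toAlternatingMap.map_vecCons_smul ![w] c v)
    (fun v w w' => by
      have hu : ∀ a, Function.update ![v, w] 1 a = ![v, a] := fun a => by
        funext i; fin_cases i <;> rfl
      have h := (Ω.form x).map_update_add ![v, w] 1 w w'
      rwa [hu, hu, hu] at h)
    (fun c v w => by
      have hu : ∀ a, Function.update ![v, w] 1 a = ![v, a] := fun a => by
        funext i; fin_cases i <;> rfl
      have h := (Ω.form x).map_update_smul ![v, w] 1 c w
      rwa [hu, hu] at h)

lemma flat_bijective (Ω : SymplecticForm d M) (x : M) : Function.Bijective (Ω.flat x) := by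
  have : FiniteDimensional ℝ (TangentSpace (𝓡 d) x) :=
    inferInstanceAs (FiniteDimensional ℝ (EuclideanSpace ℝ (Fin d)))
  have hinj : Function.Injective (Ω.flat x) := by
    rw [injective_iff_map_eq_zero]
    intro v hv
    exact Ω.nondegenerate x v fun w => LinearMap.congr_fun hv w
  exact ⟨hinj, (LinearMap.injective_iff_surjective_of_finrank_eq_finrank
    Subspace.dual_finrank_eq.symm).1 hinj⟩

/-- The Hamiltonian vector field `ϑ` of a function `f`, determined by `ϑ ⌋ Ω = -df`. -/
def hamiltonianVectorField (Ω : SymplecticForm d M) (f : M → ℝ) (x : M) : TangentSpace (𝓡 d) x :=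
  (LinearEquiv.ofBijective (Ω.flat x) (Ω.flat_bijective x)).symm
    (-(mfderiv (𝓡 d) 𝓘(ℝ, ℝ) f x).toLinearMap)

lemma form_hamiltonianVectorField (Ω : SymplecticForm d M) (f : M → ℝ) (x : M)
    (w : TangentSpace (𝓡 d) x) :
    Ω.form x ![Ω.hamiltonianVectorField f x, w] = -(mfderiv (𝓡 d) 𝓘(ℝ, ℝ) f x w : ℝ) :=
  LinearMap.congr_fun ((LinearEquiv.ofBijective (Ω.flat x) (Ω.flat_bijective x)).apply_symm_apply
    (-(mfderiv (𝓡 d) 𝓘(ℝ, ℝ) f x).toLinearMap)) w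

/-- The Poisson bracket `{f, g} = Ω(ϑ_f, ϑ_g)`. -/
def poissonBracket (Ω : SymplecticForm d M) (f g : M → ℝ) (x : M) : ℝ :=
  Ω.form x ![Ω.hamiltonianVectorField f x, Ω.hamiltonianVectorField g x]

end SymplecticForm

/-! ### Partially integrable systems and their characteristic foliation -/

/-- The smooth functions `F₁, …, F_k` are pairwise in involution and independent almost everywhere:
the points at which `F = (F₁, …, F_k)` fails to be a submersion form a nowhere dense set. -/
structure IsPartiallyIntegrable {d k : ℕ} {Z : Type*} [TopologicalSpace Z]
    [ChartedSpace (EuclideanSpace ℝ (Fin d)) Z] (Ω : SymplecticForm d Z) (F : Fin k → Z → ℝ) :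
    Prop where
  smooth : ∀ i, ContMDiff (𝓡 d) 𝓘(ℝ, ℝ) ∞ (F i)
  involution : ∀ i j z, Ω.poissonBracket (F i) (F j) z = 0
  independent : IsNowhereDense
    {z : Z | ¬ IsSubmersionAt (𝓡 d) 𝓘(ℝ, Fin k → ℝ) ∞ (fun z i => F i z) z}

/-- On the open set `UW`, the characteristic foliation of `F` (the foliation tangent to the
distribution spanned by the Hamiltonian vector fields of the `F i`) is a fibred manifold
`π₁ : UW → S`: the map `π₁` is a surjective submersion, its vertical tangent spaces are spanned by
the Hamiltonian vector fields, and its fibres are connected, so that they are the leaves.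
Values of `π₁` outside `UW` are irrelevant. -/
structure IsCharacteristicFibration {d e k : ℕ} {Z : Type*} [TopologicalSpace Z]
    [ChartedSpace (EuclideanSpace ℝ (Fin d)) Z] (Ω : SymplecticForm d Z) (F : Fin k → Z → ℝ)
    (UW : Set Z) {S : Type*} [TopologicalSpace S] [ChartedSpace (EuclideanSpace ℝ (Fin e)) S]
    (π₁ : Z → S) : Prop where
  surjOn : SurjOn π₁ UW univ
  submersion : ∀ z ∈ UW, IsSubmersionAt (𝓡 d) (𝓡 e) ∞ π₁ z
  vertical : ∀ z ∈ UW, (mfderiv (𝓡 d) (𝓡 e) π₁ z).toLinearMap.ker =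
    Submodule.span ℝ (range fun i => Ω.hamiltonianVectorField (F i) z)
  connected : ∀ s, IsConnected (UW ∩ π₁ ⁻¹' {s})

/-! ### Diffeomorphic subsets, complete vector fields, domains -/

/-- A map is smooth on a subset `A` of a manifold if near every point of `A` it extends from `A` to
a smooth map on an open set. For an embedded submanifold `A` this is smoothness on `A`. -/
def IsSmoothOnSubset (d : ℕ) {M : Type*} [TopologicalSpace M]
    [ChartedSpace (EuclideanSpace ℝ (Fin d)) M] (A : Set M) (f : M → M) : Prop :=
  ∀ x ∈ A, ∃ V : Set M, IsOpen V ∧ x ∈ V ∧ ∃ g : M → M,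
    ContMDiffOn (𝓡 d) (𝓡 d) ∞ g V ∧ EqOn f g (A ∩ V)

/-- Two (embedded) subsets `A`, `B` of a manifold are diffeomorphic. -/
def AreDiffeomorphic (d : ℕ) {M : Type*} [TopologicalSpace M]
    [ChartedSpace (EuclideanSpace ℝ (Fin d)) M] (A B : Set M) : Prop :=
  ∃ f g : M → M, MapsTo f A B ∧ MapsTo g B A ∧ LeftInvOn g f A ∧ RightInvOn g f B ∧
    IsSmoothOnSubset d A f ∧ IsSmoothOnSubset d B g

/-- The vector field `X` is complete on the set `U`: through every point of `U` there passes an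
integral curve in `U` defined for all times. -/
def IsCompleteOn {d : ℕ} {M : Type*} [TopologicalSpace M]
    [ChartedSpace (EuclideanSpace ℝ (Fin d)) M] (X : ∀ x : M, TangentSpace (𝓡 d) x)
    (U : Set M) : Prop :=
  ∀ u ∈ U, ∃ γ : ℝ → M, γ 0 = u ∧ (∀ t, γ t ∈ U) ∧ IsMIntegralCurve (I := 𝓡 d) γ X

/-- A domain is a nonempty connected open set. -/
def IsDomainSet {X : Type*} [TopologicalSpace X] (N : Set X) : Prop := IsOpen N ∧ IsConnected N

/-! ### The group `ℝˡ × Tᵐ` and trivial principal bundles -/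

/-- The manifold `ℝˡ × Tᵐ`, where `Tᵐ` is the `m`-fold product of the unit circle. -/
def Cylinder (l m : ℕ) : Type := EuclideanSpace ℝ (Fin l) × (Fin m → Circle)

namespace Cylinder

/-- The group structure of `ℝˡ × Tᵐ`, written multiplicatively: addition in `ℝˡ`, multiplication
of unit complex numbers in each factor of `Tᵐ`. -/
instance (l m : ℕ) : CommGroup (Cylinder l m) :=
  inferInstanceAs (CommGroup (Multiplicative (EuclideanSpace ℝ (Fin l)) × (Fin m → Circle)))

instance (l m : ℕ) : TopologicalSpace (Cylinder l m) :=
  inferInstanceAs (TopologicalSpace (EuclideanSpace ℝ (Fin l) × (Fin m → Circle)))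

/-- The model space of `ℝˡ × Tᵐ`. -/
abbrev Model (l m : ℕ) : Type :=
  ModelProd (EuclideanSpace ℝ (Fin l)) (ModelPi fun _ : Fin m => EuclideanSpace ℝ (Fin 1))

/-- The product smooth structure. -/
instance (l m : ℕ) : ChartedSpace (Model l m) (Cylinder l m) :=
  inferInstanceAs (ChartedSpace (Model l m) (EuclideanSpace ℝ (Fin l) × (Fin m → Circle)))

/-- The model with corners of `ℝˡ × Tᵐ`. -/
abbrev model (l m : ℕ) :
    ModelWithCorners ℝ (EuclideanSpace ℝ (Fin l) × (Fin m → EuclideanSpace ℝ (Fin 1)))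
      (Model l m) :=
  (𝓡 l).prod (ModelWithCorners.pi fun _ : Fin m => 𝓡 1)

end Cylinder

/-- `p : P → B` is a trivial principal bundle with (commutative) structure group `G`: the group `G`
acts smoothly on `P`, and there is a `G`-equivariant diffeomorphism `B × G ≃ P` over `B`, where `G`
acts on `B × G` by translations of the second factor. In particular, the action is free and its
orbits are the fibres of `p`. -/
def IsTrivialPrincipalBundle
    {EB HB EP HP EG HG : Type*} [NormedAddCommGroup EB] [NormedSpace ℝ EB] [TopologicalSpace HB]
    [NormedAddCommGroup EP] [NormedSpace ℝ EP] [TopologicalSpace HP]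
    [NormedAddCommGroup EG] [NormedSpace ℝ EG] [TopologicalSpace HG]
    (IB : ModelWithCorners ℝ EB HB) (IP : ModelWithCorners ℝ EP HP) (IG : ModelWithCorners ℝ EG HG)
    (G : Type*) [CommGroup G] [TopologicalSpace G] [ChartedSpace HG G]
    {B P : Type*} [TopologicalSpace B] [ChartedSpace HB B] [TopologicalSpace P] [ChartedSpace HP P]
    (p : P → B) : Prop :=
  ∃ (_ : MulAction G P) (Φ : Diffeomorph (IB.prod IG) IP (B × G) P ∞),
    ContMDiffSMul IG IP ∞ G P ∧
    (∀ b g, p (Φ (b, g)) = b) ∧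
    ∀ b g h, Φ (b, g * h) = g • Φ (b, h)

end

end PartialIntegrability

open PartialIntegrability

-- On the part `V` of `UW` over `N`, the Hamiltonian fields are linearly independent, vertical and
-- complete. They commute, because involution together with closedness of the symplectic form makes
-- their Lie brackets vanish. Their flows therefore combine into a smooth action of `ℝᵏ` on `V` that
-- preserves `π₁` and is locally free (`flow_comm`, `isLocallyFreeSmoothAction_jointFlow`). The
-- fibres have dimension `k`, so orbits are open in fibres; since fibres are connected, each fibre
-- is a single orbit (`exists_vadd_eq`).
--
-- A fibre is thus the quotient of `ℝᵏ` by a discrete group of periods, and the orbit map is a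
-- covering by a simply connected space (`isAddQuotientCoveringMap_orbit`). The period group is then
-- determined up to isomorphism by the fundamental group of the fibre. Mutually diffeomorphic fibres
-- have period lattices of one common rank `m` (`finrank_stabilizer_eq`), and this fixes the
-- structure group.
--
-- For local triviality, take a local section `s` of `π₁`. The inverse function theorem applied to
-- `(t, r) ↦ t +ᵥ s r` gives a smooth time function near the section (`exists_time`), and it extends
-- every period over a point to a smooth family of periods. Constancy of the rank, with a
-- compactness argument on the unit cell, shows that a basis extended in this way still generates
-- all nearby lattices (`exists_smooth_period_basis`). Completing it by a fixed complement gives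
-- isomorphisms `L r` onto `ℝᵏ` taking `ℤᵐ` to the lattice over `r`; then `(r, a) ↦ L r a +ᵥ s r`
-- descends to the required trivialization (`isTrivialPrincipalBundle`).
--
-- The analytic input is smooth dependence of flows on time and initial value. Integral curves are
-- the zeros of the Picard operator on a Banach space of continuous curves, where composition with a
-- smooth map is smooth, and the implicit function theorem gives the local statement. One-parameter
-- group arguments extend it to all times.

universe u

/-! ### Smoothness of composition operators on spaces of continuous maps -/

namespace ContinuousMap

variable {K : Type*} [TopologicalSpace K] [CompactSpace K]

/-- Pointwise application of a continuous family of continuous linear maps, as a bounded bilinear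
operation. -/
noncomputable def pointwiseApplyL (E F : Type*) [NormedAddCommGroup E] [NormedSpace ℝ E]
    [NormedAddCommGroup F] [NormedSpace ℝ F] :
    C(K, E →L[ℝ] F) →L[ℝ] C(K, E) →L[ℝ] C(K, F) :=
  LinearMap.mkContinuous₂
    (LinearMap.mk₂ ℝ (fun (A : C(K, E →L[ℝ] F)) (h : C(K, E)) =>
        (⟨fun x => A x (h x), by fun_prop⟩ : C(K, F)))
      (fun _ _ _ => by ext; simp) (fun _ _ _ => by ext; simp)
      (fun _ _ _ => by ext; simp) (fun _ _ _ => by ext; simp)) 1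
    (fun A h => by
      refine (ContinuousMap.norm_le _ (by positivity)).2 fun x => ?_
      rw [one_mul]
      exact (A x).le_of_opNorm_le_of_le (A.norm_coe_le_norm x) (h.norm_coe_le_norm x))

@[simp] lemma pointwiseApplyL_apply {E F : Type*} [NormedAddCommGroup E] [NormedSpace ℝ E]
    [NormedAddCommGroup F] [NormedSpace ℝ F] (A : C(K, E →L[ℝ] F)) (h : C(K, E)) (x : K) :
    pointwiseApplyL E F A h x = A x (h x) := rfl

/-- Compactness of `K` makes the image of `γ` compact, so a single radius `δ` controls the
oscillation of `f'` around all its points. The mean value inequality on the balls of radius `δ` then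
bounds the remainder uniformly in `x`. -/
lemma hasFDerivAt_comp_left {E F : Type*} [NormedAddCommGroup E] [NormedSpace ℝ E]
    [NormedAddCommGroup F] [NormedSpace ℝ F] (f : C(E, F)) (f' : C(E, E →L[ℝ] F))
    (hf : ∀ x, HasFDerivAt f (f' x) x) (γ : C(K, E)) :
    HasFDerivAt (fun γ : C(K, E) => f.comp γ) (pointwiseApplyL E F (f'.comp γ)) γ := by
  rw [hasFDerivAt_iff_isLittleO_nhds_zero, Asymptotics.isLittleO_iff]
  intro c hc
  have hcomp : IsCompact (range γ) := isCompact_range γ.continuous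
  have hu := hcomp.uniformContinuousAt_of_continuousAt f'
    (fun a _ => f'.continuous.continuousAt) (Metric.dist_mem_uniformity hc)
  obtain ⟨δ, hδ, hδu⟩ := Metric.mem_uniformity_dist.1 hu
  filter_upwards [Metric.ball_mem_nhds (0 : C(K, E)) hδ] with h hh
  rw [mem_ball_zero_iff] at hh
  refine (ContinuousMap.norm_le _ (by positivity)).2 fun x => ?_
  have hx : ‖h x‖ ≤ ‖h‖ := h.norm_coe_le_norm x
  have key := Convex.norm_image_sub_le_of_norm_hasFDerivWithin_le' (𝕜 := ℝ) (f := f) (f' := f')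
    (φ := f' (γ x)) (C := c) (s := Metric.ball (γ x) δ) (x := γ x) (y := γ x + h x)
    (fun y _ => (hf y).hasFDerivWithinAt)
    (fun y hy => by
      have h1 : (γ x, y) ∈ {p : E × E | p.1 ∈ range γ → (f' p.1, f' p.2) ∈
          {p : (E →L[ℝ] F) × (E →L[ℝ] F) | dist p.1 p.2 < c}} :=
        hδu (a := γ x) (b := y) (by rw [dist_comm]; exact hy)
      have h2 := h1 ⟨x, rfl⟩
      rw [← dist_eq_norm, dist_comm]
      exact le_of_lt h2)
    (convex_ball _ _) (Metric.mem_ball_self hδ)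
    (by rw [Metric.mem_ball, dist_eq_norm]; simpa using hx.trans_lt hh)
  rw [add_sub_cancel_left] at key
  exact key.trans (mul_le_mul_of_nonneg_left hx hc.le)

/-- Composition with a `C^n` map is a `C^n` map between spaces of continuous functions. -/
theorem contDiff_comp_left {E : Type u} [NormedAddCommGroup E] [NormedSpace ℝ E] (n : ℕ) :
    ∀ {F : Type u} [NormedAddCommGroup F] [NormedSpace ℝ F] (f : C(E, F)), ContDiff ℝ n f →
      ContDiff ℝ n (fun γ : C(K, E) => f.comp γ) := by
  induction n with
  | zero =>
    intro F _ _ f _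
    exact contDiff_zero.2 (ContinuousMap.continuous_postcomp f)
  | succ n ih =>
    intro F _ _ f hf
    have hf' : ContDiff ℝ n (fderiv ℝ f) := hf.fderiv_right (by norm_cast)
    have hd : Differentiable ℝ f := hf.differentiable (by simp)
    -- The hypothesis is applied with target `E →L[ℝ] F`. This is why `F` is quantified inside the
    -- induction and lives in the same universe as `E`.
    have := ih ⟨fderiv ℝ f, hf'.continuous⟩ hf'
    have hsucc := contDiff_succ_iff_hasFDerivAt (𝕜 := ℝ) (n := n)
      (f := fun γ : C(K, E) => f.comp γ)
    push_cast
    refine hsucc.2 ⟨fun γ => pointwiseApplyL E F (ContinuousMap.comp ⟨fderiv ℝ f, hf'.continuous⟩ γ),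
      this.continuousLinearMap_comp (pointwiseApplyL E F), fun γ => ?_⟩
    exact hasFDerivAt_comp_left f ⟨fderiv ℝ f, hf'.continuous⟩ (fun x => (hd x).hasFDerivAt) γ

theorem contDiff_infty_comp_left {E F : Type u} [NormedAddCommGroup E] [NormedSpace ℝ E]
    [NormedAddCommGroup F] [NormedSpace ℝ F] (f : C(E, F)) (hf : ContDiff ℝ ∞ f) :
    ContDiff ℝ ∞ (fun γ : C(K, E) => f.comp γ) :=
  contDiff_infty.2 fun n => contDiff_comp_left n f (contDiff_infty.1 hf n)

end ContinuousMap

/-! ### Smooth dependence of local flows on initial values -/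

namespace LocalFlow

variable {E : Type u} [NormedAddCommGroup E]

/-- The interval on which rescaled integral curves are considered. -/
abbrev Interval : Type := Icc (-1 : ℝ) 1

/-- A continuous function on `[-1, 1]`, extended to the line by constants. -/
noncomputable def extend (γ : C(Interval, E)) (t : ℝ) : E :=
  γ (projIcc (-1) 1 (by norm_num) t)

lemma continuous_extend (γ : C(Interval, E)) : Continuous (extend γ) :=
  γ.continuous.comp continuous_projIcc

lemma extend_of_mem (γ : C(Interval, E)) {t : ℝ} (ht : t ∈ Icc (-1 : ℝ) 1) :
    extend γ t = γ ⟨t, ht⟩ := by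
  rw [extend, projIcc_of_mem _ ht]

lemma norm_extend_le (γ : C(Interval, E)) (t : ℝ) : ‖extend γ t‖ ≤ ‖γ‖ := γ.norm_coe_le_norm _

/-- Integration from `0`, as a bounded operator on continuous functions on `[-1, 1]`. -/
noncomputable def integralL (E : Type u) [NormedAddCommGroup E] [NormedSpace ℝ E] :
    C(Interval, E) →L[ℝ] C(Interval, E) :=
  LinearMap.mkContinuous
    { toFun := fun γ => ⟨fun t => ∫ τ in (0 : ℝ)..t, extend γ τ,
        (intervalIntegral.continuous_primitive
          (fun a b => (continuous_extend γ).intervalIntegrable a b) 0).comp continuous_subtype_val⟩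
      map_add' := fun γ δ => by
        ext t
        exact intervalIntegral.integral_add ((continuous_extend γ).intervalIntegrable _ _)
          ((continuous_extend δ).intervalIntegrable _ _)
      map_smul' := fun c γ => by
        ext t
        exact intervalIntegral.integral_smul c (extend γ) } 1
    (fun γ => by
      rw [one_mul]
      refine (ContinuousMap.norm_le _ (norm_nonneg _)).2 fun t => ?_
      refine (intervalIntegral.norm_integral_le_of_norm_le_const
        fun τ _ => norm_extend_le γ τ).trans ?_
      have : |(t : ℝ) - 0| ≤ 1 := by rw [sub_zero]; exact abs_le.2 t.2
      nlinarith [norm_nonneg γ])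

lemma integralL_apply [NormedSpace ℝ E] (γ : C(Interval, E)) (t : Interval) :
    integralL E γ t = ∫ τ in (0 : ℝ)..t, extend γ τ := rfl

variable [NormedSpace ℝ E] [CompleteSpace E]

/-- The hypothesis is the Picard integral equation for `γ' = c f(γ)`, `γ 0 = x`. The equation holds
only on `[-1, 1]`, outside which `extend γ` is constant, so derivatives are taken in the open
interval. -/
lemma hasDerivAt_extend_of_eq (f : C(E, E)) (x : E) (c : ℝ) (γ : C(Interval, E))
    (h : γ - ContinuousMap.const _ x - c • integralL E (f.comp γ) = 0) :
    extend γ 0 = x ∧ ∀ t ∈ Ioo (-1 : ℝ) 1, HasDerivAt (extend γ) (c • f (extend γ t)) t := by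
  have hγ : ∀ t ∈ Icc (-1 : ℝ) 1, extend γ t = x + c • ∫ τ in (0 : ℝ)..t, f (extend γ τ) := by
    intro t ht
    have := congrArg (fun g : C(Interval, E) => g ⟨t, ht⟩) h
    simp only [ContinuousMap.sub_apply, ContinuousMap.const_apply, ContinuousMap.smul_apply,
      ContinuousMap.zero_apply, integralL_apply] at this
    rw [extend_of_mem γ ht, ← sub_eq_zero, ← this]
    have : extend (f.comp γ) = fun τ => f (extend γ τ) := rfl
    rw [this]
    abel
  refine ⟨by simpa using hγ 0 (by norm_num), fun t ht => ?_⟩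
  have hcont : Continuous fun τ => f (extend γ τ) := f.continuous.comp (continuous_extend γ)
  have hd := ((hcont.integral_hasStrictDerivAt 0 t).hasDerivAt.const_smul c).const_add x
  refine hd.congr_of_eventuallyEq ?_
  filter_upwards [Icc_mem_nhds ht.1 ht.2] with s hs
  exact hγ s hs

/-- The flow of a smooth vector field defined on the whole space, for small times. -/
theorem exists_contDiffAt_of_contDiff {f : E → E} (hf : ContDiff ℝ ∞ f) (x₀ : E) :
    ∃ ψ : ℝ × E → E, ContDiffAt ℝ ∞ ψ (0, x₀) ∧ ∀ O ∈ 𝓝 x₀, ∀ᶠ p in 𝓝 ((0 : ℝ), x₀),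
      ∃ γ : ℝ → E, γ 0 = p.2 ∧ γ (1 / 2) = ψ p ∧
        ∀ t ∈ Ioo (-1 : ℝ) 1, γ t ∈ O ∧ HasDerivAt γ ((2 * p.1) • f (γ t)) t := by
  set fc : C(E, E) := ⟨f, hf.continuous⟩
  -- The Picard operator with parameters `(time, initial value)`. Time enters as the speed `2 *
  -- time` of a curve on the fixed interval `[-1, 1]`, so all curves lie in one Banach space.
  set G : (ℝ × E) × C(Interval, E) → C(Interval, E) := fun q =>
    q.2 - ContinuousMap.const _ q.1.2 - (2 * q.1.1) • integralL E (fc.comp q.2) with hG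
  let constL : E →L[ℝ] C(Interval, E) := ContinuousLinearMap.const ℝ Interval
  have hGs : ContDiff ℝ ∞ G := by
    have h1 : ContDiff ℝ ∞ fun q : (ℝ × E) × C(Interval, E) =>
        integralL E (fc.comp q.2) :=
      ContDiff.continuousLinearMap_comp (f := fun q : (ℝ × E) × C(Interval, E) => fc.comp q.2)
        (integralL E) ((ContinuousMap.contDiff_infty_comp_left fc hf).comp contDiff_snd)
    have h2 : ContDiff ℝ ∞ fun q : (ℝ × E) × C(Interval, E) =>
        (ContinuousMap.const Interval q.1.2 : C(Interval, E)) :=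
      ContDiff.continuousLinearMap_comp (f := fun q : (ℝ × E) × C(Interval, E) => q.1.2) constL
        contDiff_fst.snd
    exact (contDiff_snd.sub h2).sub ((contDiff_const.mul contDiff_fst.fst).smul h1)
  set u : (ℝ × E) × C(Interval, E) := ((0, x₀), ContinuousMap.const _ x₀) with hu
  have hGu : G u = 0 := by simp [hG, hu]
  -- At speed zero the integral term disappears and `G` is `γ` minus a constant, so the partial
  -- derivative in `γ` is the identity.
  have hinv : (fderiv ℝ G u ∘L .inr ℝ (ℝ × E) C(Interval, E)).IsInvertible := by
    have h1 : HasFDerivAt (fun γ => G ((0, x₀), γ))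
        (fderiv ℝ G u ∘L .inr ℝ (ℝ × E) C(Interval, E)) (ContinuousMap.const _ x₀) := by
      have := (hGs.differentiable (by simp) u).hasFDerivAt
      exact this.comp (ContinuousMap.const _ x₀) (hasFDerivAt_prodMk_right _ _)
    have h2 : HasFDerivAt (fun γ => G ((0, x₀), γ)) (.id ℝ C(Interval, E))
        (ContinuousMap.const _ x₀) := by
      have : (fun γ => G ((0, x₀), γ)) = fun γ => γ - ContinuousMap.const _ x₀ := by
        funext γ; simp [hG]
      rw [this]
      exact (hasFDerivAt_id _).sub_const _
    rw [h1.unique h2]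
    exact ⟨.refl ℝ _, rfl⟩
  have hGu' : ContDiffAt ℝ ∞ G u := hGs.contDiffAt
  have hn : (∞ : WithTop ℕ∞) ≠ 0 := by simp
  set g := hGu'.implicitFunction hn hinv
  have hg : ContDiffAt ℝ ∞ g (0, x₀) := hGu'.contDiffAt_implicitFunction hn hinv
  have hg0 : g (0, x₀) = ContinuousMap.const _ x₀ := hGu'.implicitFunction_apply_self hn hinv
  -- At speed `2 * p.1` the parameter `1 / 2` corresponds to time `p.1`. It is interior to `(-1,
  -- 1)`, so uniqueness on the open interval can be evaluated there.
  have hmem : (1 / 2 : ℝ) ∈ Icc (-1 : ℝ) 1 := by norm_num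
  let ev : C(Interval, E) →L[ℝ] E := ContinuousMap.evalCLM ℝ ⟨1 / 2, hmem⟩
  refine ⟨fun p => ev (g p), (hg.continuousLinearMap_comp ev :), fun O hO => ?_⟩
  obtain ⟨ε, hε, hεO⟩ := Metric.mem_nhds_iff.1 hO
  have hcont : Filter.Tendsto g (𝓝 (0, x₀)) (𝓝 (ContinuousMap.const _ x₀)) := by
    rw [← hg0]; exact hg.continuousAt
  have heq := hGu'.eventually_apply_implicitFunction hn hinv
  filter_upwards [heq, hcont (Metric.ball_mem_nhds _ hε)] with p hp hpε
  rw [hGu] at hp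
  obtain ⟨h0, hd⟩ := hasDerivAt_extend_of_eq fc p.2 (2 * p.1) (g p) hp
  refine ⟨extend (g p), h0, extend_of_mem _ hmem, fun t ht => ⟨hεO ?_, hd t ht⟩⟩
  exact (ContinuousMap.dist_apply_le_dist (f := g p) (g := ContinuousMap.const _ x₀) _).trans_lt hpε

/-- The flow of a vector field which is smooth near a point, for small times. -/
theorem exists_contDiffAt [FiniteDimensional ℝ E] {f : E → E} {x₀ : E}
    (hf : ∀ᶠ x in 𝓝 x₀, ContDiffAt ℝ ∞ f x) :
    ∃ ψ : ℝ × E → E, ContDiffAt ℝ ∞ ψ (0, x₀) ∧ ∀ O ∈ 𝓝 x₀, ∀ᶠ p in 𝓝 ((0 : ℝ), x₀),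
      ∃ γ : ℝ → E, γ 0 = p.2 ∧ γ (1 / 2) = ψ p ∧
        ∀ t ∈ Ioo (-1 : ℝ) 1, γ t ∈ O ∧ HasDerivAt γ ((2 * p.1) • f (γ t)) t := by
  obtain ⟨ε, hε, hfε⟩ := Metric.eventually_nhds_iff_ball.1 hf
  -- The cut-off field is smooth on the whole space: its support lies within radius `ε / 2`, inside
  -- the ball on which `f` is smooth. It agrees with `f` within radius `ε / 4`.
  let χ : ContDiffBump x₀ := ⟨ε / 4, ε / 2, by positivity, by linarith⟩
  have hsm : ContDiff ℝ ∞ fun x => χ x • f x := by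
    rw [contDiff_iff_contDiffAt]
    intro x
    by_cases hx : x ∈ Metric.ball x₀ ε
    · exact χ.contDiffAt.smul (hfε x hx)
    · have : (fun x => χ x • f x) =ᶠ[𝓝 x] fun _ => 0 := by
        have hx' : x ∉ tsupport χ := by
          rw [χ.tsupport_eq]
          intro h
          exact hx (Metric.closedBall_subset_ball (by change ε / 2 < ε; linarith) h)
        filter_upwards [notMem_tsupport_iff_eventuallyEq.1 hx'] with y hy
        rw [hy]; simp
      exact contDiffAt_const.congr_of_eventuallyEq this
  obtain ⟨ψ, hψ, h⟩ := exists_contDiffAt_of_contDiff hsm x₀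
  refine ⟨ψ, hψ, fun O hO => ?_⟩
  -- Curves confined to the ball where `χ = 1` are integral curves of `f` itself.
  filter_upwards [h (O ∩ Metric.ball x₀ (ε / 4))
    (Filter.inter_mem hO (Metric.ball_mem_nhds _ (by positivity)))] with p ⟨γ, h0, h1, h2⟩
  refine ⟨γ, h0, h1, fun t ht => ⟨(h2 t ht).1.1, ?_⟩⟩
  have := (h2 t ht).2
  rwa [χ.one_of_mem_closedBall (Metric.ball_subset_closedBall (h2 t ht).1.2), one_smul] at this

end LocalFlow

/-! ### Vector fields in charts -/

namespace ManifoldFlow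

variable {E : Type u} [NormedAddCommGroup E] [NormedSpace ℝ E]
  {M : Type*} [TopologicalSpace M] [ChartedSpace E M]

/-- The coordinate expression of a vector field in the preferred chart at `x₀`. -/
noncomputable def chartField (X : ∀ x : M, TangentSpace 𝓘(ℝ, E) x) (x₀ : M) (y : E) : E :=
  mfderiv 𝓘(ℝ, E) 𝓘(ℝ, E) (extChartAt 𝓘(ℝ, E) x₀) ((extChartAt 𝓘(ℝ, E) x₀).symm y)
    (X ((extChartAt 𝓘(ℝ, E) x₀).symm y))

/-- A vector field is smooth if its expressions in the preferred charts are. -/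
def IsSmoothField (X : ∀ x : M, TangentSpace 𝓘(ℝ, E) x) : Prop :=
  ∀ x₀ : M, ∀ y ∈ (extChartAt 𝓘(ℝ, E) x₀).target, ContDiffAt ℝ ∞ (chartField X x₀) y

lemma chartField_extChartAt (X : ∀ x : M, TangentSpace 𝓘(ℝ, E) x) {x₀ x : M}
    (hx : x ∈ (extChartAt 𝓘(ℝ, E) x₀).source) :
    chartField X x₀ (extChartAt 𝓘(ℝ, E) x₀ x) =
      mfderiv 𝓘(ℝ, E) 𝓘(ℝ, E) (extChartAt 𝓘(ℝ, E) x₀) x (X x) := by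
  rw [chartField, (extChartAt 𝓘(ℝ, E) x₀).left_inv hx]

lemma isSmoothField_smul {X : ∀ x : M, TangentSpace 𝓘(ℝ, E) x} (hX : IsSmoothField X) (c : ℝ) :
    IsSmoothField (c • X) := by
  intro x₀ y hy
  have : chartField (c • X) x₀ = fun y => c • chartField X x₀ y := by
    funext y
    exact map_smul (mfderiv 𝓘(ℝ, E) 𝓘(ℝ, E) (extChartAt 𝓘(ℝ, E) x₀)
      ((extChartAt 𝓘(ℝ, E) x₀).symm y)) c _
  rw [this]
  exact contDiffAt_const.smul (hX x₀ y hy)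

lemma extChartAt_target_mem_nhds_of_mem {x₀ : M} {y : E}
    (hy : y ∈ (extChartAt 𝓘(ℝ, E) x₀).target) : (extChartAt 𝓘(ℝ, E) x₀).target ∈ 𝓝 y :=
  (isOpen_extChartAt_target x₀).mem_nhds hy

variable [IsManifold 𝓘(ℝ, E) ∞ M]

lemma contMDiffAt_extChartAt_symm {x₀ : M} {y : E} (hy : y ∈ (extChartAt 𝓘(ℝ, E) x₀).target) :
    ContMDiffAt 𝓘(ℝ, E) 𝓘(ℝ, E) ∞ (extChartAt 𝓘(ℝ, E) x₀).symm y :=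
  (contMDiffOn_extChartAt_symm x₀ y hy).contMDiffAt (extChartAt_target_mem_nhds_of_mem hy)

lemma contMDiffAt_extChartAt_of_mem {x₀ x : M} (hx : x ∈ (extChartAt 𝓘(ℝ, E) x₀).source) :
    ContMDiffAt 𝓘(ℝ, E) 𝓘(ℝ, E) ∞ (extChartAt 𝓘(ℝ, E) x₀) x :=
  contMDiffAt_extChartAt' (by rwa [extChartAt_source] at hx)

lemma mfderiv_extChartAt_symm_chartField (X : ∀ x : M, TangentSpace 𝓘(ℝ, E) x) {x₀ : M} {y : E}
    (hy : y ∈ (extChartAt 𝓘(ℝ, E) x₀).target) :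
    mfderiv 𝓘(ℝ, E) 𝓘(ℝ, E) (extChartAt 𝓘(ℝ, E) x₀).symm y (chartField (E := E) X x₀ y) =
      X ((extChartAt 𝓘(ℝ, E) x₀).symm y) := by
  have h := mfderivWithin_extChartAt_symm_comp_mfderiv_extChartAt' (I := 𝓘(ℝ, E)) (x := x₀)
    (y := (extChartAt 𝓘(ℝ, E) x₀).symm y) ((extChartAt 𝓘(ℝ, E) x₀).map_target hy)
  rw [(extChartAt 𝓘(ℝ, E) x₀).right_inv hy] at h
  simp only [modelWithCornersSelf_coe, range_id, mfderivWithin_univ] at h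
  exact congrArg (fun A => A (X ((extChartAt 𝓘(ℝ, E) x₀).symm y))) h

/-- A smooth vector field is a smooth section of the tangent bundle. -/
lemma IsSmoothField.contMDiff {X : ∀ x : M, TangentSpace 𝓘(ℝ, E) x} (hX : IsSmoothField X) :
    ContMDiff 𝓘(ℝ, E) 𝓘(ℝ, E).tangent 1
      (fun x => (⟨x, X x⟩ : TangentBundle 𝓘(ℝ, E) M)) := by
  intro x₀
  rw [Bundle.contMDiffAt_section]
  have h1 : ContMDiffAt 𝓘(ℝ, E) 𝓘(ℝ, E) ∞
      (chartField X x₀ ∘ extChartAt 𝓘(ℝ, E) x₀) x₀ :=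
    (hX x₀ _ (mem_extChartAt_target x₀)).contMDiffAt.comp x₀ contMDiffAt_extChartAt
  refine (h1.congr_of_eventuallyEq ?_).of_le (by exact_mod_cast le_top)
  filter_upwards [extChartAt_source_mem_nhds (I := 𝓘(ℝ, E)) x₀] with x hx
  rw [Function.comp_apply, chartField_extChartAt X hx]
  rw [extChartAt_source] at hx
  rw [← TangentBundle.continuousLinearMapAt_trivializationAt hx]
  exact (Bundle.Trivialization.continuousLinearMapAt_apply_of_mem ℝ
    (trivializationAt E (TangentSpace 𝓘(ℝ, E)) x₀)
    (by rwa [TangentBundle.trivializationAt_baseSet]) _).symm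

lemma hasMFDerivAt_extChartAt_symm_comp {X : ∀ x : M, TangentSpace 𝓘(ℝ, E) x} {x₀ : M}
    {γ : ℝ → E} {t c : ℝ} (ht : γ t ∈ (extChartAt 𝓘(ℝ, E) x₀).target)
    (hγ : HasDerivAt γ (c • chartField X x₀ (γ t)) t) :
    HasMFDerivAt 𝓘(ℝ, ℝ) 𝓘(ℝ, E) ((extChartAt 𝓘(ℝ, E) x₀).symm ∘ γ) t
      ((1 : ℝ →L[ℝ] ℝ).smulRight (c • X ((extChartAt 𝓘(ℝ, E) x₀).symm (γ t)))) := by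
  have h1 := ((contMDiffAt_extChartAt_symm ht).mdifferentiableAt (by simp)).hasMFDerivAt
  have h2 : HasMFDerivAt 𝓘(ℝ, ℝ) 𝓘(ℝ, E) γ t
    ((1 : ℝ →L[ℝ] ℝ).smulRight (c • chartField X x₀ (γ t))) := hγ.hasFDerivAt.hasMFDerivAt
  refine (h1.comp t h2).congr_mfderiv ?_
  rw [← mfderiv_extChartAt_symm_chartField X ht]
  let A : E →L[ℝ] E := mfderiv 𝓘(ℝ, E) 𝓘(ℝ, E) (extChartAt 𝓘(ℝ, E) x₀).symm (γ t)
  refine ContinuousLinearMap.ext fun (a : ℝ) => ?_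
  change A (a • c • chartField X x₀ (γ t)) = a • c • A (chartField X x₀ (γ t))
  rw [map_smul, map_smul]

lemma hasDerivAt_extChartAt_comp {X : ∀ x : M, TangentSpace 𝓘(ℝ, E) x} {x₀ : M}
    {γ : ℝ → M} {t : ℝ} (ht : γ t ∈ (extChartAt 𝓘(ℝ, E) x₀).source)
    (hγ : HasMFDerivAt 𝓘(ℝ, ℝ) 𝓘(ℝ, E) γ t ((1 : ℝ →L[ℝ] ℝ).smulRight (X (γ t)))) :
    HasDerivAt (extChartAt 𝓘(ℝ, E) x₀ ∘ γ)
      (chartField X x₀ (extChartAt 𝓘(ℝ, E) x₀ (γ t))) t := by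
  have h1 := ((contMDiffAt_extChartAt_of_mem ht).mdifferentiableAt (by simp)).hasMFDerivAt
  rw [chartField_extChartAt X ht]
  let A : E →L[ℝ] E := mfderiv 𝓘(ℝ, E) 𝓘(ℝ, E) (extChartAt 𝓘(ℝ, E) x₀) (γ t)
  let v : E := X (γ t)
  change HasDerivAt _ (A v) t
  have h2 : HasMFDerivAt 𝓘(ℝ, ℝ) 𝓘(ℝ, E) (extChartAt 𝓘(ℝ, E) x₀ ∘ γ) t
      ((1 : ℝ →L[ℝ] ℝ).smulRight (A v)) := by
    refine (h1.comp t hγ).congr_mfderiv (ContinuousLinearMap.ext fun (a : ℝ) => ?_)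
    change A (a • v) = a • A v
    rw [map_smul]
  have h3 : HasFDerivAt (extChartAt 𝓘(ℝ, E) x₀ ∘ γ) ((1 : ℝ →L[ℝ] ℝ).smulRight (A v)) t :=
    h2.hasFDerivAt
  exact h3.hasDerivAt.congr_deriv (by simp)

/-! ### The flow of a complete vector field -/

variable (X : ∀ x : M, TangentSpace 𝓘(ℝ, E) x) (V : Set M)

/-- Through every point of `V` there passes a global integral curve in `V`. -/
def IsCompleteField : Prop :=
  ∀ u ∈ V, ∃ γ : ℝ → M, γ 0 = u ∧ (∀ t, γ t ∈ V) ∧ IsMIntegralCurve (I := 𝓘(ℝ, E)) γ X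

open Classical in
/-- The flow of a vector field on a set on which it is complete, extended by the identity. -/
noncomputable def flow (t : ℝ) (z : M) : M :=
  if h : ∃ γ : ℝ → M, γ 0 = z ∧ (∀ t, γ t ∈ V) ∧ IsMIntegralCurve (I := 𝓘(ℝ, E)) γ X
  then h.choose t else z

variable {X V}

omit [IsManifold 𝓘(ℝ, E) ∞ M] in
lemma flow_of_notMem {z : M} (hz : z ∉ V) (t : ℝ) : flow X V t z = z := by
  rw [flow, dif_neg]
  rintro ⟨γ, h0, h, _⟩
  exact hz (h0 ▸ h 0)

omit [IsManifold 𝓘(ℝ, E) ∞ M] in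
lemma flow_spec (hV : IsCompleteField X V) {z : M} (hz : z ∈ V) :
    flow X V 0 z = z ∧ (∀ t, flow X V t z ∈ V) ∧
      IsMIntegralCurve (I := 𝓘(ℝ, E)) (fun t => flow X V t z) X := by
  have h := hV z hz
  have : (fun t => flow X V t z) = h.choose := by
    funext t
    rw [flow, dif_pos h]
  rw [this]
  refine ⟨?_, fun t => ?_, h.choose_spec.2.2⟩
  · rw [congrFun this 0]; exact h.choose_spec.1
  · rw [congrFun this t]; exact h.choose_spec.2.1 t

omit [IsManifold 𝓘(ℝ, E) ∞ M] in
lemma flow_zero (hV : IsCompleteField X V) (z : M) : flow X V 0 z = z := by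
  by_cases hz : z ∈ V
  · exact (flow_spec hV hz).1
  · exact flow_of_notMem hz 0

variable [T2Space M]

lemma flow_eq (hX : IsSmoothField X) (hV : IsCompleteField X V) {γ : ℝ → M}
    (h0 : γ 0 ∈ V) (hγ : IsMIntegralCurve (I := 𝓘(ℝ, E)) γ X) (t : ℝ) :
    flow X V t (γ 0) = γ t :=
  congrFun (isMIntegralCurve_Ioo_eq_of_contMDiff_boundaryless (t₀ := 0) hX.contMDiff
    (flow_spec hV h0).2.2 hγ (flow_spec hV h0).1) t

/-- Both sides are integral curves in `s` with the same starting point, so uniqueness applies; off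
`V` every flow map is the identity. -/
lemma flow_add (hX : IsSmoothField X) (hV : IsCompleteField X V) (s t : ℝ) (z : M) :
    flow X V (s + t) z = flow X V s (flow X V t z) := by
  by_cases hz : z ∈ V
  · have h := (flow_spec hV hz).2.2.comp_add t
    have := flow_eq hX hV (γ := (fun τ => flow X V τ z) ∘ (· + t))
      ((flow_spec hV hz).2.1 _) h s
    simpa using this.symm
  · simp [flow_of_notMem hz]

variable [FiniteDimensional ℝ E]

/-- The local flow in the chart at `z₀` is smooth, and uniqueness of integral curves identifies it
with the global flow for short times. -/
lemma contMDiffAt_flow_zero (hX : IsSmoothField X) (hVo : IsOpen V) (hV : IsCompleteField X V)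
    {z₀ : M} (hz₀ : z₀ ∈ V) :
    ContMDiffAt (𝓘(ℝ, ℝ).prod 𝓘(ℝ, E)) 𝓘(ℝ, E) ∞ (fun p : ℝ × M => flow X V p.1 p.2) (0, z₀) := by
  set φ := extChartAt 𝓘(ℝ, E) z₀ with hφ
  have hsm : ∀ᶠ y in 𝓝 (φ z₀), ContDiffAt ℝ ∞ (chartField X z₀) y := by
    filter_upwards [extChartAt_target_mem_nhds (I := 𝓘(ℝ, E)) z₀] with y hy using hX z₀ y hy
  obtain ⟨ψ, hψ, h⟩ := LocalFlow.exists_contDiffAt hsm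
  have hψ0 : ψ (0, φ z₀) ∈ φ.target := by
    obtain ⟨γ, h0, h1, h2⟩ := (h _ (extChartAt_target_mem_nhds (I := 𝓘(ℝ, E)) z₀)).self_of_nhds
    rw [← h1]
    exact (h2 _ (by norm_num)).1
  have hpair : ContMDiffAt (𝓘(ℝ, ℝ).prod 𝓘(ℝ, E)) 𝓘(ℝ, ℝ × E) ∞
      (fun p : ℝ × M => (p.1, φ p.2)) (0, z₀) :=
    contMDiffAt_fst.prodMk_space
      (ContMDiffAt.comp (0, z₀) (g := φ) (contMDiffAt_extChartAt (x := z₀)) contMDiffAt_snd)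
  have hmain : ContMDiffAt (𝓘(ℝ, ℝ).prod 𝓘(ℝ, E)) 𝓘(ℝ, E) ∞
      (fun p : ℝ × M => φ.symm (ψ (p.1, φ p.2))) (0, z₀) :=
    ContMDiffAt.comp (0, z₀) (g := φ.symm) (f := fun p : ℝ × M => ψ (p.1, φ p.2))
      (contMDiffAt_extChartAt_symm hψ0)
      (ContMDiffAt.comp (0, z₀) (g := ψ) hψ.contMDiffAt hpair)
  refine hmain.congr_of_eventuallyEq ?_
  have hO := hpair.continuousAt.eventually
    (h _ (extChartAt_target_mem_nhds (I := 𝓘(ℝ, E)) z₀))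
  have hV' : ∀ᶠ p : ℝ × M in 𝓝 (0, z₀), p.2 ∈ V ∩ φ.source :=
    (continuousAt_snd (p := ((0 : ℝ), z₀))).eventually (Filter.inter_mem (hVo.mem_nhds hz₀)
      (extChartAt_source_mem_nhds (I := 𝓘(ℝ, E)) z₀))
  filter_upwards [hO, hV'] with p ⟨γ, h0, h1, h2⟩ ⟨hpV, hps⟩
  -- The transported chart curve and the orbit traversed at speed `2 * p.1` are integral curves of
  -- the same rescaled field. They are compared at parameter `1 / 2`.
  have e1 : IsMIntegralCurveOn (I := 𝓘(ℝ, E)) (φ.symm ∘ γ) ((2 * p.1) • X) (Ioo (-1) 1) :=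
    fun t ht => (hasMFDerivAt_extChartAt_symm_comp (h2 t ht).1 (h2 t ht).2).hasMFDerivWithinAt
  have e2 := ((flow_spec hV hpV).2.2.comp_mul (2 * p.1)).isMIntegralCurveOn (Ioo (-1) 1)
  have := isMIntegralCurveOn_Ioo_eqOn_of_contMDiff_boundaryless (t₀ := 0) (by norm_num)
    (isSmoothField_smul hX (2 * p.1)).contMDiff e1 e2
    (by simp [h0, (flow_spec hV hpV).1, φ.left_inv hps])
  have := this (show (1 / 2 : ℝ) ∈ Ioo (-1 : ℝ) 1 by norm_num)
  simp only [Function.comp_apply, h1] at this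
  rw [this]
  congr 1
  ring

/-- The times at which the flow map is `C^n` at `z` form a clopen set containing `0`: two flow maps
at nearby times differ by a short flow, which is smooth near the relevant point of the orbit. -/
lemma contMDiffAt_flow_apply (hX : IsSmoothField X) (hVo : IsOpen V) (hV : IsCompleteField X V)
    {z : M} (hz : z ∈ V) (t : ℝ) : ContMDiffAt 𝓘(ℝ, E) 𝓘(ℝ, E) ∞ (flow X V t) z := by
  -- Finite order matters in `key`: being `C^n` at a point implies being `C^n` on a neighbourhood,
  -- whereas for `C^∞` the neighbourhood may depend on the order.
  refine contMDiffAt_infty.2 fun n => ?_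
  have : IsManifold 𝓘(ℝ, E) n M := IsManifold.of_le (n := ∞) (by exact_mod_cast le_top)
  set A : Set ℝ := {t | ContMDiffAt 𝓘(ℝ, E) 𝓘(ℝ, E) n (flow X V t) z} with hA
  have hcont : Continuous fun t => flow X V t z := (flow_spec hV hz).2.2.continuous
  have hcont' : ∀ t, ContinuousAt (flow X V t) z → Filter.Tendsto (flow X V t) (𝓝 z)
    (𝓝 (flow X V t z)) := fun t h => h
  have key : ∀ t₀, ∀ᶠ t in 𝓝 t₀, (t ∈ A ↔ t₀ ∈ A) := by
    intro t₀
    set y := flow X V t₀ z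
    have hy : y ∈ V := (flow_spec hV hz).2.1 t₀
    have h0 := (contMDiffAt_flow_zero hX hVo hV hy).of_le
      (show (n : WithTop ℕ∞) ≤ ∞ by exact_mod_cast le_top)
    rw [contMDiffAt_iff_contMDiffAt_nhds (by simp)] at h0
    have hstep : ∀ p : ℝ × M, ContMDiffAt (𝓘(ℝ, ℝ).prod 𝓘(ℝ, E)) 𝓘(ℝ, E) n
        (fun p : ℝ × M => flow X V p.1 p.2) p →
        ContMDiffAt 𝓘(ℝ, E) 𝓘(ℝ, E) n (flow X V p.1) p.2 := fun p hp =>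
      ContMDiffAt.comp p.2 (g := fun p : ℝ × M => flow X V p.1 p.2) (f := fun w => (p.1, w))
        hp (contMDiffAt_const.prodMk contMDiffAt_id)
    have l1 : Filter.Tendsto (fun t => (t - t₀, y)) (𝓝 t₀) (𝓝 ((0 : ℝ), y)) := by
      have : Continuous fun t : ℝ => (t - t₀, y) := by fun_prop
      simpa using this.tendsto t₀
    -- Passing from `t` back to `t₀` uses a short flow starting at the moving point `flow X V t z`,
    -- which tends to `y` by continuity of the orbit.
    have l2 : Filter.Tendsto (fun t => (t₀ - t, flow X V t z)) (𝓝 t₀) (𝓝 ((0 : ℝ), y)) := by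
      have : Continuous fun t : ℝ => (t₀ - t, flow X V t z) := by fun_prop
      simpa using this.tendsto t₀
    filter_upwards [l1.eventually h0, l2.eventually h0] with t ht1 ht2
    constructor
    · intro ht
      have h := (hstep _ ht2).comp z (show ContMDiffAt 𝓘(ℝ, E) 𝓘(ℝ, E) n (flow X V t) z from ht)
      have e : flow X V t₀ = flow X V (t₀ - t) ∘ flow X V t := by
        funext w; rw [Function.comp_apply, ← flow_add hX hV, sub_add_cancel]
      change ContMDiffAt _ _ _ _ _
      rw [e]; exact h
    · intro ht
      have h := (hstep _ ht1).comp z (show ContMDiffAt 𝓘(ℝ, E) 𝓘(ℝ, E) n (flow X V t₀) z from ht)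
      have e : flow X V t = flow X V (t - t₀) ∘ flow X V t₀ := by
        funext w; rw [Function.comp_apply, ← flow_add hX hV, sub_add_cancel]
      change ContMDiffAt _ _ _ _ _
      rw [e]; exact h
  have hclopen : IsClopen A := by
    constructor
    · rw [← isOpen_compl_iff, isOpen_iff_mem_nhds]
      intro t₀ ht₀
      filter_upwards [key t₀] with t ht using fun h => ht₀ (ht.1 h)
    · rw [isOpen_iff_mem_nhds]
      intro t₀ ht₀
      filter_upwards [key t₀] with t ht using ht.2 ht₀
  have h0 : (0 : ℝ) ∈ A := by
    have : flow X V 0 = id := funext fun w => flow_zero hV w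
    change ContMDiffAt _ _ _ _ _
    rw [this]; exact contMDiffAt_id
  have := hclopen.eq_univ ⟨0, h0⟩
  have ht : t ∈ A := this ▸ mem_univ t
  exact ht

/-- The flow of a complete smooth vector field is smooth in time and initial value. -/
theorem contMDiffAt_flow (hX : IsSmoothField X) (hVo : IsOpen V) (hV : IsCompleteField X V)
    {z₀ : M} (hz₀ : z₀ ∈ V) (t₀ : ℝ) :
    ContMDiffAt (𝓘(ℝ, ℝ).prod 𝓘(ℝ, E)) 𝓘(ℝ, E) ∞
      (fun p : ℝ × M => flow X V p.1 p.2) (t₀, z₀) := by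
  have h1 : ContMDiffAt (𝓘(ℝ, ℝ).prod 𝓘(ℝ, E)) (𝓘(ℝ, ℝ).prod 𝓘(ℝ, E)) ∞
      (fun p : ℝ × M => (p.1 - t₀, flow X V t₀ p.2)) (t₀, z₀) :=
    (contMDiffAt_fst.sub contMDiffAt_const).prodMk
      (ContMDiffAt.comp (t₀, z₀) (g := flow X V t₀) (contMDiffAt_flow_apply hX hVo hV hz₀ t₀)
        contMDiffAt_snd)
  have h2 := contMDiffAt_flow_zero hX hVo hV ((flow_spec hV hz₀).2.1 t₀)
  have h3 := ContMDiffAt.comp (t₀, z₀) (g := fun p : ℝ × M => flow X V p.1 p.2)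
    (f := fun p : ℝ × M => (p.1 - t₀, flow X V t₀ p.2)) (by simpa using h2) h1
  refine h3.congr_of_eventuallyEq (Filter.Eventually.of_forall fun p => ?_)
  simp only [Function.comp_apply]
  rw [← flow_add hX hV, sub_add_cancel]

end ManifoldFlow

/-! ### Commuting flows -/

namespace ManifoldFlow

section NormedSpace

variable {E : Type u} [NormedAddCommGroup E] [NormedSpace ℝ E]

/-- The differential of the local flow of `X` preserves a vector field `Y` commuting with `X`. -/
lemma eventually_fderiv_flow_apply {X Y : E → E} {ψ : ℝ × E → E} {y₀ : E}
    (hX : ContDiffAt ℝ ∞ X y₀) (hY : ContDiffAt ℝ ∞ Y y₀) (hψ : ContDiffAt ℝ ∞ ψ (0, y₀))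
    (h0 : ∀ᶠ y in 𝓝 y₀, ψ (0, y) = y)
    (hd : ∀ᶠ p in 𝓝 ((0 : ℝ), y₀), fderiv ℝ ψ p (1, 0) = X (ψ p))
    (hXY : ∀ᶠ y in 𝓝 y₀, fderiv ℝ Y y (X y) = fderiv ℝ X y (Y y)) :
    ∀ᶠ s in 𝓝 (0 : ℝ), fderiv ℝ ψ (s, y₀) (0, Y y₀) = Y (ψ (s, y₀)) := by
  have hψ0 : ψ (0, y₀) = y₀ := h0.self_of_nhds
  have hX2 : ContDiffAt ℝ 2 X y₀ := hX.of_le ENat.LEInfty.out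
  have hY2 : ContDiffAt ℝ 2 Y y₀ := hY.of_le ENat.LEInfty.out
  have hψ2 : ContDiffAt ℝ 2 ψ (0, y₀) := hψ.of_le ENat.LEInfty.out
  have hcurve : Filter.Tendsto (fun s : ℝ => (s, y₀)) (𝓝 0) (𝓝 (0, y₀)) :=
    (by fun_prop : Continuous fun s : ℝ => (s, y₀)).tendsto 0
  have hψcurve : Filter.Tendsto (fun s : ℝ => ψ (s, y₀)) (𝓝 0) (𝓝 y₀) := by
    have : Filter.Tendsto ψ (𝓝 (0, y₀)) (𝓝 y₀) := by
      have := hψ.continuousAt.tendsto; rwa [hψ0] at this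
    exact this.comp hcurve
  have eψ := hcurve.eventually (hψ2.eventually (by simp))
  have eX := hψcurve.eventually (hX2.eventually (by simp))
  have eY := hψcurve.eventually (hY2.eventually (by simp))
  have ed := hcurve.eventually hd.eventually_nhds
  have eXY := hψcurve.eventually hXY
  set A : ℝ → E →L[ℝ] E := fun s => fderiv ℝ X (ψ (s, y₀)) with hA
  have hAc : Filter.Tendsto A (𝓝 0) (𝓝 (fderiv ℝ X y₀)) := by
    have : ContinuousAt (fderiv ℝ X) y₀ :=
      (hX2.fderiv_right (m := 1) (by norm_num)).continuousAt
    exact this.tendsto.comp hψcurve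
  have hAb : ∀ᶠ s in 𝓝 (0 : ℝ), ‖A s‖₊ ≤ ‖fderiv ℝ X y₀‖₊ + 1 := by
    have := hAc.nnnorm
    exact (this.eventually_lt_const (lt_add_one _)).mono fun s hs => hs.le
  -- The transported vector solves the linearized equation `u' = A s u`: symmetry of the second
  -- derivative of `ψ` interchanges the time derivative and the space derivative.
  have hu : ∀ᶠ s in 𝓝 (0 : ℝ), HasDerivAt (fun s => fderiv ℝ ψ (s, y₀) (0, Y y₀))
      (A s (fderiv ℝ ψ (s, y₀) (0, Y y₀))) s := by
    filter_upwards [eψ, eX, ed] with s h1 h2 h3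
    have hD : DifferentiableAt ℝ (fderiv ℝ ψ) (s, y₀) :=
      (h1.fderiv_right (m := 1) (by norm_num)).differentiableAt (by norm_num)
    have hline : HasDerivAt (fun s : ℝ => (s, y₀)) ((1 : ℝ), (0 : E)) s :=
      (hasDerivAt_id s).prodMk (hasDerivAt_const s y₀)
    have hu1 : HasDerivAt (fun s => fderiv ℝ ψ (s, y₀) (0, Y y₀))
        (fderiv ℝ (fderiv ℝ ψ) (s, y₀) (1, 0) (0, Y y₀)) s := by
      have := hD.hasFDerivAt.comp_hasDerivAt s hline
      simpa using this.clm_apply (hasDerivAt_const s ((0 : ℝ), Y y₀))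
    have hsymm : IsSymmSndFDerivAt ℝ ψ (s, y₀) :=
      h1.isSymmSndFDerivAt (by simp)
    have hv : HasFDerivAt (fun p => fderiv ℝ ψ p (1, 0))
        ((fderiv ℝ (fderiv ℝ ψ) (s, y₀)).flip (1, 0)) (s, y₀) := by
      simpa using hD.hasFDerivAt.clm_apply (hasFDerivAt_const ((1 : ℝ), (0 : E)) (s, y₀))
    have hv' : HasFDerivAt (fun p => fderiv ℝ ψ p (1, 0)) (A s ∘L fderiv ℝ ψ (s, y₀)) (s, y₀) := by
      have := (h2.differentiableAt (by norm_num)).hasFDerivAt.comp (s, y₀)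
        (h1.differentiableAt (by norm_num)).hasFDerivAt
      exact this.congr_of_eventuallyEq h3
    have hvv := congrArg (fun B => B (0, Y y₀)) (hv.unique hv')
    refine hu1.congr_deriv ?_
    rw [hsymm.eq]
    simpa using hvv
  -- `Y` along the orbit has derivative `DY X`, which equals `DX Y` by commutation, so it solves the
  -- same linear equation with the same initial value.
  have hw : ∀ᶠ s in 𝓝 (0 : ℝ), HasDerivAt (fun s => Y (ψ (s, y₀))) (A s (Y (ψ (s, y₀)))) s := by
    filter_upwards [eψ, eY, ed, eXY] with s h1 h2 h3 h4
    have hline : HasDerivAt (fun s : ℝ => (s, y₀)) ((1 : ℝ), (0 : E)) s :=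
      (hasDerivAt_id s).prodMk (hasDerivAt_const s y₀)
    have h5 := (h1.differentiableAt (by norm_num)).hasFDerivAt.comp_hasDerivAt s hline
    have h6 := (h2.differentiableAt (by norm_num)).hasFDerivAt.comp_hasDerivAt s h5
    refine h6.congr_deriv ?_
    rw [h3.self_of_nhds, h4]
  have hinit : fderiv ℝ ψ (0, y₀) (0, Y y₀) = Y (ψ (0, y₀)) := by
    rw [hψ0]
    have h1 := (hψ2.differentiableAt (by norm_num)).hasFDerivAt.comp y₀
      (hasFDerivAt_prodMk_right (𝕜 := ℝ) (0 : ℝ) y₀)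
    have h2 : HasFDerivAt (ψ ∘ fun y => ((0 : ℝ), y)) (.id ℝ E) y₀ :=
      (hasFDerivAt_id y₀).congr_of_eventuallyEq h0
    simpa using congrArg (fun B => B (Y y₀)) (h1.unique h2)
  exact ODE_solution_unique_of_eventually (v := fun s z => A s z) (s := fun _ => univ)
    (K := ‖fderiv ℝ X y₀‖₊ + 1)
    (hAb.mono fun s hs => ((A s).lipschitz.weaken hs).lipschitzOnWith)
    (hu.mono fun s hs => ⟨hs, mem_univ _⟩) (hw.mono fun s hs => ⟨hs, mem_univ _⟩) hinit

end NormedSpace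

variable {E : Type u} [NormedAddCommGroup E] [NormedSpace ℝ E] [FiniteDimensional ℝ E]
  {M : Type*} [TopologicalSpace M] [ChartedSpace E M] [IsManifold 𝓘(ℝ, E) ∞ M] [T2Space M]
  {X Y : ∀ x : M, TangentSpace 𝓘(ℝ, E) x} {V : Set M}

/-- Two vector fields commute: their Lie bracket vanishes in the preferred charts. -/
def FieldsCommute (X Y : ∀ x : M, TangentSpace 𝓘(ℝ, E) x) : Prop :=
  ∀ x₀ : M, ∀ y ∈ (extChartAt 𝓘(ℝ, E) x₀).target,
    fderiv ℝ (chartField Y x₀) y (chartField X x₀ y) =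
      fderiv ℝ (chartField X x₀) y (chartField Y x₀ y)

omit [FiniteDimensional ℝ E] [T2Space M] in
lemma mfderiv_extChartAt_injective {x₀ x : M} (hx : x ∈ (extChartAt 𝓘(ℝ, E) x₀).source) :
    Function.Injective (mfderiv 𝓘(ℝ, E) 𝓘(ℝ, E) (extChartAt 𝓘(ℝ, E) x₀) x) := by
  obtain ⟨e, he⟩ := isInvertible_mfderiv_extChartAt (I := 𝓘(ℝ, E)) hx
  rw [← he]
  exact e.injective

/-- This is `eventually_fderiv_flow_apply` for the flow written in the chart at `z`. The result
returns to the manifold because the differential of the chart is injective. -/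
lemma eventually_mfderiv_flow_apply (hX : IsSmoothField X) (hY : IsSmoothField Y)
    (hXY : FieldsCommute X Y) (hVo : IsOpen V) (hVX : IsCompleteField X V) {z : M} (hz : z ∈ V) :
    ∀ᶠ s in 𝓝 (0 : ℝ), mfderiv 𝓘(ℝ, E) 𝓘(ℝ, E) (flow X V s) z (Y z) = Y (flow X V s z) := by
  set φ := extChartAt 𝓘(ℝ, E) z with hφ
  have hzs : z ∈ φ.source := mem_extChartAt_source z
  have hzt : φ z ∈ φ.target := mem_extChartAt_target z
  have hφz : φ.symm (φ z) = z := φ.left_inv hzs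
  set ψ : ℝ × E → E := fun p => φ (flow X V p.1 (φ.symm p.2)) with hψdef
  have hsymm : ContMDiffAt 𝓘(ℝ, E) 𝓘(ℝ, E) ∞ φ.symm (φ z) := contMDiffAt_extChartAt_symm hzt
  have hψ1 : ContMDiffAt 𝓘(ℝ, ℝ × E) 𝓘(ℝ, E) ∞ (fun p : ℝ × E => flow X V p.1 (φ.symm p.2))
      (0, φ z) := by
    have h1 : ContMDiffAt 𝓘(ℝ, ℝ × E) (𝓘(ℝ, ℝ).prod 𝓘(ℝ, E)) ∞
        (fun p : ℝ × E => (p.1, φ.symm p.2)) (0, φ z) :=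
      (contDiffAt_fst.contMDiffAt).prodMk
        (ContMDiffAt.comp (0, φ z) (g := φ.symm) hsymm contDiffAt_snd.contMDiffAt)
    exact ContMDiffAt.comp (0, φ z) (g := fun p : ℝ × M => flow X V p.1 p.2)
      (by simpa [hφz] using contMDiffAt_flow hX hVo hVX hz 0) h1
  have hψz : flow X V 0 (φ.symm (φ z)) = z := by rw [hφz, flow_zero hVX]
  have hψ : ContDiffAt ℝ ∞ ψ (0, φ z) := by
    refine ContMDiffAt.contDiffAt ?_
    refine ContMDiffAt.comp (0, φ z) (g := φ) ?_ hψ1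
    rw [hψz]
    exact contMDiffAt_extChartAt
  have hnear : ∀ᶠ p : ℝ × E in 𝓝 (0, φ z), φ.symm p.2 ∈ V ∧ flow X V p.1 (φ.symm p.2) ∈ φ.source := by
    have h1 : ∀ᶠ p : ℝ × E in 𝓝 (0, φ z), φ.symm p.2 ∈ V := by
      have : Filter.Tendsto (fun p : ℝ × E => φ.symm p.2) (𝓝 (0, φ z)) (𝓝 z) := by
        have h := hsymm.continuousAt.tendsto
        rw [hφz] at h
        exact h.comp continuousAt_snd
      exact this.eventually (hVo.mem_nhds hz)
    have h2 := hψ1.continuousAt.tendsto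
    simp only [hψz] at h2
    exact h1.and (h2.eventually (extChartAt_source_mem_nhds (I := 𝓘(ℝ, E)) z))
  have hψ1' : ∀ᶠ p in 𝓝 ((0 : ℝ), φ z), DifferentiableAt ℝ ψ p := by
    have : ContDiffAt ℝ 1 ψ (0, φ z) := hψ.of_le ENat.LEInfty.out
    exact (this.eventually (by simp)).mono fun p hp => hp.differentiableAt (by norm_num)
  have key := eventually_fderiv_flow_apply (X := chartField X z) (Y := chartField Y z)
    (hX z _ hzt) (hY z _ hzt) hψ
    (by
      filter_upwards [extChartAt_target_mem_nhds (I := 𝓘(ℝ, E)) z] with y hy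
      rw [hψdef]
      simp only
      rw [flow_zero hVX, φ.right_inv hy])
    (by
      filter_upwards [hnear, hψ1'] with p ⟨hpV, hps⟩ hpd
      have h1 : HasDerivAt (fun s => ψ (s, p.2)) (fderiv ℝ ψ p (1, 0)) p.1 :=
        HasFDerivAt.comp_hasDerivAt (f := fun s : ℝ => (s, p.2)) p.1 hpd.hasFDerivAt
          ((hasDerivAt_id p.1).prodMk (hasDerivAt_const p.1 p.2))
      have h2 := hasDerivAt_extChartAt_comp (x₀ := z) hps ((flow_spec hVX hpV).2.2 p.1)
      exact h1.unique h2)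
    (by
      filter_upwards [extChartAt_target_mem_nhds (I := 𝓘(ℝ, E)) z] with y hy using hXY z y hy)
  have hcurve : Filter.Tendsto (fun s : ℝ => (s, φ z)) (𝓝 0) (𝓝 (0, φ z)) :=
    (by fun_prop : Continuous fun s : ℝ => (s, φ z)).tendsto 0
  filter_upwards [key, hcurve.eventually hnear, hcurve.eventually hψ1'] with s hs ⟨hsV, hss⟩ hsd
  simp only [hφz] at hss
  apply mfderiv_extChartAt_injective hss
  let w : M := flow X V s z
  have hYw := chartField_extChartAt Y hss
  have hYz := chartField_extChartAt Y hzs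
  rw [← hYw]
  have hψs : ψ (s, φ z) = φ (flow X V s z) := by rw [hψdef]; simp only [hφz]
  rw [hψs] at hs
  rw [← hs]
  have hflow := ((contMDiffAt_flow_apply hX hVo hVX hz s).mdifferentiableAt (by simp)).hasMFDerivAt
  have hφw := ((contMDiffAt_extChartAt_of_mem hss).mdifferentiableAt (by simp)).hasMFDerivAt
  have hφzd := ((contMDiffAt_extChartAt_of_mem hzs).mdifferentiableAt (by simp)).hasMFDerivAt
  have c1 := hφw.comp z hflow
  have hψsd : HasFDerivAt (fun y => ψ (s, y)) (fderiv ℝ ψ (s, φ z) ∘L .inr ℝ ℝ E) (φ z) :=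
    hsd.hasFDerivAt.comp (φ z) (hasFDerivAt_prodMk_right s (φ z))
  have c2 := (hψsd.hasMFDerivAt).comp z hφzd
  have c3 : (φ ∘ flow X V s) =ᶠ[𝓝 z] ((fun y => ψ (s, y)) ∘ φ) := by
    filter_upwards [extChartAt_source_mem_nhds (I := 𝓘(ℝ, E)) z] with x hx
    simp only [Function.comp_apply, hψdef]
    rw [φ.left_inv hx]
  have c4 := hasMFDerivAt_unique c1 (c2.congr_of_eventuallyEq c3)
  have c5 := congrArg (fun B => B (Y z)) c4
  refine c5.trans ?_
  rw [hYz]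
  rfl

omit [FiniteDimensional ℝ E] in
lemma flow_neg_flow (hX : IsSmoothField X) (hVX : IsCompleteField X V) (s : ℝ) (z : M) :
    flow X V (-s) (flow X V s z) = z := by
  rw [← flow_add hX hVX, neg_add_cancel, flow_zero hVX]

lemma mfderiv_flow_injective (hX : IsSmoothField X) (hVo : IsOpen V) (hVX : IsCompleteField X V)
    {z : M} (hz : z ∈ V) (s : ℝ) :
    Function.Injective (mfderiv 𝓘(ℝ, E) 𝓘(ℝ, E) (flow X V s) z) := by
  have h1 := ((contMDiffAt_flow_apply hX hVo hVX hz s).mdifferentiableAt (by simp)).hasMFDerivAt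
  have h2 := ((contMDiffAt_flow_apply hX hVo hVX ((flow_spec hVX hz).2.1 s)
    (-s)).mdifferentiableAt (by simp)).hasMFDerivAt
  have h3 := h2.comp z h1
  have h4 : flow X V (-s) ∘ flow X V s = id := funext fun w => flow_neg_flow hX hVX s w
  rw [h4] at h3
  have h5 := hasMFDerivAt_unique h3 (hasMFDerivAt_id z)
  exact Function.LeftInverse.injective
    (g := mfderiv 𝓘(ℝ, E) 𝓘(ℝ, E) (flow X V (-s)) (flow X V s z))
    fun v => congrArg (fun B => B v) h5

/-- The times at which the identity holds form a clopen set: at times near `t₀` both sides arise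
from their values at `t₀` by the differential of a short flow. -/
lemma mfderiv_flow_apply (hX : IsSmoothField X) (hY : IsSmoothField Y)
    (hXY : FieldsCommute X Y) (hVo : IsOpen V) (hVX : IsCompleteField X V) {z : M} (hz : z ∈ V)
    (t : ℝ) : mfderiv 𝓘(ℝ, E) 𝓘(ℝ, E) (flow X V t) z (Y z) = Y (flow X V t z) := by
  set A : Set ℝ := {t | mfderiv 𝓘(ℝ, E) 𝓘(ℝ, E) (flow X V t) z (Y z) = Y (flow X V t z)} with hA
  have key : ∀ t₀, ∀ᶠ t in 𝓝 t₀, (t ∈ A ↔ t₀ ∈ A) := by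
    intro t₀
    have hy : flow X V t₀ z ∈ V := (flow_spec hVX hz).2.1 t₀
    have l1 : Filter.Tendsto (fun t => t - t₀) (𝓝 t₀) (𝓝 0) := by
      have : Continuous fun t : ℝ => t - t₀ := by fun_prop
      simpa using this.tendsto t₀
    filter_upwards [l1.eventually (eventually_mfderiv_flow_apply hX hY hXY hVo hVX hy)] with t ht
    have e : flow X V t = flow X V (t - t₀) ∘ flow X V t₀ := by
      funext w; rw [Function.comp_apply, ← flow_add hX hVX, sub_add_cancel]
    have h1 := ((contMDiffAt_flow_apply hX hVo hVX hz t₀).mdifferentiableAt (by simp)).hasMFDerivAt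
    have h2 := ((contMDiffAt_flow_apply hX hVo hVX hy
      (t - t₀)).mdifferentiableAt (by simp)).hasMFDerivAt
    have h3 : mfderiv 𝓘(ℝ, E) 𝓘(ℝ, E) (flow X V t) z (Y z) =
        mfderiv 𝓘(ℝ, E) 𝓘(ℝ, E) (flow X V (t - t₀)) (flow X V t₀ z)
          (mfderiv 𝓘(ℝ, E) 𝓘(ℝ, E) (flow X V t₀) z (Y z)) := by
      rw [e, (h2.comp z h1).mfderiv]; rfl
    have h4 : flow X V t z = flow X V (t - t₀) (flow X V t₀ z) := congrFun e z
    have h5 : (Y (flow X V t z) : E) = Y (flow X V (t - t₀) (flow X V t₀ z)) :=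
      congrArg (fun w => (Y w : E)) h4
    let B : E →L[ℝ] E := mfderiv 𝓘(ℝ, E) 𝓘(ℝ, E) (flow X V (t - t₀)) (flow X V t₀ z)
    let u : E := mfderiv 𝓘(ℝ, E) 𝓘(ℝ, E) (flow X V t₀) z (Y z)
    let w : E := Y (flow X V t₀ z)
    have h6 : t ∈ A ↔ B u = B w := Eq.congr h3 (h5.trans ht.symm)
    -- Injectivity of the short flow's differential carries the identity from `t` back to `t₀`,
    -- which gives closedness as well as openness.
    exact h6.trans (mfderiv_flow_injective hX hVo hVX hy (t - t₀)).eq_iff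
  have hclopen : IsClopen A := by
    constructor
    · rw [← isOpen_compl_iff, isOpen_iff_mem_nhds]
      intro t₀ ht₀
      filter_upwards [key t₀] with t ht using fun h => ht₀ (ht.1 h)
    · rw [isOpen_iff_mem_nhds]
      intro t₀ ht₀
      filter_upwards [key t₀] with t ht using ht.2 ht₀
  have h0 : (0 : ℝ) ∈ A := by
    have : flow X V 0 = id := funext fun w => flow_zero hVX w
    change mfderiv 𝓘(ℝ, E) 𝓘(ℝ, E) (flow X V 0) z (Y z) = Y (flow X V 0 z)
    rw [this, mfderiv_id]; rfl
  have ht : t ∈ A := hclopen.eq_univ ⟨0, h0⟩ ▸ mem_univ t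
  exact ht

/-- The flows of commuting complete vector fields commute. -/
theorem flow_comm (hX : IsSmoothField X) (hY : IsSmoothField Y)
    (hXY : FieldsCommute X Y) (hVo : IsOpen V) (hVX : IsCompleteField X V)
    (hVY : IsCompleteField Y V) (s t : ℝ) (z : M) :
    flow Y V s (flow X V t z) = flow X V t (flow Y V s z) := by
  by_cases hz : z ∈ V
  -- Since the flow of `X` preserves `Y`, it maps an integral curve of `Y` to an integral curve of
  -- `Y`; uniqueness does the rest.
  · have hγ : IsMIntegralCurve (I := 𝓘(ℝ, E)) (fun s => flow X V t (flow Y V s z)) Y := by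
      intro s
      have hw : flow Y V s z ∈ V := (flow_spec hVY hz).2.1 s
      have h1 := ((contMDiffAt_flow_apply hX hVo hVX hw t).mdifferentiableAt
        (by simp)).hasMFDerivAt
      have h2 := (flow_spec hVY hz).2.2 s
      refine (h1.comp s h2).congr_mfderiv ?_
      rw [← mfderiv_flow_apply hX hY hXY hVo hVX hw t]
      let A : E →L[ℝ] E := mfderiv 𝓘(ℝ, E) 𝓘(ℝ, E) (flow X V t) (flow Y V s z)
      let v : E := Y (flow Y V s z)
      refine ContinuousLinearMap.ext fun (a : ℝ) => ?_
      change A (a • v) = a • A v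
      rw [map_smul]
    have h0 : flow X V t (flow Y V 0 z) = flow X V t z := by rw [flow_zero hVY]
    have := flow_eq hY hVY (γ := fun s => flow X V t (flow Y V s z))
      (by rw [h0]; exact (flow_spec hVX hz).2.1 t) hγ s
    rw [h0] at this
    exact this
  · simp [flow_of_notMem hz]

end ManifoldFlow

/-! ### Hamiltonian vector fields -/

namespace HamiltonianFields

open ManifoldFlow PartialIntegrability

section NormedSpace

variable {E : Type*} [NormedAddCommGroup E] [NormedSpace ℝ E]

/-- Two-forms as bilinear forms. -/
noncomputable def bilinL (E : Type*) [NormedAddCommGroup E] [NormedSpace ℝ E] :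
    (E [⋀^Fin 2]→L[ℝ] ℝ) →L[ℝ] (E →L[ℝ] E →L[ℝ] ℝ) :=
  (ContinuousLinearMap.compL ℝ E (E [×1]→L[ℝ] ℝ) (E →L[ℝ] ℝ)
    (continuousMultilinearCurryFin1 ℝ E ℝ).toContinuousLinearEquiv.toContinuousLinearMap) ∘L
  (continuousMultilinearCurryLeftEquiv ℝ
    (fun _ : Fin 2 => E) ℝ).toContinuousLinearEquiv.toContinuousLinearMap ∘L
  (ContinuousAlternatingMap.toContinuousMultilinearMapCLM ℝ)

lemma bilinL_apply (η : E [⋀^Fin 2]→L[ℝ] ℝ) (v w : E) : bilinL E η v w = η ![v, w] := by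
  change η (Fin.cons v (Fin.snoc 0 w)) = _
  congr 1
  funext i
  fin_cases i <;> rfl

lemma isBoundedLinearMap_bilinL (E : Type*) [NormedAddCommGroup E] [NormedSpace ℝ E] :
    IsBoundedLinearMap ℝ (fun η : E [⋀^Fin 2]→L[ℝ] ℝ => bilinL E η) where
  map_add η ξ := map_add _ _ _
  map_smul c η := map_smul _ _ _
  bound := by
    refine ⟨1, one_pos, fun η => ?_⟩
    rw [one_mul]
    refine ContinuousLinearMap.opNorm_le_bound₂ _ (norm_nonneg _) fun v w => ?_
    rw [bilinL_apply]
    refine (η.le_opNorm _).trans_eq ?_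
    simp [Fin.prod_univ_two, mul_assoc]

lemma bilinL_swap (η : E [⋀^Fin 2]→L[ℝ] ℝ) (v w : E) : bilinL E η v w = -bilinL E η w v := by
  rw [bilinL_apply, bilinL_apply]
  have h := η.toAlternatingMap.map_swap ![w, v] (i := 0) (j := 1) (by decide)
  have e : ![w, v] ∘ Equiv.swap (0 : Fin 2) 1 = ![v, w] := by
    funext i; fin_cases i <;> rfl
  rw [e] at h
  exact h

lemma extDeriv_two_form_apply (η : E → E [⋀^Fin 2]→L[ℝ] ℝ) (y a b c : E) :
    extDeriv η y ![a, b, c] = bilinL E (fderiv ℝ η y a) b c - bilinL E (fderiv ℝ η y b) a c +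
      bilinL E (fderiv ℝ η y c) a b := by
  rw [extDeriv, ContinuousAlternatingMap.alternatizeUncurryFin_apply, Fin.sum_univ_three]
  simp only [bilinL_apply]
  have e0 : Fin.removeNth 0 ![a, b, c] = ![b, c] := by funext i; fin_cases i <;> rfl
  have e1 : Fin.removeNth 1 ![a, b, c] = ![a, c] := by funext i; fin_cases i <;> rfl
  have e2 : Fin.removeNth 2 ![a, b, c] = ![a, b] := by funext i; fin_cases i <;> rfl
  rw [e0, e1, e2]
  simp
  ring

/-- Hamiltonian vector fields of functions in involution commute. -/
lemma fderiv_apply_comm_of_involution {η : E → E [⋀^Fin 2]→L[ℝ] ℝ} {f g : E → ℝ} {X Y : E → E}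
    {y : E} (hη : DifferentiableAt ℝ η y) (hdη : extDeriv η y = 0)
    (hnd : ∀ v, (∀ w, bilinL E (η y) v w = 0) → v = 0)
    (hX : DifferentiableAt ℝ X y) (hY : DifferentiableAt ℝ Y y)
    (hf : ContDiffAt ℝ 2 f y) (hg : ContDiffAt ℝ 2 g y)
    (hXf : ∀ᶠ z in 𝓝 y, ∀ w, bilinL E (η z) (X z) w = -fderiv ℝ f z w)
    (hYg : ∀ᶠ z in 𝓝 y, ∀ w, bilinL E (η z) (Y z) w = -fderiv ℝ g z w)
    (hinv : ∀ᶠ z in 𝓝 y, bilinL E (η z) (X z) (Y z) = 0) :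
    fderiv ℝ Y y (X y) = fderiv ℝ X y (Y y) := by
  obtain ⟨B, hB, hBa⟩ : ∃ B : E →L[ℝ] E →L[ℝ] E →L[ℝ] ℝ,
      HasFDerivAt (fun z => bilinL E (η z)) B y ∧ ∀ u, B u = bilinL E (fderiv ℝ η y u) :=
    ⟨(isBoundedLinearMap_bilinL E).toContinuousLinearMap ∘L fderiv ℝ η y,
      HasFDerivAt.comp y (g := fun ξ => bilinL E ξ)
        ((isBoundedLinearMap_bilinL E).hasFDerivAt (x := η y)) hη.hasFDerivAt, fun _ => rfl⟩
  -- This differentiates the defining equation `η(X, ·) = -df` in the direction `u`.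
  have hD : ∀ {f : E → ℝ} {X : E → E}, DifferentiableAt ℝ X y → ContDiffAt ℝ 2 f y →
      (∀ᶠ z in 𝓝 y, ∀ w, bilinL E (η z) (X z) w = -fderiv ℝ f z w) → ∀ u w,
      bilinL E (fderiv ℝ η y u) (X y) w + bilinL E (η y) (fderiv ℝ X y u) w =
        -fderiv ℝ (fderiv ℝ f) y u w := by
    intro f X hX hf hXf u w
    have h1 : HasFDerivAt (fun z => bilinL E (η z) (X z)) _ y :=
      hB.clm_apply hX.hasFDerivAt
    have h2 : HasFDerivAt (fderiv ℝ f) (fderiv ℝ (fderiv ℝ f) y) y :=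
      ((hf.fderiv_right (m := 1) (by norm_num)).differentiableAt (by norm_num)).hasFDerivAt
    have h3 := h1.unique (h2.neg.congr_of_eventuallyEq (hXf.mono fun z hz =>
      ContinuousLinearMap.ext fun w => by simpa using hz w))
    have h4 := congrArg (fun A => A u w) h3
    simp [hBa] at h4
    linarith
  -- Involution says that `dg(X)` vanishes near `y`; this is its derivative in the direction `w`.
  have hzero : ∀ w, fderiv ℝ (fderiv ℝ g) y w (X y) + fderiv ℝ g y (fderiv ℝ X y w) = 0 := by
    intro w
    have h2 : HasFDerivAt (fderiv ℝ g) (fderiv ℝ (fderiv ℝ g) y) y :=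
      ((hg.fderiv_right (m := 1) (by norm_num)).differentiableAt (by norm_num)).hasFDerivAt
    have h1 : HasFDerivAt (fun z => fderiv ℝ g z (X z)) _ y := h2.clm_apply hX.hasFDerivAt
    have h3 : (fun z => fderiv ℝ g z (X z)) =ᶠ[𝓝 y] fun _ => 0 := by
      filter_upwards [hYg, hinv] with z hz1 hz2
      have := hz1 (X z)
      rw [bilinL_swap, hz2] at this
      linarith
    have h4 := h1.unique ((hasFDerivAt_const (0 : ℝ) y).congr_of_eventuallyEq h3)
    have h5 := congrArg (fun A => A w) h4
    simp at h5
    linarith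
  rw [← sub_eq_zero]
  refine hnd _ fun w => ?_
  -- In `η(DY X - DX Y, w)`, closedness trades the derivatives of `η` along `X` and `Y` for the one
  -- along `w`. The Hessians of `f` cancel by symmetry, and what remains is minus the expression in
  -- `hzero`.
  have hsf := (hf.isSymmSndFDerivAt (by simp)).eq (Y y) w
  have hsg := (hg.isSymmSndFDerivAt (by simp)).eq (X y) w
  have hcl := extDeriv_two_form_apply η y (X y) (Y y) w
  rw [hdη] at hcl
  have e1 := hD hY hg hYg (X y) w
  have e2 := hD hX hf hXf (Y y) w
  have e3 := hD hX hf hXf w (Y y)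
  have e4 := hzero w
  have e5 := hYg.self_of_nhds (fderiv ℝ X y w)
  have e6 := bilinL_swap (η y) (Y y) (fderiv ℝ X y w)
  rw [map_sub, sub_apply]
  change (0 : ℝ) = _ at hcl
  linarith

end NormedSpace

variable {d : ℕ} {M : Type*} [TopologicalSpace M] [ChartedSpace (EuclideanSpace ℝ (Fin d)) M]
  [IsManifold (𝓡 d) ∞ M] (Ω : SymplecticForm d M)

local notation "𝔼" => EuclideanSpace ℝ (Fin d)

omit [IsManifold (𝓡 d) ∞ M] in
lemma bilinL_coordForm_apply (x₀ : M) (y : 𝔼) (v w : 𝔼) :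
    bilinL 𝔼 (coordForm Ω.form x₀ y) v w =
      Ω.form ((extChartAt (𝓡 d) x₀).symm y)
        ![mfderiv 𝓘(ℝ, 𝔼) (𝓡 d) (extChartAt (𝓡 d) x₀).symm y v,
          mfderiv 𝓘(ℝ, 𝔼) (𝓡 d) (extChartAt (𝓡 d) x₀).symm y w] := by
  rw [bilinL_apply]
  change Ω.form _ _ = _
  congr 1
  funext i
  fin_cases i <;> rfl

lemma fderiv_comp_extChartAt_symm {f : M → ℝ} (hf : ContMDiff (𝓡 d) 𝓘(ℝ, ℝ) ∞ f) {x₀ : M} {y : 𝔼}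
    (hy : y ∈ (extChartAt (𝓡 d) x₀).target) (w : 𝔼) :
    fderiv ℝ (f ∘ (extChartAt (𝓡 d) x₀).symm) y w =
      mfderiv (𝓡 d) 𝓘(ℝ, ℝ) f ((extChartAt (𝓡 d) x₀).symm y)
        (mfderiv 𝓘(ℝ, 𝔼) (𝓡 d) (extChartAt (𝓡 d) x₀).symm y w) := by
  have h1 := ((contMDiffAt_extChartAt_symm hy).mdifferentiableAt (by simp)).hasMFDerivAt
  have h2 := ((hf.contMDiffAt (x := (extChartAt (𝓡 d) x₀).symm y)).mdifferentiableAt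
    (by simp)).hasMFDerivAt
  let A : 𝔼 →L[ℝ] 𝔼 := mfderiv 𝓘(ℝ, 𝔼) (𝓡 d) (extChartAt (𝓡 d) x₀).symm y
  let B : 𝔼 →L[ℝ] ℝ := mfderiv (𝓡 d) 𝓘(ℝ, ℝ) f ((extChartAt (𝓡 d) x₀).symm y)
  have h3 : HasFDerivAt (f ∘ (extChartAt (𝓡 d) x₀).symm) (B ∘L A) y := (h2.comp y h1).hasFDerivAt
  rw [h3.fderiv]
  rfl

lemma contDiffAt_comp_extChartAt_symm {f : M → ℝ} (hf : ContMDiff (𝓡 d) 𝓘(ℝ, ℝ) ∞ f) {x₀ : M}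
    {y : 𝔼} (hy : y ∈ (extChartAt (𝓡 d) x₀).target) :
    ContDiffAt ℝ ∞ (f ∘ (extChartAt (𝓡 d) x₀).symm) y :=
  (hf.contMDiffAt.comp y (contMDiffAt_extChartAt_symm hy)).contDiffAt

lemma bilinL_coordForm_chartField (f : M → ℝ) (hf : ContMDiff (𝓡 d) 𝓘(ℝ, ℝ) ∞ f) {x₀ : M} {y : 𝔼}
    (hy : y ∈ (extChartAt (𝓡 d) x₀).target) (w : 𝔼) :
    bilinL 𝔼 (coordForm Ω.form x₀ y) (chartField (Ω.hamiltonianVectorField f) x₀ y) w =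
      -fderiv ℝ (f ∘ (extChartAt (𝓡 d) x₀).symm) y w := by
  rw [bilinL_coordForm_apply, mfderiv_extChartAt_symm_chartField _ hy,
    Ω.form_hamiltonianVectorField, fderiv_comp_extChartAt_symm hf hy]
  rfl

lemma coordForm_nondegenerate {x₀ : M} {y : 𝔼} (hy : y ∈ (extChartAt (𝓡 d) x₀).target) (v : 𝔼)
    (hv : ∀ w, bilinL 𝔼 (coordForm Ω.form x₀ y) v w = 0) : v = 0 := by
  have hinv := isInvertible_mfderivWithin_extChartAt_symm (I := 𝓡 d) hy
  simp only [modelWithCornersSelf_coe, range_id, mfderivWithin_univ] at hinv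
  obtain ⟨e, he⟩ := hinv
  have h0 : e v = 0 := by
    refine Ω.nondegenerate _ _ fun w => ?_
    have := (bilinL_coordForm_apply Ω x₀ y v (e.symm w)).symm.trans (hv _)
    rw [← he] at this
    change Ω.form _ ![e v, e (e.symm w)] = 0 at this
    rwa [e.apply_symm_apply] at this
  exact (map_eq_zero_iff e e.injective).1 h0

omit [IsManifold (𝓡 d) ∞ M] in
lemma contDiffAt_coordForm {x₀ : M} {y : 𝔼} (hy : y ∈ (extChartAt (𝓡 d) x₀).target) :
    ContDiffAt ℝ ∞ (coordForm Ω.form x₀) y :=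
  (Ω.smooth x₀ y hy).contDiffAt (extChartAt_target_mem_nhds_of_mem hy)

/-- Hamiltonian vector fields of smooth functions are smooth. -/
theorem isSmoothField_hamiltonianVectorField (f : M → ℝ) (hf : ContMDiff (𝓡 d) 𝓘(ℝ, ℝ) ∞ f) :
    IsSmoothField (E := 𝔼) (Ω.hamiltonianVectorField f) := by
  intro x₀ y hy
  set L : 𝔼 → 𝔼 →L[ℝ] 𝔼 →L[ℝ] ℝ := fun z => bilinL 𝔼 (coordForm Ω.form x₀ z) with hL
  have hinv : ∀ z ∈ (extChartAt (𝓡 d) x₀).target, (L z).IsInvertible := by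
    intro z hz
    have hinj : Function.Injective (L z) := by
      rw [injective_iff_map_eq_zero]
      intro v hv
      exact coordForm_nondegenerate Ω hz v fun w => by
        rw [← hL] at *
        exact congrArg (fun A => A w) hv
    have hdim : Module.finrank ℝ 𝔼 = Module.finrank ℝ (𝔼 →L[ℝ] ℝ) := by
      rw [← (LinearMap.toContinuousLinearMap (𝕜 := ℝ) (E := 𝔼) (F' := ℝ)).finrank_eq]
      exact Subspace.dual_finrank_eq.symm
    exact ⟨(LinearEquiv.ofInjectiveOfFinrankEq (L z).toLinearMap hinj
      hdim).toContinuousLinearEquiv, by ext; rfl⟩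
  have hLs : ContDiffAt ℝ ∞ L y :=
    (isBoundedLinearMap_bilinL 𝔼).contDiff.contDiffAt.comp y (contDiffAt_coordForm Ω hy)
  -- In coordinates the field is `L⁻¹(-df)`, and operator inversion is smooth at invertible
  -- operators.
  have hform : ContDiffAt ℝ ∞ (fun z => (L z).inverse
      (-fderiv ℝ (f ∘ (extChartAt (𝓡 d) x₀).symm) z)) y := by
    refine ContDiffAt.clm_apply ?_ ?_
    · exact ContDiffAt.comp y (g := ContinuousLinearMap.inverse) (hinv y hy).contDiffAt_map_inverse
        hLs
    · exact ((contDiffAt_comp_extChartAt_symm hf hy).fderiv_right (m := ∞) (by simp)).neg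
  refine hform.congr_of_eventuallyEq ?_
  filter_upwards [extChartAt_target_mem_nhds_of_mem hy] with z hz
  have h1 : L z (chartField (Ω.hamiltonianVectorField f) x₀ z) =
      -fderiv ℝ (f ∘ (extChartAt (𝓡 d) x₀).symm) z :=
    ContinuousLinearMap.ext fun w => bilinL_coordForm_chartField Ω f hf hz w
  rw [← h1]
  obtain ⟨e, he⟩ := hinv z hz
  rw [← he, ContinuousLinearMap.inverse_equiv]
  exact (e.symm_apply_apply _).symm

/-- Hamiltonian vector fields of functions in involution commute. -/
theorem fieldsCommute_hamiltonianVectorField (f g : M → ℝ) (hf : ContMDiff (𝓡 d) 𝓘(ℝ, ℝ) ∞ f)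
    (hg : ContMDiff (𝓡 d) 𝓘(ℝ, ℝ) ∞ g) (hfg : ∀ z, Ω.poissonBracket f g z = 0) :
    FieldsCommute (E := 𝔼) (Ω.hamiltonianVectorField f) (Ω.hamiltonianVectorField g) := by
  intro x₀ y hy
  have h2 : (2 : WithTop ℕ∞) ≤ ∞ := ENat.LEInfty.out
  have hn := extChartAt_target_mem_nhds_of_mem hy
  refine fderiv_apply_comm_of_involution (η := coordForm Ω.form x₀)
    (f := f ∘ (extChartAt (𝓡 d) x₀).symm) (g := g ∘ (extChartAt (𝓡 d) x₀).symm)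
    ((contDiffAt_coordForm Ω hy).differentiableAt (by simp)) (Ω.closed x₀ y hy)
    (coordForm_nondegenerate Ω hy)
    ((isSmoothField_hamiltonianVectorField Ω f hf x₀ y hy).differentiableAt (by simp))
    ((isSmoothField_hamiltonianVectorField Ω g hg x₀ y hy).differentiableAt (by simp))
    ((contDiffAt_comp_extChartAt_symm hf hy).of_le h2)
    ((contDiffAt_comp_extChartAt_symm hg hy).of_le h2) ?_ ?_ ?_
  · filter_upwards [hn] with z hz using bilinL_coordForm_chartField Ω f hf hz
  · filter_upwards [hn] with z hz using bilinL_coordForm_chartField Ω g hg hz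
  · filter_upwards [hn] with z hz
    rw [bilinL_coordForm_apply, mfderiv_extChartAt_symm_chartField _ hz,
      mfderiv_extChartAt_symm_chartField _ hz]
    exact hfg _

end HamiltonianFields

/-! ### The action of `ℝᵏ` defined by commuting complete vector fields -/

namespace ManifoldFlow

variable {E : Type u} [NormedAddCommGroup E] [NormedSpace ℝ E]
  {M : Type*} [TopologicalSpace M] [ChartedSpace E M] [IsManifold 𝓘(ℝ, E) ∞ M] [T2Space M]
  {X : ∀ x : M, TangentSpace 𝓘(ℝ, E) x} {V : Set M}

/-- The flow of a complete vector field as a one-parameter group. -/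
noncomputable def flowHom (hX : IsSmoothField X) (hV : IsCompleteField X V) :
    Multiplicative ℝ →* Equiv.Perm M where
  toFun t :=
    { toFun := flow X V t.toAdd
      invFun := flow X V (-t.toAdd)
      left_inv := fun z => by rw [← flow_add hX hV, neg_add_cancel, flow_zero hV]
      right_inv := fun z => by rw [← flow_add hX hV, add_neg_cancel, flow_zero hV] }
  map_one' := Equiv.ext fun z => flow_zero hV z
  map_mul' s t := Equiv.ext fun z => flow_add hX hV s.toAdd t.toAdd z

omit [IsManifold 𝓘(ℝ, E) ∞ M] [T2Space M] in
/-- A map that annihilates a vector field is constant along its flow. -/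
lemma apply_flow_eq {B S : Type*} [NormedAddCommGroup B] [NormedSpace ℝ B]
    [TopologicalSpace S] [T2Space S] [ChartedSpace B S] [IsManifold 𝓘(ℝ, B) ∞ S] {π : M → S}
    (hV : IsCompleteField X V)
    (hπ : ∀ z ∈ V, MDifferentiableAt 𝓘(ℝ, E) 𝓘(ℝ, B) π z)
    (hπX : ∀ z ∈ V, mfderiv 𝓘(ℝ, E) 𝓘(ℝ, B) π z (X z) = 0) {z : M} (hz : z ∈ V) (t : ℝ) :
    π (flow X V t z) = π z := by
  -- The image of an orbit and the constant curve are both integral curves of the zero field on `S`,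
  -- so uniqueness identifies them.
  have h0 : IsSmoothField (fun _ => 0 : ∀ x : S, TangentSpace 𝓘(ℝ, B) x) := by
    intro x₀ y _
    have : chartField (fun _ => 0 : ∀ x : S, TangentSpace 𝓘(ℝ, B) x) x₀ = fun _ => 0 := by
      funext y
      exact map_zero (mfderiv 𝓘(ℝ, B) 𝓘(ℝ, B) (extChartAt 𝓘(ℝ, B) x₀)
        ((extChartAt 𝓘(ℝ, B) x₀).symm y))
    rw [this]
    exact contDiffAt_const
  have h1 : IsMIntegralCurve (I := 𝓘(ℝ, B)) (fun t => π (flow X V t z))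
      (fun _ => 0 : ∀ x : S, TangentSpace 𝓘(ℝ, B) x) := by
    intro t
    have hm := (flow_spec hV hz).2.1 t
    have h := (hπ _ hm).hasMFDerivAt.comp t ((flow_spec hV hz).2.2 t)
    refine h.congr_mfderiv (ContinuousLinearMap.ext fun (a : ℝ) => ?_)
    let A : E →L[ℝ] B := mfderiv 𝓘(ℝ, E) 𝓘(ℝ, B) π (flow X V t z)
    let v : E := X (flow X V t z)
    change A (a • v) = a • (0 : B)
    rw [map_smul]
    exact congrArg (a • ·) (hπX _ hm)
  have h2 : IsMIntegralCurve (I := 𝓘(ℝ, B)) (fun _ => π z)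
      (fun _ => 0 : ∀ x : S, TangentSpace 𝓘(ℝ, B) x) := by
    intro t
    refine (hasMFDerivAt_const (π z) t).congr_mfderiv (ContinuousLinearMap.ext fun (a : ℝ) => ?_)
    change (0 : B) = a • (0 : B)
    simp
  refine congrFun (isMIntegralCurve_Ioo_eq_of_contMDiff_boundaryless (t₀ := 0) h0.contMDiff
    h1 h2 ?_) t
  rw [flow_zero hV]

end ManifoldFlow

/-- An action of a vector group by diffeomorphisms of an open set `V`, preserving the map `π`, and
locally free on `V`. -/
structure IsLocallyFreeSmoothAction (T E B : Type*) [NormedAddCommGroup T] [NormedSpace ℝ T]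
    [NormedAddCommGroup E] [NormedSpace ℝ E] {M S : Type*} [TopologicalSpace M]
    [ChartedSpace E M] [AddAction T M] (V : Set M) (π : M → S) : Prop where
  vadd_mem : ∀ (t : T), ∀ z ∈ V, t +ᵥ z ∈ V
  apply_vadd : ∀ (t : T), ∀ z ∈ V, π (t +ᵥ z) = π z
  contMDiffAt : ∀ (t : T), ∀ z ∈ V,
    ContMDiffAt (𝓘(ℝ, T).prod 𝓘(ℝ, E)) 𝓘(ℝ, E) ∞ (fun p : T × M => p.1 +ᵥ p.2) (t, z)
  eq_zero_of_mfderiv : ∀ z ∈ V, ∀ t : T,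
    mfderiv 𝓘(ℝ, T) 𝓘(ℝ, E) (fun t : T => t +ᵥ z) 0 t = (0 : E) → t = 0

namespace ManifoldFlow

variable {E : Type*} [NormedAddCommGroup E] [NormedSpace ℝ E]
  {M : Type*} [TopologicalSpace M] [ChartedSpace E M] [IsManifold 𝓘(ℝ, E) ∞ M] [T2Space M]
  {ι : Type*} [Fintype ι] {X : ι → ∀ x : M, TangentSpace 𝓘(ℝ, E) x} {V : Set M}
  (hX : ∀ i, IsSmoothField (X i)) (hV : ∀ i, IsCompleteField (X i) V)
  (hc : Pairwise fun i j => ∀ s t, Commute (flowHom (hX i) (hV i) s) (flowHom (hX j) (hV j) t))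

/-- The joint flow of commuting complete vector fields. -/
noncomputable abbrev jointFlow : AddAction (ι → ℝ) M where
  vadd t z := MonoidHom.noncommPiCoprod (fun i => flowHom (hX i) (hV i)) hc
    (fun i => Multiplicative.ofAdd (t i)) z
  zero_vadd z := by
    change MonoidHom.noncommPiCoprod (fun i => flowHom (hX i) (hV i)) hc 1 z = z
    rw [map_one]; rfl
  add_vadd s t z := by
    change MonoidHom.noncommPiCoprod (fun i => flowHom (hX i) (hV i)) hc
      ((fun i => Multiplicative.ofAdd (s i)) * (fun i => Multiplicative.ofAdd (t i))) z = _
    rw [map_mul]; rfl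

lemma jointFlow_single [DecidableEq ι] (i : ι) (c : ℝ) (z : M) :
    (letI := jointFlow hX hV hc; (Pi.single i c : ι → ℝ) +ᵥ z) = flow (X i) V c z := by
  change MonoidHom.noncommPiCoprod (fun i => flowHom (hX i) (hV i)) hc
    (fun j => Multiplicative.ofAdd ((Pi.single i c : ι → ℝ) j)) z = _
  have : (fun j => Multiplicative.ofAdd ((Pi.single i c : ι → ℝ) j)) =
      Pi.mulSingle i (Multiplicative.ofAdd c) := by
    funext j
    by_cases h : j = i
    · subst h; simp
    · simp [h]
  rw [this, MonoidHom.noncommPiCoprod_mulSingle]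
  rfl

/-- The composite of the flows with indices in a finite set. -/
noncomputable def partialFlow (s : Finset ι) (t : ι → ℝ) : Equiv.Perm M :=
  s.noncommProd (fun i => flowHom (hX i) (hV i) (Multiplicative.ofAdd (t i)))
    (Pairwise.set_pairwise (fun ⦃_ _⦄ h => hc h _ _) _)

omit [Fintype ι] in
lemma partialFlow_insert [DecidableEq ι] {s : Finset ι} {i : ι} (hi : i ∉ s) (t : ι → ℝ) (z : M) :
    partialFlow hX hV hc (insert i s) t z = flow (X i) V (t i) (partialFlow hX hV hc s t z) := by
  rw [partialFlow, Finset.noncommProd_insert_of_notMem _ _ _ _ hi]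
  rfl

/-- Invariance of `V` and `π` and joint smoothness follow by composing one flow at a time. Local
freeness holds because the derivative of the orbit map at `0` sends the coordinate vectors to the
independent vectors `X i z`. -/
theorem isLocallyFreeSmoothAction_jointFlow [FiniteDimensional ℝ E] (hVo : IsOpen V)
    (hli : ∀ z ∈ V, LinearIndependent ℝ (fun i => (X i z : E)))
    {B S : Type*} [NormedAddCommGroup B] [NormedSpace ℝ B]
    [TopologicalSpace S] [T2Space S] [ChartedSpace B S] [IsManifold 𝓘(ℝ, B) ∞ S] {π : M → S}
    (hπ : ∀ z ∈ V, MDifferentiableAt 𝓘(ℝ, E) 𝓘(ℝ, B) π z)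
    (hπX : ∀ i, ∀ z ∈ V, mfderiv 𝓘(ℝ, E) 𝓘(ℝ, B) π z (X i z) = 0) :
    letI := jointFlow hX hV hc
    IsLocallyFreeSmoothAction (ι → ℝ) E B V π := by
  classical
  let := jointFlow hX hV hc
  have hmem : ∀ (t : ι → ℝ) (s : Finset ι), ∀ z ∈ V,
      partialFlow hX hV hc s t z ∈ V ∧ π (partialFlow hX hV hc s t z) = π z := by
    intro t s
    induction s using Finset.induction_on with
    | empty => intro z hz; exact ⟨hz, rfl⟩
    | insert i s hi ih =>
      intro z hz
      rw [partialFlow_insert hX hV hc hi]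
      exact ⟨(flow_spec (hV i) (ih z hz).1).2.1 _,
        (apply_flow_eq (hV i) hπ (hπX i) (ih z hz).1 _).trans (ih z hz).2⟩
  have hsm : ∀ (t : ι → ℝ) (s : Finset ι), ∀ z ∈ V,
      ContMDiffAt (𝓘(ℝ, ι → ℝ).prod 𝓘(ℝ, E)) 𝓘(ℝ, E) ∞ (fun p : (ι → ℝ) × M =>
        partialFlow hX hV hc s p.1 p.2) (t, z) := by
    intro t s
    induction s using Finset.induction_on with
    | empty => intro z hz; exact contMDiffAt_snd
    | insert i s hi ih =>
      intro z hz
      have h1 : ContMDiffAt (𝓘(ℝ, ι → ℝ).prod 𝓘(ℝ, E)) 𝓘(ℝ, ℝ) ∞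
          (fun p : (ι → ℝ) × M => p.1 i) (t, z) :=
        ContMDiffAt.comp (t, z) (g := fun t : ι → ℝ => t i)
          (contDiff_apply ℝ ℝ i).contDiffAt.contMDiffAt contMDiffAt_fst
      have h2 := ContMDiffAt.comp (t, z) (g := fun p : ℝ × M => flow (X i) V p.1 p.2)
        (contMDiffAt_flow (hX i) hVo (hV i) (hmem t s z hz).1 (t i)) (h1.prodMk (ih z hz))
      exact h2.congr_of_eventuallyEq (Filter.Eventually.of_forall fun p =>
        partialFlow_insert hX hV hc hi p.1 p.2)
  -- The joint action is by definition the partial flow over all indices.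
  have hcd : ∀ (t : ι → ℝ), ∀ z ∈ V,
    ContMDiffAt (𝓘(ℝ, ι → ℝ).prod 𝓘(ℝ, E)) 𝓘(ℝ, E) ∞
      (fun p : (ι → ℝ) × M => p.1 +ᵥ p.2) (t, z) := fun t z hz => hsm t Finset.univ z hz
  refine ⟨fun t z hz => (hmem t Finset.univ z hz).1, fun t z hz => (hmem t Finset.univ z hz).2,
    hcd, fun z hz t ht => ?_⟩
  have h1 : ContMDiffAt 𝓘(ℝ, ι → ℝ) 𝓘(ℝ, E) ∞ (fun t : ι → ℝ => t +ᵥ z) 0 :=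
    ContMDiffAt.comp 0 (g := fun p : (ι → ℝ) × M => p.1 +ᵥ p.2) (f := fun t => (t, z)) (hcd 0 z hz)
      (contMDiffAt_id.prodMk contMDiffAt_const)
  have h2 := (h1.mdifferentiableAt (by simp)).hasMFDerivAt
  let D : (ι → ℝ) →L[ℝ] E := mfderiv 𝓘(ℝ, ι → ℝ) 𝓘(ℝ, E) (fun t : ι → ℝ => t +ᵥ z) 0
  change D t = 0 at ht
  have key : ∀ i, D (Pi.single i 1) = (X i z : E) := by
    intro i
    have h3 : HasMFDerivAt 𝓘(ℝ, ℝ) 𝓘(ℝ, ι → ℝ) (fun c : ℝ => (Pi.single i c : ι → ℝ)) 0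
        (ContinuousLinearMap.single ℝ (fun _ : ι => ℝ) i) :=
      (ContinuousLinearMap.single ℝ (fun _ : ι => ℝ) i).hasFDerivAt.hasMFDerivAt
    have h4 := HasMFDerivAt.comp (x := (0 : ℝ)) (g := fun t : ι → ℝ => t +ᵥ z)
      (f := fun c : ℝ => (Pi.single i c : ι → ℝ)) (by rw [Pi.single_zero]; exact h2) h3
    have h5 : (fun t : ι → ℝ => t +ᵥ z) ∘ (fun c : ℝ => (Pi.single i c : ι → ℝ)) =
        fun c => flow (X i) V c z := funext fun c => jointFlow_single hX hV hc i c z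
    rw [h5] at h4
    have h6 := (flow_spec (hV i) hz).2.2 0
    have h7 := hasMFDerivAt_unique h4 h6
    have h8 := congrArg (fun A : ℝ →L[ℝ] E => A 1) h7
    have h9 : (1 : ℝ) • (X i (flow (X i) V 0 z) : E) = (X i z : E) := by
      rw [flow_zero (hV i), one_smul]
    refine Eq.trans ?_ (h8.trans h9)
    rfl
  have h10 : ∑ i, t i • (X i z : E) = 0 := by
    refine Eq.trans ?_ ht
    conv_rhs => rw [← Finset.univ_sum_single t, map_sum]
    refine Finset.sum_congr rfl fun i _ => ?_
    rw [← key i]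
    refine (map_smul D (t i) (Pi.single i 1)).symm.trans (congrArg D ?_)
    rw [← Pi.single_smul, smul_eq_mul, mul_one]
  funext i
  exact Fintype.linearIndependent_iff.1 (hli z hz) t h10 i

end ManifoldFlow

/-! ### Local sections of submersions and the time function of a locally free action -/

/-- A submersion has smooth local sections. -/
lemma Manifold.IsSubmersionAt.exists_local_section
    {E : Type u} [NormedAddCommGroup E] [NormedSpace ℝ E]
    {B : Type*} [NormedAddCommGroup B] [NormedSpace ℝ B]
    {M : Type*} [TopologicalSpace M] [ChartedSpace E M] [IsManifold 𝓘(ℝ, E) ∞ M]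
    {S : Type*} [TopologicalSpace S] [ChartedSpace B S] [IsManifold 𝓘(ℝ, B) ∞ S]
    {π : M → S} {z : M} (h : IsSubmersionAt 𝓘(ℝ, E) 𝓘(ℝ, B) ∞ π z) :
    ∃ (s : S → M) (O : Set S), IsOpen O ∧ π z ∈ O ∧ ContMDiffOn 𝓘(ℝ, B) 𝓘(ℝ, E) ∞ s O ∧
      s (π z) = z ∧ ∀ r ∈ O, π (s r) = r := by
  set φ := h.domChart
  set ψ := h.codChart
  have hz : z ∈ φ.source := h.mem_domChart_source
  have hw : ∀ y ∈ φ.target, ψ (π (φ.symm y)) = (h.equiv y).1 := by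
    intro y hy
    have hy' : y ∈ (φ.extend 𝓘(ℝ, E)).target := by simpa using hy
    exact h.writtenInCharts hy'
  -- In adapted charts the submersion is a projection; the section keeps the fibre coordinate fixed
  -- at its value `c` at `z`.
  obtain ⟨c, hc⟩ : ∃ c, c = (h.equiv (φ z)).2 := ⟨_, rfl⟩
  have hcz : h.equiv.symm (ψ (π z), c) = φ z := by
    rw [h.equiv.symm_apply_eq, hc]
    refine Prod.ext ?_ rfl
    have := hw (φ z) (φ.map_source hz)
    rwa [φ.left_inv hz] at this
  have hcont : Continuous fun y : B => h.equiv.symm (y, c) :=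
    h.equiv.symm.continuous.comp (by fun_prop)
  refine ⟨fun r => φ.symm (h.equiv.symm (ψ r, c)),
    ψ.source ∩ ψ ⁻¹' ((fun y : B => h.equiv.symm (y, c)) ⁻¹' φ.target),
    ψ.isOpen_inter_preimage (φ.open_target.preimage hcont),
    ⟨h.mem_codChart_source, ?_⟩, ?_, ?_, ?_⟩
  · simpa [hcz] using φ.map_source hz
  · refine (contMDiffOn_symm_of_mem_maximalAtlas h.domChart_mem_maximalAtlas).comp (t := φ.target)
      ?_ fun r hr => hr.2
    have h1 : ContDiff ℝ ∞ fun y : B => h.equiv.symm (y, c) :=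
      h.equiv.symm.contDiff.comp (by fun_prop)
    exact h1.contMDiff.comp_contMDiffOn
      ((contMDiffOn_of_mem_maximalAtlas h.codChart_mem_maximalAtlas).mono inter_subset_left)
  · simp only [hcz]
    exact φ.left_inv hz
  · intro r hr
    have h1 : φ.symm (h.equiv.symm (ψ r, c)) ∈ φ.source := φ.map_target hr.2
    refine ψ.injOn (h.source_subset_preimage_source h1) hr.1 ?_
    rw [hw _ hr.2, h.equiv.apply_symm_apply]

namespace IsLocallyFreeSmoothAction

open ManifoldFlow

variable {T E B : Type*} [NormedAddCommGroup T] [NormedSpace ℝ T] [FiniteDimensional ℝ T]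
  [NormedAddCommGroup E] [NormedSpace ℝ E] [FiniteDimensional ℝ E]
  [NormedAddCommGroup B] [NormedSpace ℝ B] [FiniteDimensional ℝ B]
  {M : Type*} [TopologicalSpace M] [ChartedSpace E M] [IsManifold 𝓘(ℝ, E) ∞ M]
  {S : Type*} [TopologicalSpace S] [ChartedSpace B S] [IsManifold 𝓘(ℝ, B) ∞ S]
  [AddAction T M] {V : Set M} {π : M → S}

omit [FiniteDimensional ℝ T] [FiniteDimensional ℝ E] [FiniteDimensional ℝ B]
  [IsManifold 𝓘(ℝ, E) ∞ M] [IsManifold 𝓘(ℝ, B) ∞ S] in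
lemma contMDiffAt_vadd_section (hA : IsLocallyFreeSmoothAction T E B V π) {s : S → M} {O : Set S}
    (hO : IsOpen O) (hs : ContMDiffOn 𝓘(ℝ, B) 𝓘(ℝ, E) ∞ s O) (hsV : ∀ r ∈ O, s r ∈ V)
    (t : T) {r : S} (hr : r ∈ O) :
    ContMDiffAt (𝓘(ℝ, T).prod 𝓘(ℝ, B)) 𝓘(ℝ, E) ∞ (fun p : T × S => p.1 +ᵥ s p.2) (t, r) :=
  ContMDiffAt.comp (t, r) (g := fun p : T × M => p.1 +ᵥ p.2) (f := fun p : T × S => (p.1, s p.2))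
    (hA.contMDiffAt t _ (hsV r hr))
    (contMDiffAt_fst.prodMk (ContMDiffAt.comp (t, r) (g := s) (hs.contMDiffAt (hO.mem_nhds hr))
      contMDiffAt_snd))

/-- Near a point of a section, the points of the manifold are uniquely obtained by moving the
section for a short time; this time is a smooth function. -/
theorem exists_time (hA : IsLocallyFreeSmoothAction T E B V π)
    (hdim : Module.finrank ℝ E = Module.finrank ℝ B + Module.finrank ℝ T)
    (hπ : ∀ z ∈ V, ContMDiffAt 𝓘(ℝ, E) 𝓘(ℝ, B) ∞ π z) {s : S → M} {O : Set S}
    (hO : IsOpen O) (hs : ContMDiffOn 𝓘(ℝ, B) 𝓘(ℝ, E) ∞ s O) (hsV : ∀ r ∈ O, s r ∈ V)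
    (hπs : ∀ r ∈ O, π (s r) = r) {r₀ : S} (hr₀ : r₀ ∈ O) :
    ∃ τ : M → T, (∀ᶠ w in 𝓝 (s r₀), ContMDiffAt 𝓘(ℝ, E) 𝓘(ℝ, T) ∞ τ w ∧ τ w +ᵥ s (π w) = w) ∧
      ∀ᶠ p : T × S in 𝓝 (0, r₀), τ (p.1 +ᵥ s p.2) = p.1 := by
  set φ := extChartAt 𝓘(ℝ, E) (s r₀) with hφ
  set ψ := extChartAt 𝓘(ℝ, B) r₀ with hψ
  -- The inverse function theorem is applied to `(t, r) ↦ t +ᵥ s r` in charts; the time function is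
  -- the first component of the local inverse.
  set G : T × B → E := fun q => φ (q.1 +ᵥ s (ψ.symm q.2)) with hG
  set q₀ : T × B := (0, ψ r₀) with hq₀
  have hψs : ψ.symm (ψ r₀) = r₀ := extChartAt_to_inv r₀
  have hGq₀ : G q₀ = φ (s r₀) := by simp only [hG, hq₀, hψs, zero_vadd]
  have hsm : ∀ q : T × B, q.2 ∈ ψ.target → ψ.symm q.2 ∈ O →
      ContMDiffAt 𝓘(ℝ, T × B) 𝓘(ℝ, E) ∞ (fun q : T × B => q.1 +ᵥ s (ψ.symm q.2)) q := by
    intro q h1 h2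
    have h3 : ContMDiffAt 𝓘(ℝ, T × B) (𝓘(ℝ, T).prod 𝓘(ℝ, B)) ∞
        (fun q : T × B => (q.1, ψ.symm q.2)) q :=
      contDiffAt_fst.contMDiffAt.prodMk (ContMDiffAt.comp q (g := ψ.symm)
        (contMDiffAt_extChartAt_symm h1) contDiffAt_snd.contMDiffAt)
    exact ContMDiffAt.comp q (g := fun p : T × S => p.1 +ᵥ s p.2)
      (hA.contMDiffAt_vadd_section hO hs hsV q.1 h2) h3
  have hev1 : ∀ᶠ q in 𝓝 q₀, q.2 ∈ ψ.target ∧ ψ.symm q.2 ∈ O := by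
    have h1 : ∀ᶠ y in 𝓝 (ψ r₀), y ∈ ψ.target ∧ ψ.symm y ∈ O := by
      have h2 : ∀ᶠ y in 𝓝 (ψ r₀), y ∈ ψ.target := extChartAt_target_mem_nhds (I := 𝓘(ℝ, B)) r₀
      refine h2.and ((continuousAt_extChartAt_symm (I := 𝓘(ℝ, B)) r₀).eventually ?_)
      rw [hψs]
      exact hO.mem_nhds hr₀
    exact (continuous_snd.tendsto q₀).eventually h1
  have hev2 : ∀ᶠ q in 𝓝 q₀, (q.2 ∈ ψ.target ∧ ψ.symm q.2 ∈ O) ∧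
      q.1 +ᵥ s (ψ.symm q.2) ∈ φ.source := by
    refine hev1.and ?_
    have h1 := (hsm q₀ hev1.self_of_nhds.1 hev1.self_of_nhds.2).continuousAt
    refine h1.eventually ?_
    simp only [hq₀, hψs, zero_vadd]
    exact extChartAt_source_mem_nhds (I := 𝓘(ℝ, E)) (s r₀)
  have hGs : ∀ᶠ q in 𝓝 q₀, ContDiffAt ℝ ∞ G q := by
    filter_upwards [hev2] with q hq
    exact (ContMDiffAt.comp q (g := φ) (contMDiffAt_extChartAt_of_mem hq.2)
      (hsm q hq.1.1 hq.1.2)).contDiffAt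
  have hG0 : ContDiffAt ℝ ∞ G q₀ := hGs.self_of_nhds
  have hD : HasFDerivAt G (fderiv ℝ G q₀) q₀ := (hG0.differentiableAt (by simp)).hasFDerivAt
  have hinj : ∀ x, fderiv ℝ G q₀ x = 0 → x = 0 := by
    rintro ⟨a, b⟩ hab
    -- Since the action preserves `π`, following `G` by `π` in charts gives the projection to `B`; a
    -- kernel vector therefore has no base component.
    have hb : b = 0 := by
      set H : E → B := fun y => ψ (π (φ.symm y)) with hH
      have hHs : ContMDiffAt 𝓘(ℝ, E) 𝓘(ℝ, B) ∞ H (G q₀) := by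
        have e1 : φ.symm (G q₀) = s r₀ := by rw [hGq₀]; exact extChartAt_to_inv _
        have e2 : π (φ.symm (G q₀)) = r₀ := by rw [e1, hπs r₀ hr₀]
        refine ContMDiffAt.comp (I' := 𝓘(ℝ, B)) (G q₀) (g := ψ) (f := fun y => π (φ.symm y)) ?_
          (ContMDiffAt.comp (I' := 𝓘(ℝ, E)) (G q₀) (g := π) (f := φ.symm) ?_ ?_)
        · rw [e2]; exact contMDiffAt_extChartAt
        · rw [e1]; exact hπ _ (hsV _ hr₀)
        · rw [hGq₀]; exact contMDiffAt_extChartAt_symm (mem_extChartAt_target _)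
      have h1 := (hHs.contDiffAt.differentiableAt (by simp)).hasFDerivAt.comp q₀ hD
      have h2 : H ∘ G =ᶠ[𝓝 q₀] fun q => q.2 := by
        filter_upwards [hev2] with q hq
        simp only [Function.comp_apply, hH, hG]
        rw [φ.left_inv hq.2, hA.apply_vadd _ _ (hsV _ hq.1.2), hπs _ hq.1.2, ψ.right_inv hq.1.1]
      have h3 := (h1.congr_of_eventuallyEq h2.symm).unique hasFDerivAt_snd
      have h4 := congrArg (fun A => A (a, b)) h3
      simp only [ContinuousLinearMap.comp_apply, hab, map_zero] at h4
      exact h4.symm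
    subst hb
    -- The remaining component is killed by the derivative of the orbit map through `s r₀`, hence
    -- vanishes by local freeness.
    have h1 : ContMDiffAt 𝓘(ℝ, T) 𝓘(ℝ, E) ∞ (fun t : T => t +ᵥ s r₀) 0 :=
      ContMDiffAt.comp 0 (g := fun p : T × M => p.1 +ᵥ p.2) (f := fun t => (t, s r₀))
        (hA.contMDiffAt 0 _ (hsV _ hr₀)) (contMDiffAt_id.prodMk contMDiffAt_const)
    have h2 := (h1.mdifferentiableAt (by simp)).hasMFDerivAt
    have h3 : HasMFDerivAt 𝓘(ℝ, E) 𝓘(ℝ, E) φ ((0 : T) +ᵥ s r₀)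
        (mfderiv 𝓘(ℝ, E) 𝓘(ℝ, E) φ (s r₀)) := by
      rw [zero_vadd]
      exact ((contMDiffAt_extChartAt (n := ∞)).mdifferentiableAt (by simp)).hasMFDerivAt
    have h4 := h3.comp (0 : T) h2
    have h5 : HasFDerivAt (fun t : T => (t, ψ r₀)) (ContinuousLinearMap.inl ℝ T B) 0 :=
      (hasFDerivAt_id (0 : T)).prodMk (hasFDerivAt_const (ψ r₀) (0 : T))
    have h6 : HasFDerivAt (G ∘ fun t : T => (t, ψ r₀)) _ 0 := hD.comp (0 : T) h5
    have h7 : G ∘ (fun t : T => (t, ψ r₀)) = φ ∘ fun t : T => t +ᵥ s r₀ := by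
      funext t
      simp only [Function.comp_apply, hG, hψs]
    rw [h7] at h6
    have h8 := hasMFDerivAt_unique h4 h6.hasMFDerivAt
    have h9 := congrArg (fun A : T →L[ℝ] E => A a) h8
    refine Prod.ext (hA.eq_zero_of_mfderiv _ (hsV _ hr₀) a ?_) rfl
    refine mfderiv_extChartAt_injective (x₀ := s r₀) (mem_extChartAt_source _) ?_
    refine h9.trans ?_
    refine Eq.trans ?_ (map_zero (mfderiv 𝓘(ℝ, E) 𝓘(ℝ, E) φ (s r₀))).symm
    exact hab
  have hdim' : Module.finrank ℝ (T × B) = Module.finrank ℝ E := by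
    rw [Module.finrank_prod, hdim, add_comm]
  obtain ⟨e, he⟩ : ∃ e : (T × B) ≃L[ℝ] E, (e : T × B →L[ℝ] E) = fderiv ℝ G q₀ :=
    ⟨(LinearEquiv.ofInjectiveOfFinrankEq (fderiv ℝ G q₀).toLinearMap
      ((injective_iff_map_eq_zero _).2 hinj) hdim').toContinuousLinearEquiv, by ext <;> rfl⟩
  have hD' : HasFDerivAt G (e : T × B →L[ℝ] E) q₀ := he ▸ hD
  set P := hG0.toOpenPartialHomeomorph G hD' (by simp) with hP
  have hPq₀ : q₀ ∈ P.source := hG0.mem_toOpenPartialHomeomorph_source hD' (by simp)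
  have hPG : ∀ q, P q = G q := fun _ => rfl
  have hPt : φ (s r₀) ∈ P.target := by
    rw [← hGq₀, ← hPG]
    exact P.map_source hPq₀
  have hPsymm : P.symm (φ (s r₀)) = q₀ := by rw [← hGq₀, ← hPG, P.left_inv hPq₀]
  have hcont : Filter.Tendsto P.symm (𝓝 (φ (s r₀))) (𝓝 q₀) := by
    have := P.continuousAt_symm hPt
    rwa [ContinuousAt, hPsymm] at this
  -- Smoothness of the inverse is needed at all points near `s r₀`, so invertibility of the
  -- derivative is spread to a neighbourhood of `q₀`.
  have hinv : ∀ᶠ q in 𝓝 q₀, fderiv ℝ G q ∈ range ((↑) : ((T × B) ≃L[ℝ] E) → T × B →L[ℝ] E) := by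
    have h1 : ContinuousAt (fderiv ℝ G) q₀ :=
      (hG0.fderiv_right (m := 0) (by simp)).continuousAt
    exact h1.eventually (by rw [← he]; exact e.nhds)
  have hφc : Filter.Tendsto φ (𝓝 (s r₀)) (𝓝 (φ (s r₀))) := continuousAt_extChartAt (s r₀)
  refine ⟨fun w => (P.symm (φ w)).1, ?_, ?_⟩
  · filter_upwards [hφc.eventually (P.open_target.mem_nhds hPt),
      hφc.eventually (hcont.eventually hev2), hφc.eventually (hcont.eventually hinv),
      hφc.eventually (hcont.eventually hGs),
      extChartAt_source_mem_nhds (I := 𝓘(ℝ, E)) (s r₀)] with w hw1 hw2 hw3 hw4 hw5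
    constructor
    · obtain ⟨e', he'⟩ := hw3
      have h1 : ContDiffAt ℝ ∞ P.symm (φ w) := by
        refine P.contDiffAt_symm (f₀' := e') hw1 ?_ hw4
        rw [he']
        exact (hw4.differentiableAt (by simp)).hasFDerivAt
      exact ContMDiffAt.comp w (g := fun y => (P.symm y).1) h1.fst.contMDiffAt
        (contMDiffAt_extChartAt_of_mem hw5)
    · have h1 : φ ((P.symm (φ w)).1 +ᵥ s (ψ.symm (P.symm (φ w)).2)) = φ w := P.right_inv hw1
      have h2 := φ.injOn hw2.2 hw5 h1
      -- Invariance of `π` forces the base component of the local inverse to be `π w`.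
      have h3 : π w = ψ.symm (P.symm (φ w)).2 := by
        rw [← hπs _ hw2.1.2, ← hA.apply_vadd (P.symm (φ w)).1 _ (hsV _ hw2.1.2), h2]
      rw [h3]
      exact h2
  · have h1 : Filter.Tendsto (fun p : T × S => (p.1, ψ p.2)) (𝓝 (0, r₀)) (𝓝 q₀) :=
      ContinuousAt.prodMk continuousAt_fst
        ((continuousAt_extChartAt r₀).comp (f := fun p : T × S => p.2) continuousAt_snd)
    filter_upwards [h1.eventually (P.open_source.mem_nhds hPq₀),
      (continuous_snd.tendsto (0, r₀)).eventually
        (extChartAt_source_mem_nhds (I := 𝓘(ℝ, B)) r₀)] with p hp1 hp2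
    have h2 : φ (p.1 +ᵥ s p.2) = P (p.1, ψ p.2) := by
      rw [hPG]
      simp only [hG]
      rw [ψ.left_inv hp2]
    rw [h2, P.left_inv hp1]

end IsLocallyFreeSmoothAction

/-! ### Orbits and period lattices of a locally free action along a fibration -/

/-- Two groups of deck transformations of coverings of homeomorphic spaces by a vector space are
isomorphic. -/
lemma AddSubgroup.nonempty_addEquiv_of_isAddQuotientCoveringMap {T X Y : Type*}
    [NormedAddCommGroup T] [NormedSpace ℝ T] [TopologicalSpace X] [TopologicalSpace Y]
    {G H : AddSubgroup T} {p : T → X} {q : T → Y} (hp : IsAddQuotientCoveringMap p G)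
    (hq : IsAddQuotientCoveringMap q H) (φ : X ≃ₜ Y) : Nonempty (G ≃+ H) := by
  have hp' := hp.homeomorph_comp φ
  obtain ⟨t, ht⟩ := hq.surjective ((φ ∘ p) 0)
  -- As `T` is simply connected, both deck groups are identified with the fundamental group of `Y`
  -- at one base point, up to passing to opposite groups.
  have e1 := hp'.fundamentalGroupEquiv (x := (φ ∘ p) 0) ⟨0, rfl⟩
  have e2 := hq.fundamentalGroupEquiv (x := (φ ∘ p) 0) ⟨t, ht⟩
  exact ⟨AddEquiv.toMultiplicative.symm (MulEquiv.op.symm (e1.symm.trans e2))⟩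

/-- A smooth section over `O` of the restriction of `π` to `V`. -/
structure IsLocalSection (E B : Type*) [NormedAddCommGroup E] [NormedSpace ℝ E]
    [NormedAddCommGroup B] [NormedSpace ℝ B] {M S : Type*} [TopologicalSpace M] [ChartedSpace E M]
    [TopologicalSpace S] [ChartedSpace B S] (V : Set M) (π : M → S) (s : S → M) (O : Set S) :
    Prop where
  isOpen : IsOpen O
  contMDiffOn : ContMDiffOn 𝓘(ℝ, B) 𝓘(ℝ, E) ∞ s O
  mem : ∀ r ∈ O, s r ∈ V
  apply : ∀ r ∈ O, π (s r) = r

/-- A locally free action on an open set `V`, along a submersion `π` of complementary dimension. -/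
structure IsLocallyFreeFibration (T : Type*) (E : Type u) (B : Type*) [NormedAddCommGroup T]
    [NormedSpace ℝ T] [NormedAddCommGroup E] [NormedSpace ℝ E] [NormedAddCommGroup B]
    [NormedSpace ℝ B] {M S : Type*} [TopologicalSpace M] [ChartedSpace E M] [AddAction T M]
    [TopologicalSpace S] [ChartedSpace B S] (V : Set M) (π : M → S) : Prop extends
    IsLocallyFreeSmoothAction T E B V π where
  isOpen : IsOpen V
  isSubmersionAt : ∀ z ∈ V, IsSubmersionAt 𝓘(ℝ, E) 𝓘(ℝ, B) ∞ π z
  finrank_eq : Module.finrank ℝ E = Module.finrank ℝ B + Module.finrank ℝ T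

namespace IsLocallyFreeFibration

variable {T B : Type*} {E : Type u} [NormedAddCommGroup T] [NormedSpace ℝ T]
  [NormedAddCommGroup E] [NormedSpace ℝ E] [NormedAddCommGroup B] [NormedSpace ℝ B]
  {M : Type*} [TopologicalSpace M] [ChartedSpace E M] [IsManifold 𝓘(ℝ, E) ∞ M]
  {S : Type*} [TopologicalSpace S] [ChartedSpace B S] [IsManifold 𝓘(ℝ, B) ∞ S]
  [AddAction T M] {V : Set M} {π : M → S}

omit [IsManifold 𝓘(ℝ, E) ∞ M] [IsManifold 𝓘(ℝ, B) ∞ S] in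
lemma contMDiffAt_proj (h : IsLocallyFreeFibration T E B V π) {z : M} (hz : z ∈ V) :
    ContMDiffAt 𝓘(ℝ, E) 𝓘(ℝ, B) ∞ π z := (h.isSubmersionAt z hz).contMDiffAt

lemma exists_isLocalSection (h : IsLocallyFreeFibration T E B V π) {z : M} (hz : z ∈ V) :
    ∃ (s : S → M) (O : Set S), IsLocalSection E B V π s O ∧ π z ∈ O ∧ s (π z) = z := by
  obtain ⟨s, O, hO, hzO, hs, hsz, hπs⟩ := (h.isSubmersionAt z hz).exists_local_section
  refine ⟨s, O ∩ s ⁻¹' V, ⟨hs.continuousOn.isOpen_inter_preimage hO h.isOpen,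
    hs.mono inter_subset_left, fun r hr => hr.2, fun r hr => hπs r hr.1⟩, ⟨hzO, ?_⟩, hsz⟩
  rw [mem_preimage, hsz]
  exact hz

omit [IsManifold 𝓘(ℝ, E) ∞ M] [IsManifold 𝓘(ℝ, B) ∞ S] in
lemma contMDiffAt_vadd_right (h : IsLocallyFreeFibration T E B V π) {z : M} (hz : z ∈ V) (t : T) :
    ContMDiffAt 𝓘(ℝ, T) 𝓘(ℝ, E) ∞ (fun t : T => t +ᵥ z) t :=
  ContMDiffAt.comp t (g := fun p : T × M => p.1 +ᵥ p.2) (f := fun t => (t, z))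
    (h.contMDiffAt t z hz) (contMDiffAt_id.prodMk contMDiffAt_const)

omit [IsManifold 𝓘(ℝ, E) ∞ M] [IsManifold 𝓘(ℝ, B) ∞ S] in
lemma contMDiffAt_vadd_left (h : IsLocallyFreeFibration T E B V π) {z : M} (hz : z ∈ V) (t : T) :
    ContMDiffAt 𝓘(ℝ, E) 𝓘(ℝ, E) ∞ (fun z : M => t +ᵥ z) z :=
  ContMDiffAt.comp z (g := fun p : T × M => p.1 +ᵥ p.2) (f := fun z => (t, z))
    (h.contMDiffAt t z hz) (contMDiffAt_const.prodMk contMDiffAt_id)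

variable [FiniteDimensional ℝ T] [FiniteDimensional ℝ E] [FiniteDimensional ℝ B]

lemma exists_time_of_section (h : IsLocallyFreeFibration T E B V π) {s : S → M} {O : Set S}
    (hs : IsLocalSection E B V π s O) {r₀ : S} (hr₀ : r₀ ∈ O) :
    ∃ τ : M → T, (∀ᶠ w in 𝓝 (s r₀), ContMDiffAt 𝓘(ℝ, E) 𝓘(ℝ, T) ∞ τ w ∧ τ w +ᵥ s (π w) = w) ∧
      ∀ᶠ p : T × S in 𝓝 (0, r₀), τ (p.1 +ᵥ s p.2) = p.1 :=
  h.exists_time h.finrank_eq (fun _ hz => h.contMDiffAt_proj hz) hs.isOpen hs.contMDiffOn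
    hs.mem hs.apply hr₀

/-- Within the fibre through `z`, the time function locally inverts the orbit map. This gives open
orbits, discrete stabilizers and the covering property. -/
lemma exists_time_in_fibre (h : IsLocallyFreeFibration T E B V π) {z : M} (hz : z ∈ V) :
    ∃ τ : M → T, ContinuousAt τ z ∧ τ z = 0 ∧ (∀ᶠ w in 𝓝 z, π w = π z → τ w +ᵥ z = w) ∧
      ∀ᶠ t in 𝓝 (0 : T), τ (t +ᵥ z) = t := by
  obtain ⟨s, O, hs, hzO, hsz⟩ := h.exists_isLocalSection hz
  obtain ⟨τ, h1, h2⟩ := h.exists_time_of_section hs hzO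
  rw [hsz] at h1
  refine ⟨τ, h1.self_of_nhds.1.continuousAt, ?_, ?_, ?_⟩
  · have := h2.self_of_nhds
    simpa [hsz] using this
  · filter_upwards [h1] with w hw hπ
    have := hw.2
    rwa [hπ, hsz] at this
  · have h3 : Filter.Tendsto (fun t : T => (t, π z)) (𝓝 0) (𝓝 (0, π z)) :=
      (Continuous.prodMk_left (π z)).tendsto 0
    filter_upwards [h3.eventually h2] with t ht
    rwa [hsz] at ht

/-- The action is transitive on connected fibres. -/
theorem exists_vadd_eq (h : IsLocallyFreeFibration T E B V π) {z w : M} (hz : z ∈ V) (hw : w ∈ V)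
    (hzw : π w = π z) (hconn : IsPreconnected (V ∩ π ⁻¹' {π z})) : ∃ t : T, t +ᵥ z = w := by
  have := isPreconnected_iff_preconnectedSpace.1 hconn
  have hopen : ∀ x : ↥(V ∩ π ⁻¹' {π z}), ∀ᶠ y : ↥(V ∩ π ⁻¹' {π z}) in 𝓝 x,
      (y : M) ∈ AddAction.orbit T (x : M) := by
    intro x
    obtain ⟨τ, -, -, h1, -⟩ := h.exists_time_in_fibre x.2.1
    filter_upwards [(continuous_subtype_val.tendsto x).eventually h1] with y hy
    exact ⟨_, hy (y.2.2.trans x.2.2.symm)⟩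
  -- Orbits are open in the fibre and partition it, so each is also closed there.
  have hcl : IsClopen {x : ↥(V ∩ π ⁻¹' {π z}) | (x : M) ∈ AddAction.orbit T z} := by
    constructor
    · rw [← isOpen_compl_iff, isOpen_iff_mem_nhds]
      intro x hx
      filter_upwards [hopen x] with y hy hyz
      refine hx ?_
      have h1 := AddAction.orbit_eq_iff.2 hy
      have h2 := AddAction.orbit_eq_iff.2 hyz
      exact AddAction.orbit_eq_iff.1 (h1.symm.trans h2)
    · rw [isOpen_iff_mem_nhds]
      intro x hx
      filter_upwards [hopen x] with y hy
      exact AddAction.orbit_eq_iff.1 ((AddAction.orbit_eq_iff.2 hy).trans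
        (AddAction.orbit_eq_iff.2 hx))
  have huniv := hcl.eq_univ ⟨⟨z, hz, rfl⟩, AddAction.mem_orbit_self z⟩
  have hmem : (⟨w, hw, hzw⟩ : ↥(V ∩ π ⁻¹' {π z})) ∈ (univ : Set _) := mem_univ _
  rw [← huniv] at hmem
  exact hmem

lemma eventually_eq_zero_of_vadd_eq (h : IsLocallyFreeFibration T E B V π) {z : M} (hz : z ∈ V) :
    ∀ᶠ t in 𝓝 (0 : T), t +ᵥ z = z → t = 0 := by
  obtain ⟨τ, -, h0, -, h1⟩ := h.exists_time_in_fibre hz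
  filter_upwards [h1] with t ht htz
  rw [← ht, htz, h0]

lemma discreteTopology_stabilizer (h : IsLocallyFreeFibration T E B V π) {z : M} (hz : z ∈ V) :
    DiscreteTopology (AddAction.stabilizer T z) := by
  refine discreteTopology_of_isOpen_singleton_zero ?_
  have : ∀ᶠ t in 𝓝 (0 : AddAction.stabilizer T z), t = 0 := by
    have h1 : Filter.Tendsto (fun t : AddAction.stabilizer T z => (t : T)) (𝓝 0) (𝓝 0) :=
      continuous_subtype_val.tendsto (0 : AddAction.stabilizer T z)
    filter_upwards [h1.eventually (h.eventually_eq_zero_of_vadd_eq hz)] with t ht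
    exact Subtype.ext (ht t.2)
  rw [isOpen_iff_mem_nhds]
  rintro x rfl
  exact this

/-- The orbit map onto a connected fibre is a covering. -/
theorem isAddQuotientCoveringMap_orbit (h : IsLocallyFreeFibration T E B V π) {z : M} (hz : z ∈ V)
    (hconn : IsPreconnected (V ∩ π ⁻¹' {π z})) :
    IsAddQuotientCoveringMap
      (fun t : T => (⟨t +ᵥ z, h.vadd_mem t z hz, h.apply_vadd t z hz⟩ : ↥(V ∩ π ⁻¹' {π z})))
      (AddAction.stabilizer T z) := by
  have hcont : Continuous
      (fun t : T => (⟨t +ᵥ z, h.vadd_mem t z hz, h.apply_vadd t z hz⟩ : ↥(V ∩ π ⁻¹' {π z}))) :=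
    (continuous_iff_continuousAt.2 fun t => (h.contMDiffAt_vadd_right hz t).continuousAt).subtype_mk
      _
  refine Topology.IsQuotientMap.isAddQuotientCoveringMap_of_addSubgroup
    (IsOpenMap.isQuotientMap ?_ hcont ?_) _ ⟨h.discreteTopology_stabilizer hz⟩ ?_
  -- Openness at `t`: with `τ` the time function centred at `t +ᵥ z`, the map `w ↦ τ w + t` is a
  -- local right inverse of the orbit map, continuous at that point.
  · rw [isOpenMap_iff_nhds_le]
    intro t U hU
    rw [Filter.mem_map] at hU
    obtain ⟨τ, h1, h2, h3, -⟩ := h.exists_time_in_fibre (h.vadd_mem t z hz)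
    have h4 : Filter.Tendsto (fun w => τ w + t) (𝓝 (t +ᵥ z)) (𝓝 t) := by
      have : ContinuousAt (fun w => τ w + t) (t +ᵥ z) := h1.add continuousAt_const
      rwa [ContinuousAt, h2, zero_add] at this
    have h5 := (h3.and (h4.eventually hU))
    refine Filter.mem_of_superset
      ((continuous_subtype_val.tendsto (⟨t +ᵥ z, h.vadd_mem t z hz, h.apply_vadd t z hz⟩ :
        ↥(V ∩ π ⁻¹' {π z}))).eventually h5) fun w hw => ?_
    have h6 : (τ w + t) +ᵥ z = (w : M) := by
      rw [add_vadd]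
      exact hw.1 (w.2.2.trans (h.apply_vadd t z hz).symm)
    have h7 := hw.2
    convert h7
    exact Subtype.ext h6.symm
  · rintro ⟨w, hw, hwz⟩
    obtain ⟨t, ht⟩ := h.exists_vadd_eq hz hw hwz hconn
    exact ⟨t, Subtype.ext ht⟩
  · intro t₁ t₂
    refine Subtype.ext_iff.trans ?_
    rw [AddAction.mem_stabilizer_iff, add_comm, add_vadd, neg_vadd_eq_iff, eq_comm]

/-- The rank of the period lattice depends only on the homeomorphism type of the fibre. -/
theorem finrank_stabilizer_eq (h : IsLocallyFreeFibration T E B V π) {z w : M} (hz : z ∈ V)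
    (hw : w ∈ V) (hz' : IsPreconnected (V ∩ π ⁻¹' {π z})) (hw' : IsPreconnected (V ∩ π ⁻¹' {π w}))
    (φ : ↥(V ∩ π ⁻¹' {π z}) ≃ₜ ↥(V ∩ π ⁻¹' {π w})) :
    Module.finrank ℤ (AddAction.stabilizer T z) = Module.finrank ℤ (AddAction.stabilizer T w) := by
  obtain ⟨e⟩ := AddSubgroup.nonempty_addEquiv_of_isAddQuotientCoveringMap
    (h.isAddQuotientCoveringMap_orbit hz hz') (h.isAddQuotientCoveringMap_orbit hw hw') φ
  exact e.toIntLinearEquiv.finrank_eq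

end IsLocallyFreeFibration

/-! ### Smooth bases of the period lattices -/

/-- Discreteness is essential, as `ℤ + √2 ℤ` in `ℝ` shows. The equality bounds the rank of the
periods by the dimension and makes integral bases linearly independent over `ℝ`. -/
lemma AddSubgroup.finrank_span_eq_of_discreteTopology {T : Type*} [NormedAddCommGroup T]
    [NormedSpace ℝ T] [FiniteDimensional ℝ T] (L : AddSubgroup T) [DiscreteTopology L] :
    Module.finrank ℝ (Submodule.span ℝ (L : Set T)) = Module.finrank ℤ L := by
  have h : Submodule.span ℤ (L : Set T) = AddSubgroup.toIntSubmodule L :=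
    Submodule.span_eq (AddSubgroup.toIntSubmodule L)
  have h1 : DiscreteTopology (Submodule.span ℤ (L : Set T)) := by
    rw [h]
    exact ‹DiscreteTopology L›
  have h2 := Real.finrank_eq_int_finrank_of_discrete h1
  rw [Set.finrank, Set.finrank, h] at h2
  exact h2

/-- A discrete subgroup of a vector space has a `ℤ`-basis that is linearly independent over `ℝ`. -/
lemma AddSubgroup.exists_basis_of_discreteTopology {T : Type*} [NormedAddCommGroup T]
    [NormedSpace ℝ T] [FiniteDimensional ℝ T] (L : AddSubgroup T) [DiscreteTopology L] {m : ℕ}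
    (hm : Module.finrank ℤ L = m) :
    ∃ v : Fin m → T, LinearIndependent ℝ v ∧
      ∀ t, t ∈ L ↔ ∃ n : Fin m → ℤ, t = ∑ i, (n i : ℝ) • v i := by
  have hd : DiscreteTopology (AddSubgroup.toIntSubmodule L) := ‹DiscreteTopology L›
  have hfin : Module.Finite ℤ L :=
    inferInstanceAs (Module.Finite ℤ (AddSubgroup.toIntSubmodule L))
  have hfree : Module.Free ℤ L := inferInstanceAs (Module.Free ℤ (AddSubgroup.toIntSubmodule L))
  let b := Module.finBasisOfFinrankEq ℤ L hm
  have hb : ∀ t, t ∈ L ↔ ∃ n : Fin m → ℤ, t = ∑ i, (n i : ℝ) • (b i : T) := by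
    intro t
    constructor
    · intro ht
      refine ⟨fun i => b.repr ⟨t, ht⟩ i, ?_⟩
      have := congrArg (L.subtype) (b.sum_repr ⟨t, ht⟩)
      rw [map_sum] at this
      refine this.symm.trans (Finset.sum_congr rfl fun i _ => ?_)
      rw [map_zsmul, Int.cast_smul_eq_zsmul]
      rfl
    · rintro ⟨n, rfl⟩
      refine sum_mem fun i _ => ?_
      rw [Int.cast_smul_eq_zsmul]
      exact zsmul_mem (b i).2 _
  refine ⟨fun i => b i, ?_, hb⟩
  -- The basis spans the real span of `L`, whose dimension is the integral rank `m`; `m` vectors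
  -- spanning dimension `m` are independent.
  rw [linearIndependent_iff_card_eq_finrank_span, Fintype.card_fin, Set.finrank]
  refine hm.symm.trans (L.finrank_span_eq_of_discreteTopology.symm.trans ?_)
  suffices h : Submodule.span ℝ (L : Set T) = Submodule.span ℝ (range fun i => (b i : T)) by rw [h]
  refine le_antisymm (Submodule.span_le.2 fun t ht => ?_) (Submodule.span_mono ?_)
  · obtain ⟨n, rfl⟩ := (hb t).1 ht
    exact sum_mem fun i _ => Submodule.smul_mem _ _ (Submodule.subset_span ⟨i, rfl⟩)
  · rintro _ ⟨i, rfl⟩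
    exact (b i).2

/-- Vectors of a discrete subgroup, of the right number and linearly independent, generate it if
the points of the subgroup in the unit cell are vertices. -/
lemma AddSubgroup.exists_eq_sum_of_forall_cell {T : Type*} [NormedAddCommGroup T]
    [NormedSpace ℝ T] [FiniteDimensional ℝ T] (L : AddSubgroup T) [DiscreteTopology L] {m : ℕ}
    (hm : Module.finrank ℤ L = m) {v : Fin m → T} (hv : LinearIndependent ℝ v) (hvL : ∀ i, v i ∈ L)
    (hcell : ∀ x : Fin m → ℝ, x ∈ Icc (0 : Fin m → ℝ) 1 → ∑ i, x i • v i ∈ L →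
      ∀ i, ∃ n : ℤ, x i = n) {t : T} (ht : t ∈ L) : ∃ n : Fin m → ℤ, t = ∑ i, (n i : ℝ) • v i := by
  -- Both spans have dimension `m`, so every element of `L` has real coordinates in `v`; subtracting
  -- integer parts moves it into the unit cell.
  have hspan : Submodule.span ℝ (range v) = Submodule.span ℝ (L : Set T) := by
    refine Submodule.eq_of_le_of_finrank_eq (Submodule.span_mono ?_) ?_
    · rintro _ ⟨i, rfl⟩
      exact hvL i
    · rw [finrank_span_eq_card hv, AddSubgroup.finrank_span_eq_of_discreteTopology, hm,
        Fintype.card_fin]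
  have ht' : t ∈ Submodule.span ℝ (range v) := hspan ▸ Submodule.subset_span ht
  obtain ⟨x, rfl⟩ := (Submodule.mem_span_range_iff_exists_fun ℝ).1 ht'
  have hsplit : ∑ i, Int.fract (x i) • v i = ∑ i, x i • v i - ∑ i, ⌊x i⌋ • v i := by
    rw [← Finset.sum_sub_distrib]
    refine Finset.sum_congr rfl fun i _ => ?_
    rw [← Int.cast_smul_eq_zsmul ℝ, ← sub_smul, Int.self_sub_floor]
  have h1 := hcell (fun i => Int.fract (x i))
    ⟨fun i => Int.fract_nonneg _, fun i => (Int.fract_lt_one _).le⟩ (by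
      rw [hsplit]
      exact sub_mem ht (sum_mem fun i _ => zsmul_mem (hvL i) _))
  choose n hn using h1
  refine ⟨fun i => n i + ⌊x i⌋, Finset.sum_congr rfl fun i _ => ?_⟩
  push_cast
  rw [← hn i, Int.fract_add_floor]

namespace IsLocallyFreeFibration

variable {T B : Type*} {E : Type u} [NormedAddCommGroup T] [NormedSpace ℝ T]
  [NormedAddCommGroup E] [NormedSpace ℝ E] [NormedAddCommGroup B] [NormedSpace ℝ B]
  {M : Type*} [TopologicalSpace M] [ChartedSpace E M] [IsManifold 𝓘(ℝ, E) ∞ M]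
  {S : Type*} [TopologicalSpace S] [ChartedSpace B S] [IsManifold 𝓘(ℝ, B) ∞ S]
  [AddAction T M] {V : Set M} {π : M → S}
  [FiniteDimensional ℝ T] [FiniteDimensional ℝ E] [FiniteDimensional ℝ B]

omit [IsManifold 𝓘(ℝ, E) ∞ M] [IsManifold 𝓘(ℝ, B) ∞ S] [FiniteDimensional ℝ T]
  [FiniteDimensional ℝ E] [FiniteDimensional ℝ B] in
lemma continuousAt_vadd_section (h : IsLocallyFreeFibration T E B V π) {s : S → M} {O : Set S}
    (hs : IsLocalSection E B V π s O) (t : T) {r : S} (hr : r ∈ O) :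
    ContinuousAt (fun p : T × S => p.1 +ᵥ s p.2) (t, r) :=
  (h.contMDiffAt_vadd_section hs.isOpen hs.contMDiffOn hs.mem t hr).continuousAt

/-- A period extends to a smooth family of periods along a section. -/
lemma exists_period_extension (h : IsLocallyFreeFibration T E B V π) {s : S → M} {O : Set S}
    (hs : IsLocalSection E B V π s O) {r₀ : S} (hr₀ : r₀ ∈ O) {v : T} (hv : v +ᵥ s r₀ = s r₀) :
    ∃ w : S → T, w r₀ = v ∧ ∀ᶠ r in 𝓝 r₀, ContMDiffAt 𝓘(ℝ, B) 𝓘(ℝ, T) ∞ w r ∧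
      w r +ᵥ s r = s r := by
  obtain ⟨τ, h1, h2⟩ := h.exists_time_of_section hs hr₀
  have hτ0 : τ (s r₀) = 0 := by simpa using h2.self_of_nhds
  -- For `r` near `r₀`, the vector `v` moves `s r` to a point of the same fibre near the section;
  -- subtracting the time from `s r` to that point closes the loop.
  refine ⟨fun r => v - τ (v +ᵥ s r), by simp only [hv, hτ0, sub_zero], ?_⟩
  have hc : Filter.Tendsto (fun r => v +ᵥ s r) (𝓝 r₀) (𝓝 (s r₀)) := by
    have := (h.continuousAt_vadd_section hs v hr₀).comp (f := fun r => (v, r))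
      (Continuous.prodMk_right v).continuousAt
    simpa only [ContinuousAt, Function.comp_def, hv] using this
  filter_upwards [hc.eventually h1, hs.isOpen.mem_nhds hr₀] with r hr hrO
  constructor
  · refine contMDiffAt_const.sub (ContMDiffAt.comp r (g := τ) (f := fun r => v +ᵥ s r) hr.1 ?_)
    exact ContMDiffAt.comp r (g := fun z => v +ᵥ z) (h.contMDiffAt_vadd_left (hs.mem r hrO) v)
      (hs.contMDiffOn.contMDiffAt (hs.isOpen.mem_nhds hrO))
  · have h3 := hr.2
    rw [h.apply_vadd _ _ (hs.mem r hrO), hs.apply r hrO] at h3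
    rw [sub_eq_neg_add, add_vadd, neg_vadd_eq_iff]
    exact h3.symm

/-- The excluded neighbourhood of `0` is uniform in `r`: a small period `t` at `s r` satisfies `t =
τ (t +ᵥ s r) = τ (s r) = 0`. -/
lemma eventually_eq_zero_of_vadd_section_eq (h : IsLocallyFreeFibration T E B V π) {s : S → M}
    {O : Set S} (hs : IsLocalSection E B V π s O) {r₀ : S} (hr₀ : r₀ ∈ O) :
    ∀ᶠ p : T × S in 𝓝 (0, r₀), p.1 +ᵥ s p.2 = s p.2 → p.1 = 0 := by
  obtain ⟨τ, -, h2⟩ := h.exists_time_of_section hs hr₀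
  have hc : Filter.Tendsto (fun p : T × S => ((0 : T), p.2)) (𝓝 (0, r₀)) (𝓝 (0, r₀)) := by
    have : Continuous fun p : T × S => ((0 : T), p.2) := by fun_prop
    exact this.tendsto (0, r₀)
  filter_upwards [h2, hc.eventually h2] with p hp1 hp2 hp
  rw [← hp1, hp]
  simpa using hp2

/-- Locally, the period lattices along a section have a smooth basis, if their rank is constant. -/
theorem exists_smooth_period_basis [T2Space M] (h : IsLocallyFreeFibration T E B V π) {s : S → M}
    {O : Set S} (hs : IsLocalSection E B V π s O) {m : ℕ}
    (hm : ∀ r ∈ O, Module.finrank ℤ (AddAction.stabilizer T (s r)) = m) {r₀ : S} (hr₀ : r₀ ∈ O) :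
    ∃ v : Fin m → S → T, ∀ᶠ r in 𝓝 r₀, r ∈ O ∧ (∀ i, ContMDiffAt 𝓘(ℝ, B) 𝓘(ℝ, T) ∞ (v i) r) ∧
      LinearIndependent ℝ (fun i => v i r) ∧
      ∀ t, t +ᵥ s r = s r ↔ ∃ n : Fin m → ℤ, t = ∑ i, (n i : ℝ) • v i r := by
  have hdisc : ∀ r ∈ O, DiscreteTopology (AddAction.stabilizer T (s r)) :=
    fun r hr => h.discreteTopology_stabilizer (hs.mem r hr)
  have := hdisc r₀ hr₀
  obtain ⟨b, hbli, hb⟩ :=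
    (AddAction.stabilizer T (s r₀)).exists_basis_of_discreteTopology (hm r₀ hr₀)
  have hbmem : ∀ i, b i +ᵥ s r₀ = s r₀ := fun i => by
    refine (hb (b i)).2 ⟨Pi.single i 1, ?_⟩
    rw [Finset.sum_eq_single i (fun j _ hj => by simp [hj]) (by simp)]
    simp
  choose v hv0 hv using fun i => h.exists_period_extension hs hr₀ (hbmem i)
  have hvall : ∀ᶠ r in 𝓝 r₀, ∀ i, ContMDiffAt 𝓘(ℝ, B) 𝓘(ℝ, T) ∞ (v i) r ∧
      v i r +ᵥ s r = s r := Filter.eventually_all.2 hv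
  have hvcont : ContinuousAt (fun r i => v i r) r₀ :=
    continuousAt_pi.2 fun i => (hv i).self_of_nhds.1.continuousAt
  have hli : ∀ᶠ r in 𝓝 r₀, LinearIndependent ℝ (fun i => v i r) := by
    refine hvcont.eventually (isOpen_setOfPred_linearIndependent.mem_nhds ?_)
    change LinearIndependent ℝ fun i => v i r₀
    simpa only [hv0] using hbli
  have hfcont : ∀ x : Fin m → ℝ, ContinuousAt
      (fun p : S × (Fin m → ℝ) => ∑ i, p.2 i • v i p.1) (r₀, x) := by
    intro x
    refine tendsto_finsetSum _ fun i _ => ?_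
    refine Filter.Tendsto.smul ?_ ?_
    · exact ((continuous_apply i).comp continuous_snd).tendsto _
    · exact ContinuousAt.comp (f := fun p : S × (Fin m → ℝ) => p.1) (g := v i)
        (hv i).self_of_nhds.1.continuousAt continuousAt_fst
  -- No new periods appear in the unit cell near `r₀`. The closed cell is compact, so the claim may
  -- be checked near each pair `(r₀, x)`.
  have hcell : ∀ᶠ r in 𝓝 r₀, ∀ x ∈ Icc (0 : Fin m → ℝ) 1,
      (∑ i, x i • v i r) +ᵥ s r = s r → ∀ i, ∃ n : ℤ, x i = n := by
    refine isCompact_Icc.eventually_forall_of_forall_eventually fun x _ => ?_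
    have hfst : Filter.Tendsto (fun p : S × (Fin m → ℝ) => p.1) (𝓝 (r₀, x)) (𝓝 r₀) :=
      continuous_fst.tendsto _
    by_cases hx : (∑ i, x i • v i r₀) +ᵥ s r₀ = s r₀
    · simp only [hv0] at hx
      obtain ⟨n, hn⟩ := (hb _).1 hx
      have hxn : ∀ i, x i = n i := by
        have h1 : ∑ i, (x i - n i) • b i = 0 := by
          simp only [sub_smul, Finset.sum_sub_distrib]
          rw [hn, sub_self]
        intro i
        exact sub_eq_zero.1 (Fintype.linearIndependent_iff.1 hbli _ h1 i)
      -- If `x` gives a period at `r₀`, it is an integer vector `n`. A nearby period with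
      -- coordinates `y` differs from the one with coordinates `n` by a small period, which must
      -- vanish.
      have hdiff : ContinuousAt
          (fun p : S × (Fin m → ℝ) => (∑ i, (p.2 i - n i) • v i p.1, p.1)) (r₀, x) := by
        refine ContinuousAt.prodMk ?_ continuousAt_fst
        refine ContinuousAt.comp (f := fun p : S × (Fin m → ℝ) => (p.1, fun i => p.2 i - n i))
          (g := fun p : S × (Fin m → ℝ) => ∑ i, p.2 i • v i p.1) (hfcont _) ?_
        exact Continuous.continuousAt (by fun_prop)
      have h0 := hdiff.tendsto
      simp only [hxn, sub_self, zero_smul, Finset.sum_const_zero] at h0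
      filter_upwards [h0.eventually (h.eventually_eq_zero_of_vadd_section_eq hs hr₀),
        hfst.eventually hli, hfst.eventually hvall] with p hp1 hp2 hp3 hp4 i
      refine ⟨n i, ?_⟩
      have h5 : ∑ i, (p.2 i - n i) • v i p.1 ∈ AddAction.stabilizer T (s p.1) := by
        simp only [sub_smul, Finset.sum_sub_distrib]
        refine sub_mem hp4 (sum_mem fun i _ => ?_)
        rw [Int.cast_smul_eq_zsmul]
        exact zsmul_mem (hp3 i).2 _
      have h6 := hp1 h5
      exact sub_eq_zero.1 (Fintype.linearIndependent_iff.1 hp2 _ h6 i)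
    -- If `x` does not give a period at `r₀`, then in a Hausdorff space the same holds for nearby
    -- coordinates and base points.
    · have h1 : ContinuousAt (fun p : S × (Fin m → ℝ) => (∑ i, p.2 i • v i p.1) +ᵥ s p.1) (r₀, x) :=
        ContinuousAt.comp (f := fun p : S × (Fin m → ℝ) => (∑ i, p.2 i • v i p.1, p.1))
          (g := fun p : T × S => p.1 +ᵥ s p.2) (h.continuousAt_vadd_section hs _ hr₀)
          ((hfcont x).prodMk continuousAt_fst)
      have h2 : ContinuousAt (fun p : S × (Fin m → ℝ) => s p.1) (r₀, x) :=
        ContinuousAt.comp (f := fun p : S × (Fin m → ℝ) => p.1) (g := s)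
          (hs.contMDiffOn.contMDiffAt (hs.isOpen.mem_nhds hr₀)).continuousAt continuousAt_fst
      filter_upwards [(h1.ne_iff_eventually_ne h2).1 hx] with p hp1 hp2
      exact absurd hp2 hp1
  refine ⟨v, ?_⟩
  filter_upwards [hs.isOpen.mem_nhds hr₀, hvall, hli, hcell] with r hrO hr1 hr2 hr3
  refine ⟨hrO, fun i => (hr1 i).1, hr2, fun t => ⟨fun ht => ?_, ?_⟩⟩
  -- Constancy of the rank enters here: `m` independent periods span the whole lattice over `ℝ`, so
  -- checking the cell suffices.
  · have := hdisc r hrO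
    exact (AddAction.stabilizer T (s r)).exists_eq_sum_of_forall_cell (hm r hrO) hr2
      (fun i => (hr1 i).2) hr3 ht
  · rintro ⟨n, rfl⟩
    change _ ∈ AddAction.stabilizer T (s r)
    refine sum_mem fun i _ => ?_
    rw [Int.cast_smul_eq_zsmul]
    exact zsmul_mem (hr1 i).2 _

end IsLocallyFreeFibration

/-! ### Trivial principal bundles from smooth bases of periods -/

namespace IsLocallyFreeFibration

open PartialIntegrability

variable {T B : Type*} {E : Type u} [NormedAddCommGroup T] [NormedSpace ℝ T]
  [NormedAddCommGroup E] [NormedSpace ℝ E] [NormedAddCommGroup B] [NormedSpace ℝ B]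
  {M : Type*} [TopologicalSpace M] [ChartedSpace E M] [IsManifold 𝓘(ℝ, E) ∞ M]
  {S : Type*} [TopologicalSpace S] [ChartedSpace B S] [IsManifold 𝓘(ℝ, B) ∞ S]
  [AddAction T M] {V : Set M} {π : M → S}
  [FiniteDimensional ℝ T] [FiniteDimensional ℝ E] [FiniteDimensional ℝ B]
  {A : Type*} [NormedAddCommGroup A] [NormedSpace ℝ A] [CompleteSpace A]
  {EG HG : Type*} [NormedAddCommGroup EG] [NormedSpace ℝ EG] [TopologicalSpace HG]
  {IG : ModelWithCorners ℝ EG HG}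
  {G : Type*} [CommGroup G] [TopologicalSpace G] [ChartedSpace HG G]

/-- A locally free action with transitive fibres is a trivial principal bundle over a domain of a
section over which its periods are the kernel of a group covering `q`, up to a smooth family of
linear isomorphisms. -/
theorem isTrivialPrincipalBundle (h : IsLocallyFreeFibration T E B V π) {s : S → M} {O : Set S}
    (hs : IsLocalSection E B V π s O) {N : Opens S} {U : Opens M}
    (hU : (U : Set M) = V ∩ π ⁻¹' (N : Set S)) (hNO : ∀ r ∈ N, r ∈ O) {p : U → N}
    (hp : ∀ u : U, (p u : S) = π u)
    (htrans : ∀ z ∈ V, ∀ w ∈ V, π z ∈ N → π w = π z → ∃ t : T, t +ᵥ z = w)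
    {L : S → A →L[ℝ] T} (hL : ∀ r ∈ N, ContMDiffAt 𝓘(ℝ, B) 𝓘(ℝ, A →L[ℝ] T) ∞ L r)
    (hLi : ∀ r ∈ N, (L r).IsInvertible)
    {q : A → G} (hq : ContMDiff 𝓘(ℝ, A) IG ∞ q) (hq_add : ∀ a b, q (a + b) = q a * q b)
    (hlift : ∀ g₀, ∃ ℓ : G → A, ContMDiffAt IG 𝓘(ℝ, A) ∞ ℓ g₀ ∧ ∀ g, q (ℓ g) = g)
    (hper : ∀ r ∈ N, ∀ a, L r a +ᵥ s r = s r ↔ q a = 1) :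
    IsTrivialPrincipalBundle 𝓘(ℝ, B) 𝓘(ℝ, E) IG G p := by
  have hUV : ∀ u : U, (u : M) ∈ V := fun u => ((Set.ext_iff.1 hU u).1 u.2).1
  have hUN : ∀ u : U, π u ∈ N := fun u => ((Set.ext_iff.1 hU u).1 u.2).2
  have hmemU : ∀ z ∈ V, π z ∈ N → z ∈ U := fun z h1 h2 => (Set.ext_iff.1 hU z).2 ⟨h1, h2⟩
  have hsV : ∀ r ∈ N, s r ∈ V := fun r hr => hs.mem r (hNO r hr)
  have hπs : ∀ r ∈ N, π (s r) = r := fun r hr => hs.apply r (hNO r hr)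
  have hq_zero : q 0 = 1 := by
    have := hq_add 0 0
    rwa [add_zero, left_eq_mul] at this
  have hq_sub : ∀ a b, q a = q b ↔ q (a - b) = 1 := by
    intro a b
    have := hq_add (a - b) b
    rw [sub_add_cancel] at this
    rw [this, mul_eq_right]
  have hsec : ∀ r ∈ N, ∀ a b, L r a +ᵥ s r = L r b +ᵥ s r ↔ q a = q b := by
    intro r hr a b
    rw [hq_sub, ← hper r hr, map_sub, sub_eq_neg_add, add_vadd, neg_vadd_eq_iff]
  have htime : ∀ u : U, ∃ t : T, t +ᵥ s (π u) = u := fun u =>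
    htrans _ (hsV _ (hUN u)) _ (hUV u) (by rw [hπs _ (hUN u)]; exact hUN u)
      (hπs _ (hUN u)).symm
  -- Every point of the fibre is a translate of the section and `T` is commutative, so periods at `s
  -- (π u)` are also periods at `u`.
  have hact : ∀ (u : U) (a b : A), q a = q b → L (π u) a +ᵥ (u : M) = L (π u) b +ᵥ (u : M) := by
    intro u a b hab
    obtain ⟨t, ht⟩ := htime u
    have h1 : ∀ c, L (π u) c +ᵥ (u : M) = t +ᵥ (L (π u) c +ᵥ s (π u)) := fun c =>
      (congrArg (fun z => L (π u) c +ᵥ z) ht.symm).trans (vadd_comm _ _ _)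
    rw [h1, h1, (hsec _ (hUN u) a b).2 hab]
  -- `σ` is a global right inverse of `q` that need not be continuous. By `hact` and `hsec` the
  -- choice does not matter, so smoothness is checked with a lift `ℓ` smooth at the given point.
  obtain ⟨σ, hσ⟩ : ∃ σ : G → A, ∀ g, q (σ g) = g := (hlift 1).imp fun ℓ hℓ => hℓ.2
  have hinv_apply : ∀ r ∈ N, ∀ t, L r ((L r).inverse t) = t := by
    intro r hr t
    obtain ⟨e, he⟩ := hLi r hr
    rw [← he, ContinuousLinearMap.inverse_equiv]
    exact e.apply_symm_apply t
  let act : G → U → U := fun g u => ⟨L (π u) (σ g) +ᵥ (u : M), hmemU _ (h.vadd_mem _ _ (hUV u))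
    (by rw [h.apply_vadd _ _ (hUV u)]; exact hUN u)⟩
  have hact_coe : ∀ g u, ((act g u : U) : M) = L (π u) (σ g) +ᵥ (u : M) := fun _ _ => rfl
  have hπact : ∀ g u, π (act g u : U) = π u := fun g u => h.apply_vadd _ _ (hUV u)
  let action : MulAction G U :=
    { smul := act
      one_smul := fun u => Subtype.ext (by
        change L (π u) (σ 1) +ᵥ (u : M) = u
        rw [hact u (σ 1) 0 (by rw [hσ, hq_zero]), map_zero, zero_vadd])
      mul_smul := fun g g' u => Subtype.ext (by
        change L (π u) (σ (g * g')) +ᵥ (u : M) = L (π (act g' u : U)) (σ g) +ᵥ (act g' u : M)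
        rw [hπact, hact_coe, ← add_vadd, ← map_add]
        exact hact u _ _ (by rw [hq_add, hσ, hσ, hσ])) }
  have hsmul : ∀ (g : G) (u : U), ((g • u : U) : M) = L (π u) (σ g) +ᵥ (u : M) := fun _ _ => rfl
  let time : U → T := fun u => (htime u).choose
  have htime_spec : ∀ u, time u +ᵥ s (π u) = u := fun u => (htime u).choose_spec
  let Φ : N × G ≃ U :=
    { toFun := fun x => ⟨L x.1 (σ x.2) +ᵥ s x.1, hmemU _ (h.vadd_mem _ _ (hsV _ x.1.2))
        (by rw [h.apply_vadd _ _ (hsV _ x.1.2), hπs _ x.1.2]; exact x.1.2)⟩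
      invFun := fun u => (p u, q ((L (π u)).inverse (time u)))
      left_inv := by
        rintro ⟨r, g⟩
        set u : U := ⟨L r (σ g) +ᵥ s r, hmemU _ (h.vadd_mem _ _ (hsV _ r.2))
          (by rw [h.apply_vadd _ _ (hsV _ r.2), hπs _ r.2]; exact r.2)⟩ with hu
        have hπu : π u = r := by
          change π (L r (σ g) +ᵥ s r) = r
          rw [h.apply_vadd _ _ (hsV _ r.2), hπs _ r.2]
        refine Prod.ext (Subtype.ext ((hp u).trans hπu)) ?_
        change q ((L (π u)).inverse (time u)) = g
        rw [← hσ g, ← hsec _ r.2]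
        have h1 := htime_spec u
        rw [hπu] at h1 ⊢
        rw [hinv_apply _ r.2, h1]
      right_inv := fun u => Subtype.ext (by
        change L (p u) (σ (q ((L (π u)).inverse (time u)))) +ᵥ s (p u) = u
        rw [hp, (hsec _ (hUN u) _ ((L (π u)).inverse (time u))).2 (hσ _), hinv_apply _ (hUN u)]
        exact htime_spec u) }
  have hΦ_coe : ∀ x, ((Φ x : U) : M) = L x.1 (σ x.2) +ᵥ s x.1 := fun _ => rfl
  have hs_at : ∀ r ∈ N, ContMDiffAt 𝓘(ℝ, B) 𝓘(ℝ, E) ∞ s r := fun r hr =>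
    hs.contMDiffOn.contMDiffAt (hs.isOpen.mem_nhds (hNO r hr))
  have hΦ_smooth : ContMDiff (𝓘(ℝ, B).prod IG) 𝓘(ℝ, E) ∞ Φ := by
    rintro ⟨r, g⟩
    rw [← ContMDiffAt.subtypeVal_comp_iff]
    obtain ⟨ℓ, hℓ, hℓq⟩ := hlift g
    have h1 : ContMDiffAt (𝓘(ℝ, B).prod IG) 𝓘(ℝ, B) ∞ (fun x : N × G => (x.1 : S)) (r, g) :=
      contMDiff_subtype_val.contMDiffAt.comp (r, g) contMDiffAt_fst
    have h2 : ContMDiffAt (𝓘(ℝ, B).prod IG) 𝓘(ℝ, A →L[ℝ] T) ∞ (fun x : N × G => L x.1) (r, g) :=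
      ContMDiffAt.comp (r, g) (g := L) (hL r r.2) h1
    have h3 : ContMDiffAt (𝓘(ℝ, B).prod IG) 𝓘(ℝ, A) ∞ (fun x : N × G => ℓ x.2) (r, g) :=
      ContMDiffAt.comp (r, g) (g := ℓ) hℓ contMDiffAt_snd
    have h4 : ContMDiffAt (𝓘(ℝ, B).prod IG) 𝓘(ℝ, E) ∞ (fun x : N × G => s x.1) (r, g) :=
      ContMDiffAt.comp (r, g) (g := s) (hs_at r r.2) h1
    have h5 := ContMDiffAt.comp (r, g) (g := fun x : T × M => x.1 +ᵥ x.2)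
      (f := fun x : N × G => (L x.1 (ℓ x.2), s x.1))
      (h.contMDiffAt _ _ (hsV r r.2)) ((h2.clm_apply h3).prodMk h4)
    refine h5.congr_of_eventuallyEq (Filter.Eventually.of_forall fun x => ?_)
    exact (hsec _ x.1.2 _ _).2 (by rw [hσ, hℓq])
  have hπ_smooth : ∀ u : U, ContMDiffAt 𝓘(ℝ, E) 𝓘(ℝ, B) ∞ (fun u : U => π u) u := fun u =>
    ContMDiffAt.comp u (g := π) (h.contMDiffAt_proj (hUV u)) contMDiff_subtype_val.contMDiffAt
  have hinv_smooth : ContMDiff 𝓘(ℝ, E) (𝓘(ℝ, B).prod IG) ∞ Φ.symm := by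
    intro u
    have hp_smooth : ContMDiffAt 𝓘(ℝ, E) 𝓘(ℝ, B) ∞ p u := by
      rw [← ContMDiffAt.subtypeVal_comp_iff]
      exact (hπ_smooth u).congr_of_eventuallyEq (Filter.Eventually.of_forall hp)
    refine ContMDiffAt.prodMk (f := p) (g := fun u => q ((L (π u)).inverse (time u))) hp_smooth ?_
    -- The chosen function `time` need not be continuous. Near `u` it is replaced by `time u + τ
    -- (-time u +ᵥ w)`, which is smooth and gives the same element of `G`.
    obtain ⟨τ, hτ, -⟩ := h.exists_time_of_section hs (hNO _ (hUN u))
    have h0 : -time u +ᵥ (u : M) = s (π u) := by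
      rw [neg_vadd_eq_iff]
      exact (htime_spec u).symm
    have h1 : ContMDiffAt 𝓘(ℝ, E) 𝓘(ℝ, E) ∞ (fun w : U => -time u +ᵥ (w : M)) u :=
      ContMDiffAt.comp u (g := fun w : M => -time u +ᵥ w) (h.contMDiffAt_vadd_left (hUV u) _)
        contMDiff_subtype_val.contMDiffAt
    have h2 : ContMDiffAt 𝓘(ℝ, E) 𝓘(ℝ, T) ∞
        (fun w : U => time u + τ (-time u +ᵥ (w : M))) u := by
      refine contMDiffAt_const.add (ContMDiffAt.comp u (g := τ) ?_ h1)
      rw [h0]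
      exact hτ.self_of_nhds.1
    have h3 : ContMDiffAt 𝓘(ℝ, E) 𝓘(ℝ, T →L[ℝ] A) ∞ (fun w : U => (L (π w)).inverse) u :=
      ContMDiffAt.comp u (g := fun K : A →L[ℝ] T => K.inverse)
        (hLi _ (hUN u)).contDiffAt_map_inverse.contMDiffAt
        (ContMDiffAt.comp u (g := L) (hL _ (hUN u)) (hπ_smooth u))
    have h4 := ContMDiffAt.comp u (g := q) (hq _) (h3.clm_apply h2)
    refine h4.congr_of_eventuallyEq ?_
    have h5 : Filter.Tendsto (fun w : U => -time u +ᵥ (w : M)) (𝓝 u) (𝓝 (s (π u))) := by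
      have := h1.continuousAt
      rwa [ContinuousAt, h0] at this
    filter_upwards [h5.eventually hτ] with w hw
    have h7 : (time u + τ (-time u +ᵥ (w : M))) +ᵥ s (π w) = w := by
      have := hw.2
      rw [h.apply_vadd _ _ (hUV w)] at this
      rw [add_vadd, this, ← add_vadd, add_neg_cancel, zero_vadd]
    change q ((L (π w)).inverse (time w)) = q ((L (π w)).inverse _)
    rw [← hsec _ (hUN w), hinv_apply _ (hUN w), hinv_apply _ (hUN w), h7, htime_spec]
  refine ⟨action, ⟨Φ, hΦ_smooth, hinv_smooth⟩, ⟨?_⟩, ?_, ?_⟩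
  · rintro ⟨g, u⟩
    rw [← ContMDiffAt.subtypeVal_comp_iff]
    obtain ⟨ℓ, hℓ, hℓq⟩ := hlift g
    have h1 : ContMDiffAt (IG.prod 𝓘(ℝ, E)) 𝓘(ℝ, E) ∞ (fun x : G × U => (x.2 : M)) (g, u) :=
      contMDiff_subtype_val.contMDiffAt.comp (g, u) contMDiffAt_snd
    have h2 : ContMDiffAt (IG.prod 𝓘(ℝ, E)) 𝓘(ℝ, A →L[ℝ] T) ∞ (fun x : G × U => L (π x.2)) (g, u) :=
      ContMDiffAt.comp (g, u) (g := fun u : U => L (π u))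
        (ContMDiffAt.comp u (g := L) (hL _ (hUN u)) (hπ_smooth u)) contMDiffAt_snd
    have h3 : ContMDiffAt (IG.prod 𝓘(ℝ, E)) 𝓘(ℝ, A) ∞ (fun x : G × U => ℓ x.1) (g, u) :=
      ContMDiffAt.comp (g, u) (g := ℓ) hℓ contMDiffAt_fst
    have h5 := ContMDiffAt.comp (g, u) (g := fun x : T × M => x.1 +ᵥ x.2)
      (f := fun x : G × U => (L (π x.2) (ℓ x.1), (x.2 : M)))
      (h.contMDiffAt _ _ (hUV u)) ((h2.clm_apply h3).prodMk h1)
    refine h5.congr_of_eventuallyEq (Filter.Eventually.of_forall fun x => ?_)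
    exact hact x.2 _ _ (by rw [hσ, hℓq])
  · intro b g
    have := hp (Φ (b, g))
    rw [hΦ_coe, h.apply_vadd _ _ (hsV _ b.2), hπs _ b.2] at this
    exact Subtype.ext this
  · intro b g g'
    refine Subtype.ext ?_
    have hπΦ : π (Φ (b, g') : U) = b := by
      rw [hΦ_coe, h.apply_vadd _ _ (hsV _ b.2), hπs _ b.2]
    change L b (σ (g * g')) +ᵥ s b = L (π (Φ (b, g') : U)) (σ g) +ᵥ (L b (σ g') +ᵥ s b)
    rw [hπΦ, ← add_vadd, ← map_add, hsec _ b.2, hq_add, hσ, hσ, hσ]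

end IsLocallyFreeFibration

/-! ### The group `ℝˡ × Tᵐ` as a quotient of a vector space -/

/-! ### Smooth maps into finite products of manifolds -/

section Pi

variable {𝕜 : Type*} [NontriviallyNormedField 𝕜] {ι : Type*} [Fintype ι]
  {E' : ι → Type*} [∀ i, NormedAddCommGroup (E' i)] [∀ i, NormedSpace 𝕜 (E' i)]
  {H' : ι → Type*} [∀ i, TopologicalSpace (H' i)] {I' : ∀ i, ModelWithCorners 𝕜 (E' i) (H' i)}
  {N : ι → Type*} [∀ i, TopologicalSpace (N i)] [∀ i, ChartedSpace (H' i) (N i)]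
  {E H M : Type*} [NormedAddCommGroup E] [NormedSpace 𝕜 E] [TopologicalSpace H]
  {I : ModelWithCorners 𝕜 E H} [TopologicalSpace M] [ChartedSpace H M] {n : WithTop ℕ∞}

/-- Smoothness of maps into a product manifold. -/
lemma contMDiffAt_pi_iff {f : M → ∀ i, N i} {x : M} :
    ContMDiffAt I (ModelWithCorners.pi I') n f x ↔
      ∀ i, ContMDiffAt I (I' i) n (fun x => f x i) x := by
  have key : ∀ y, extChartAt (ModelWithCorners.pi I') (f x) y =
      fun i => extChartAt (I' i) (f x i) (y i) := fun y => rfl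
  rw [contMDiffAt_iff_target, continuousAt_pi]
  simp only [contMDiffAt_iff_target (I' := I' _), forall_and]
  refine and_congr Iff.rfl ?_
  have : extChartAt (ModelWithCorners.pi I') (f x) ∘ f =
      fun z i => extChartAt (I' i) (f x i) (f z i) := funext fun z => key _
  rw [this]
  exact contMDiffAt_pi_space

lemma contMDiff_pi_apply (i : ι) :
    ContMDiff (ModelWithCorners.pi I') (I' i) n (fun f : ∀ i, N i => f i) := fun _ =>
  (contMDiffAt_pi_iff (f := fun f : ∀ i, N i => f)).1 contMDiffAt_id i

end Pi

namespace Circle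

/-- Locally, the covering of the circle by the line has a smooth section. -/
lemma exists_smooth_lift (z₀ : Circle) : ∃ ℓ : Circle → ℝ,
    ContMDiffAt (𝓡 1) 𝓘(ℝ, ℝ) ∞ ℓ z₀ ∧ ∀ z, Circle.exp (2 * Real.pi * ℓ z) = z := by
  have hfact : Fact (Module.finrank ℝ ℂ = 1 + 1) := ⟨Complex.finrank_real_complex⟩
  have hπ : (2 * Real.pi) ≠ 0 := Real.two_pi_pos.ne'
  -- Rotating `z₀` to `1` makes the argument smooth at the point in question; the formula lifts
  -- every `z`, although it jumps elsewhere.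
  refine ⟨fun z => (2 * Real.pi)⁻¹ * (Complex.arg z₀ + Complex.arg ((z * z₀⁻¹ : Circle) : ℂ)),
    ?_, fun z => ?_⟩
  · have h1 : ContMDiffAt (𝓡 1) 𝓘(ℝ, ℂ) ∞ (fun z : Circle => (z : ℂ) * ((z₀⁻¹ : Circle) : ℂ)) z₀ := by
      have h2 : ContMDiff (𝓡 1) 𝓘(ℝ, ℂ) ∞ (fun z : Circle => (z : ℂ)) :=
        contMDiff_coe_sphere (E := ℂ) (n := 1)
      have h3 : ContDiff ℝ ∞ (fun w : ℂ => w * ((z₀⁻¹ : Circle) : ℂ)) := by fun_prop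
      exact h3.contMDiff.contMDiffAt.comp z₀ h2.contMDiffAt
    have h4 : (z₀ : ℂ) * ((z₀⁻¹ : Circle) : ℂ) = 1 := by
      rw [← Circle.coe_mul, mul_inv_cancel, Circle.coe_one]
    have h5 : ContDiffAt ℝ ∞ (fun w : ℂ => (2 * Real.pi)⁻¹ * (Complex.arg z₀ + (Complex.log w).im))
        ((z₀ : ℂ) * ((z₀⁻¹ : Circle) : ℂ)) := by
      have h6 : ContDiffAt ℝ ∞ Complex.log ((z₀ : ℂ) * ((z₀⁻¹ : Circle) : ℂ)) := by
        rw [h4]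
        exact (Complex.contDiffAt_log Complex.one_mem_slitPlane).restrict_scalars ℝ
      exact contDiffAt_const.mul (contDiffAt_const.add
        (Complex.imCLM.contDiff.contDiffAt.comp _ h6))
    refine (ContMDiffAt.comp z₀ (g := fun w : ℂ =>
      (2 * Real.pi)⁻¹ * (Complex.arg z₀ + (Complex.log w).im)) h5.contMDiffAt
      h1).congr_of_eventuallyEq (Filter.Eventually.of_forall fun z => ?_)
    simp only [Function.comp_apply, Complex.log_im, Circle.coe_mul]
  · rw [mul_inv_cancel_left₀ hπ, Circle.exp_add, Circle.exp_arg, Circle.exp_arg]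
    rw [← mul_assoc, mul_comm z₀ z, mul_inv_cancel_right]

lemma exp_two_pi_mul_eq_one_iff {x : ℝ} : Circle.exp (2 * Real.pi * x) = 1 ↔ ∃ n : ℤ, x = n := by
  rw [← Circle.exp_zero, Circle.exp_eq_exp]
  refine exists_congr fun n => ?_
  rw [zero_add, mul_comm, mul_left_inj' Real.two_pi_pos.ne']

end Circle

namespace PartialIntegrability.Cylinder

variable {l m : ℕ}

/-- The covering of `ℝˡ × Tᵐ` by the vector space `ℝˡ × ℝᵐ`. -/
noncomputable def ofVector (a : EuclideanSpace ℝ (Fin l) × (Fin m → ℝ)) : Cylinder l m :=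
  (a.1, fun i => Circle.exp (2 * Real.pi * a.2 i))

lemma ofVector_add (a b : EuclideanSpace ℝ (Fin l) × (Fin m → ℝ)) :
    ofVector (a + b) = ofVector a * ofVector b := by
  refine Prod.ext rfl (funext fun i => ?_)
  change Circle.exp (2 * Real.pi * (a.2 i + b.2 i)) =
    Circle.exp (2 * Real.pi * a.2 i) * Circle.exp (2 * Real.pi * b.2 i)
  rw [mul_add, Circle.exp_add]

lemma ofVector_eq_one_iff (a : EuclideanSpace ℝ (Fin l) × (Fin m → ℝ)) :
    ofVector a = 1 ↔ a.1 = 0 ∧ ∃ n : Fin m → ℤ, ∀ i, a.2 i = n i := by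
  have h1 : ofVector a = 1 ↔ a.1 = 0 ∧ ∀ i, Circle.exp (2 * Real.pi * a.2 i) = 1 :=
    Prod.ext_iff.trans (and_congr Iff.rfl funext_iff)
  rw [h1]
  simp only [Circle.exp_two_pi_mul_eq_one_iff]
  exact and_congr Iff.rfl ⟨fun h => ⟨fun i => (h i).choose, fun i => (h i).choose_spec⟩,
    fun ⟨n, hn⟩ i => ⟨n i, hn i⟩⟩

lemma contMDiff_ofVector :
    ContMDiff 𝓘(ℝ, EuclideanSpace ℝ (Fin l) × (Fin m → ℝ)) (model l m) ∞
      (ofVector : _ → Cylinder l m) := by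
  have h : ContMDiff 𝓘(ℝ, EuclideanSpace ℝ (Fin l) × (Fin m → ℝ))
      ((𝓡 l).prod (ModelWithCorners.pi fun _ : Fin m => 𝓡 1)) ∞
      (fun a : EuclideanSpace ℝ (Fin l) × (Fin m → ℝ) =>
        (a.1, fun i : Fin m => Circle.exp (2 * Real.pi * a.2 i))) := by
    intro a
    refine contDiffAt_fst.contMDiffAt.prodMk (contMDiffAt_pi_iff.2 fun i => ?_)
    have h1 : ContDiff ℝ ∞
        (fun a : EuclideanSpace ℝ (Fin l) × (Fin m → ℝ) => 2 * Real.pi * a.2 i) := by fun_prop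
    exact (contMDiff_circleExp.comp h1.contMDiff).contMDiffAt
  exact h

lemma exists_smooth_lift (g₀ : Cylinder l m) :
    ∃ ℓ : Cylinder l m → EuclideanSpace ℝ (Fin l) × (Fin m → ℝ),
      ContMDiffAt (model l m) 𝓘(ℝ, EuclideanSpace ℝ (Fin l) × (Fin m → ℝ)) ∞ ℓ g₀ ∧
      ∀ g, ofVector (ℓ g) = g := by
  choose ℓ hℓ hℓz using fun i => Circle.exists_smooth_lift (g₀.2 i)
  refine ⟨fun g => (g.1, fun i => ℓ i (g.2 i)), ?_, fun g => ?_⟩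
  · have h : ContMDiffAt ((𝓡 l).prod (ModelWithCorners.pi fun _ : Fin m => 𝓡 1))
        𝓘(ℝ, EuclideanSpace ℝ (Fin l) × (Fin m → ℝ)) ∞
        (fun g : EuclideanSpace ℝ (Fin l) × (Fin m → Circle) => (g.1, fun i => ℓ i (g.2 i))) g₀ := by
      refine contMDiffAt_fst.prodMk_space (contMDiffAt_pi_space.2 fun i => ?_)
      exact ContMDiffAt.comp (I' := 𝓡 1) g₀ (g := ℓ i)
        (f := fun g : EuclideanSpace ℝ (Fin l) × (Fin m → Circle) => g.2 i) (hℓ i)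
        ((contMDiff_pi_apply i).contMDiffAt.comp g₀ contMDiffAt_snd)
    exact h
  · exact Prod.ext rfl (funext fun i => hℓz i (g.2 i))

end PartialIntegrability.Cylinder

/-! ### Local triviality of locally free actions with constant rank of the periods -/

/-- Linearly independent vectors extend to a linear isomorphism, with a Euclidean complement. -/
lemma LinearIndependent.exists_complement {T : Type*} [NormedAddCommGroup T] [NormedSpace ℝ T]
    [FiniteDimensional ℝ T] {m : ℕ} {v : Fin m → T} (hv : LinearIndependent ℝ v) :
    ∃ C : EuclideanSpace ℝ (Fin (Module.finrank ℝ T - m)) →L[ℝ] T,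
      ∀ (x) (y : Fin m → ℝ), C x + ∑ i, y i • v i = 0 → x = 0 ∧ y = 0 := by
  obtain ⟨W, hW⟩ := Submodule.exists_isCompl (Submodule.span ℝ (range v))
  have hdim : Module.finrank ℝ (EuclideanSpace ℝ (Fin (Module.finrank ℝ T - m))) =
      Module.finrank ℝ W := by
    have h1 := Submodule.finrank_add_eq_of_isCompl hW
    rw [finrank_span_eq_card hv, Fintype.card_fin] at h1
    rw [finrank_euclideanSpace_fin]
    omega
  let e := ContinuousLinearEquiv.ofFinrankEq hdim
  refine ⟨W.subtypeL ∘L e, fun x y hxy => ?_⟩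
  have h1 : (e x : T) + ∑ i, y i • v i = 0 := hxy
  have h2 : ∑ i, y i • v i ∈ Submodule.span ℝ (range v) :=
    sum_mem fun i _ => Submodule.smul_mem _ _ (Submodule.subset_span ⟨i, rfl⟩)
  have h3 : (e x : T) ∈ Submodule.span ℝ (range v) := by
    rw [eq_neg_of_add_eq_zero_left h1]
    exact neg_mem h2
  have h4 : (e x : T) = 0 := Submodule.disjoint_def.1 hW.disjoint _ h3 (e x).2
  refine ⟨?_, ?_⟩
  · exact (map_eq_zero_iff e e.injective).1 (Subtype.ext h4)
  · rw [h4, zero_add] at h1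
    exact funext fun i => Fintype.linearIndependent_iff.1 hv y h1 i

/-- The linear map with given values on a Euclidean complement and on the coordinate vectors. -/
noncomputable def frameMap {T : Type*} [NormedAddCommGroup T] [NormedSpace ℝ T] {l m : ℕ}
    (C : EuclideanSpace ℝ (Fin l) →L[ℝ] T) (v : Fin m → T) :
    EuclideanSpace ℝ (Fin l) × (Fin m → ℝ) →L[ℝ] T :=
  C.comp (ContinuousLinearMap.fst ℝ (EuclideanSpace ℝ (Fin l)) (Fin m → ℝ)) +
    ∑ i, ContinuousLinearMap.smulRightL ℝ (EuclideanSpace ℝ (Fin l) × (Fin m → ℝ)) T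
      ((ContinuousLinearMap.proj (R := ℝ) (φ := fun _ : Fin m => ℝ) i).comp
        (ContinuousLinearMap.snd ℝ (EuclideanSpace ℝ (Fin l)) (Fin m → ℝ))) (v i)

lemma frameMap_apply {T : Type*} [NormedAddCommGroup T] [NormedSpace ℝ T] {l m : ℕ}
    (C : EuclideanSpace ℝ (Fin l) →L[ℝ] T) (v : Fin m → T)
    (a : EuclideanSpace ℝ (Fin l) × (Fin m → ℝ)) :
    frameMap C v a = C a.1 + ∑ i, a.2 i • v i := by
  simp [frameMap]

/-- The frame map is affine in `v`: a constant plus bounded linear maps of the components. -/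
lemma contDiff_frameMap {T : Type*} [NormedAddCommGroup T] [NormedSpace ℝ T] {l m : ℕ}
    (C : EuclideanSpace ℝ (Fin l) →L[ℝ] T) :
    ContDiff ℝ ∞ (fun v : Fin m → T => frameMap C v) := by
  unfold frameMap
  refine contDiff_const.add (ContDiff.sum fun i _ => ?_)
  exact (ContinuousLinearMap.contDiff _).comp (contDiff_apply ℝ T i)

lemma IsLocalSection.mono {E B : Type*} [NormedAddCommGroup E] [NormedSpace ℝ E]
    [NormedAddCommGroup B] [NormedSpace ℝ B] {M S : Type*} [TopologicalSpace M] [ChartedSpace E M]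
    [TopologicalSpace S] [ChartedSpace B S] {V : Set M} {π : M → S} {s : S → M} {O O' : Set S}
    (hs : IsLocalSection E B V π s O) (hO' : IsOpen O') (h : O' ⊆ O) :
    IsLocalSection E B V π s O' :=
  ⟨hO', hs.contMDiffOn.mono h, fun r hr => hs.mem r (h hr), fun r hr => hs.apply r (h hr)⟩

namespace IsLocallyFreeFibration

open PartialIntegrability

variable {T B : Type*} {E : Type u} [NormedAddCommGroup T] [NormedSpace ℝ T]
  [NormedAddCommGroup E] [NormedSpace ℝ E] [NormedAddCommGroup B] [NormedSpace ℝ B]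
  {M : Type*} [TopologicalSpace M] [ChartedSpace E M] [IsManifold 𝓘(ℝ, E) ∞ M]
  {S : Type*} [TopologicalSpace S] [ChartedSpace B S] [IsManifold 𝓘(ℝ, B) ∞ S]
  [AddAction T M] {V : Set M} {π : M → S}
  [FiniteDimensional ℝ T] [FiniteDimensional ℝ E] [FiniteDimensional ℝ B]

/-- A locally free action with connected fibres and periods of constant rank is locally a trivial
principal bundle. -/
theorem exists_isTrivialPrincipalBundle [T2Space M] (h : IsLocallyFreeFibration T E B V π)
    {N : Set S} (hN : IsOpen N) (hconn : ∀ r ∈ N, IsPreconnected (V ∩ π ⁻¹' {r})) {m : ℕ}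
    (hm : ∀ z ∈ V, π z ∈ N → Module.finrank ℤ (AddAction.stabilizer T z) = m)
    {z₀ : M} (hz₀ : z₀ ∈ V) (hr₀ : π z₀ ∈ N) :
    ∃ (N' : Opens S) (U : Opens M) (p : U → N'),
      π z₀ ∈ N' ∧ (N' : Set S) ⊆ N ∧ IsDomainSet (N' : Set S) ∧
      (U : Set M) = V ∩ π ⁻¹' (N' : Set S) ∧ (∀ u : U, (p u : S) = π u) ∧
      IsTrivialPrincipalBundle 𝓘(ℝ, B) 𝓘(ℝ, E) (Cylinder.model (Module.finrank ℝ T - m) m)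
        (Cylinder (Module.finrank ℝ T - m) m) p := by
  obtain ⟨s, O, hs', hr₀O', hsz⟩ := h.exists_isLocalSection hz₀
  have hs := hs'.mono (hs'.isOpen.inter hN) inter_subset_left
  have hr₀O : π z₀ ∈ O ∩ N := ⟨hr₀O', hr₀⟩
  obtain ⟨v, hv⟩ := h.exists_smooth_period_basis hs (m := m)
    (fun r hr => hm _ (hs.mem r hr) (by rw [hs.apply r hr]; exact hr.2)) hr₀O
  -- The complement is chosen at `π z₀` and kept fixed in `r`; it remains complementary nearby
  -- because invertible operators form an open set.
  obtain ⟨C, hC⟩ := LinearIndependent.exists_complement hv.self_of_nhds.2.2.1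
  let L : S → EuclideanSpace ℝ (Fin (Module.finrank ℝ T - m)) × (Fin m → ℝ) →L[ℝ] T :=
    fun r => frameMap C fun i => v i r
  have hL : ∀ r, (∀ i, ContMDiffAt 𝓘(ℝ, B) 𝓘(ℝ, T) ∞ (v i) r) →
      ContMDiffAt 𝓘(ℝ, B) 𝓘(ℝ, EuclideanSpace ℝ (Fin (Module.finrank ℝ T - m)) × (Fin m → ℝ) →L[ℝ] T)
        ∞ L r := fun r hr =>
    ContMDiffAt.comp r (g := fun v : Fin m → T => frameMap C v) (f := fun r i => v i r)
      (contDiff_frameMap C).contMDiff.contMDiffAt (contMDiffAt_pi_space.2 hr)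
  have hmle : m ≤ Module.finrank ℝ T := by
    have := hv.self_of_nhds.2.2.1.fintype_card_le_finrank
    rwa [Fintype.card_fin] at this
  have hLr₀ : (L (π z₀)).IsInvertible := by
    have hinj : Function.Injective (L (π z₀)).toLinearMap := by
      rw [injective_iff_map_eq_zero]
      rintro ⟨x, y⟩ hxy
      have h1 : L (π z₀) (x, y) = 0 := hxy
      rw [frameMap_apply] at h1
      exact Prod.ext (hC x y h1).1 (hC x y h1).2
    have hdim : Module.finrank ℝ
        (EuclideanSpace ℝ (Fin (Module.finrank ℝ T - m)) × (Fin m → ℝ)) = Module.finrank ℝ T := by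
      rw [Module.finrank_prod, finrank_euclideanSpace_fin, Module.finrank_fin_fun]
      omega
    exact ⟨(LinearEquiv.ofInjectiveOfFinrankEq _ hinj hdim).toContinuousLinearEquiv,
      ContinuousLinearMap.ext fun _ => rfl⟩
  have hLi : ∀ᶠ r in 𝓝 (π z₀), (L r).IsInvertible := by
    obtain ⟨e, he⟩ := hLr₀
    exact (hL _ hv.self_of_nhds.2.1).continuousAt.eventually (by rw [← he]; exact e.nhds)
  obtain ⟨W, hW, hWo, hr₀W⟩ := eventually_nhds_iff.1 (hv.and hLi)
  -- Local connectedness makes the connected component of the good neighbourhood `W` open, hence a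
  -- domain.
  have : LocallyConnectedSpace S := ChartedSpace.locallyConnectedSpace B S
  have hN'W : ∀ r ∈ connectedComponentIn W (π z₀), r ∈ W :=
    fun r hr => connectedComponentIn_subset W _ hr
  let N' : Opens S := ⟨connectedComponentIn W (π z₀), hWo.connectedComponentIn⟩
  have hUo : IsOpen (V ∩ π ⁻¹' (N' : Set S)) := by
    rw [isOpen_iff_mem_nhds]
    intro z hz
    exact Filter.inter_mem (h.isOpen.mem_nhds hz.1)
      ((h.contMDiffAt_proj hz.1).continuousAt.preimage_mem_nhds (N'.isOpen.mem_nhds hz.2))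
  refine ⟨N', ⟨_, hUo⟩, fun u => ⟨π u, u.2.2⟩, mem_connectedComponentIn hr₀W,
    fun r hr => (hW r (hN'W r hr)).1.1.2, ⟨N'.isOpen, isConnected_connectedComponentIn_iff.2 hr₀W⟩,
    rfl, fun _ => rfl, ?_⟩
  refine h.isTrivialPrincipalBundle hs rfl (fun r hr => (hW r (hN'W r hr)).1.1) (fun _ => rfl)
    (fun z hz w hw hzN hwz => h.exists_vadd_eq hz hw hwz
      (hconn _ (hW _ (hN'W _ hzN)).1.1.2))
    (L := L) (fun r hr => hL r (hW r (hN'W r hr)).1.2.1) (fun r hr => (hW r (hN'W r hr)).2)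
    Cylinder.contMDiff_ofVector Cylinder.ofVector_add Cylinder.exists_smooth_lift ?_
  rintro r hr ⟨x, y⟩
  obtain ⟨⟨-, -, -, hper⟩, e, he⟩ := hW r (hN'W r hr)
  -- The kernel of the group covering is `{0} × ℤᵐ`, and `L r` takes it exactly to the lattice
  -- generated by the `v i r`.
  rw [hper, Cylinder.ofVector_eq_one_iff]
  have hinj : Function.Injective (L r) := by
    rw [← he]
    exact e.injective
  constructor
  · rintro ⟨n, hn⟩
    have h1 : L r (x, y) = L r (0, fun i => (n i : ℝ)) := by
      rw [hn, frameMap_apply, map_zero, zero_add]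
    have h2 := hinj h1
    exact ⟨congrArg Prod.fst h2, n, fun i => congrFun (congrArg Prod.snd h2) i⟩
  · rintro ⟨hx, n, hn⟩
    refine ⟨n, ?_⟩
    simp only at hx hn
    rw [frameMap_apply, hx, map_zero, zero_add]
    simp only [hn]

end IsLocallyFreeFibration

/-! ### Partially integrable systems -/

namespace PartialIntegrability

lemma IsSmoothOnSubset.continuousOn {d : ℕ} {M : Type*} [TopologicalSpace M]
    [ChartedSpace (EuclideanSpace ℝ (Fin d)) M] {A : Set M} {f : M → M}
    (hf : IsSmoothOnSubset d A f) : ContinuousOn f A := by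
  intro x hx
  obtain ⟨V, hV, hxV, g, hg, hfg⟩ := hf x hx
  have h1 : ContinuousWithinAt g (A ∩ V) x := (hg.continuousOn x hxV).mono inter_subset_right
  have h2 : ContinuousWithinAt f (A ∩ V) x := h1.congr hfg (hfg ⟨hx, hxV⟩)
  exact h2.mono_of_mem_nhdsWithin (Filter.inter_mem self_mem_nhdsWithin
    (mem_nhdsWithin_of_mem_nhds (hV.mem_nhds hxV)))

/-- Diffeomorphic subsets are homeomorphic. -/
lemma AreDiffeomorphic.nonempty_homeomorph {d : ℕ} {M : Type*} [TopologicalSpace M]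
    [ChartedSpace (EuclideanSpace ℝ (Fin d)) M] {A B : Set M} (h : AreDiffeomorphic d A B) :
    Nonempty (A ≃ₜ B) := by
  obtain ⟨f, g, hf, hg, hgf, hfg, hfs, hgs⟩ := h
  exact ⟨{
    toFun := hf.restrict
    invFun := hg.restrict
    left_inv := fun x => Subtype.ext (hgf x.2)
    right_inv := fun x => Subtype.ext (hfg x.2)
    continuous_toFun := hfs.continuousOn.mapsToRestrict hf
    continuous_invFun := hgs.continuousOn.mapsToRestrict hg }⟩

/-- The Hamiltonian vector fields of independent functions are linearly independent. -/
lemma linearIndependent_hamiltonianVectorField {d k : ℕ} {Z : Type*} [TopologicalSpace Z]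
    [ChartedSpace (EuclideanSpace ℝ (Fin d)) Z] [IsManifold (𝓡 d) ∞ Z]
    (Ω : SymplecticForm d Z) (F : Fin k → Z → ℝ) {z : Z}
    (h : IsSubmersionAt (𝓡 d) 𝓘(ℝ, Fin k → ℝ) ∞ (fun z i => F i z) z) :
    LinearIndependent ℝ
      (fun i => (Ω.hamiltonianVectorField (F i) z : EuclideanSpace ℝ (Fin d))) := by
  obtain ⟨s, O, hO, hzO, hs, hsz, hFs⟩ := h.exists_local_section
  have hF := (h.contMDiffAt.mdifferentiableAt (by simp)).hasMFDerivAt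
  let A : EuclideanSpace ℝ (Fin d) →L[ℝ] (Fin k → ℝ) :=
    mfderiv (𝓡 d) 𝓘(ℝ, Fin k → ℝ) (fun z i => F i z) z
  have hs' := ((hs.contMDiffAt (hO.mem_nhds hzO)).mdifferentiableAt (by simp)).hasMFDerivAt
  let R : (Fin k → ℝ) →L[ℝ] EuclideanSpace ℝ (Fin d) :=
    mfderiv 𝓘(ℝ, Fin k → ℝ) (𝓡 d) s (fun i => F i z)
  -- The derivative of a local section is a right inverse of `dF`.
  have hAR : ∀ a, A (R a) = a := by
    have h1 := HasMFDerivAt.comp (x := fun i => F i z) (g := fun z i => F i z) (f := s)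
      (by rw [hsz]; exact hF) hs'
    have h2 : (fun z i => F i z) ∘ s =ᶠ[𝓝 (fun i => F i z)] id :=
      Filter.eventually_of_mem (hO.mem_nhds hzO) hFs
    have h3 := hasMFDerivAt_unique (h1.congr_of_eventuallyEq h2.symm)
      (hasMFDerivAt_id (I := 𝓘(ℝ, Fin k → ℝ)) (fun i => F i z))
    intro a
    exact congrArg (fun K : (Fin k → ℝ) →L[ℝ] (Fin k → ℝ) => K a) h3
  have hAi : ∀ i (w : EuclideanSpace ℝ (Fin d)),
      (mfderiv (𝓡 d) 𝓘(ℝ, ℝ) (F i) z w : ℝ) = A w i := by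
    intro i w
    have h1 : HasMFDerivAt 𝓘(ℝ, Fin k → ℝ) 𝓘(ℝ, ℝ) (fun a : Fin k → ℝ => a i) (fun i => F i z)
        (ContinuousLinearMap.proj i) :=
      (ContinuousLinearMap.proj (R := ℝ) (φ := fun _ : Fin k => ℝ) i).hasFDerivAt.hasMFDerivAt
    have h2 := HasMFDerivAt.comp (x := z) (g := fun a : Fin k → ℝ => a i) (f := fun z i => F i z)
      h1 hF
    exact congrArg (fun K : EuclideanSpace ℝ (Fin d) →L[ℝ] ℝ => K w) h2.mfderiv
  rw [Fintype.linearIndependent_iff]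
  intro a ha i
  -- A relation `∑ aᵢ ϑᵢ = 0` is paired with `R a`. Since `Ω(ϑᵢ, R a) = -dFᵢ(R a) = -aᵢ`, this gives
  -- `∑ aᵢ² = 0`.
  let φ : EuclideanSpace ℝ (Fin d) →ₗ[ℝ] ℝ := LinearMap.flip (Ω.flat z) (R a)
  let X : Fin k → EuclideanSpace ℝ (Fin d) := fun i => Ω.hamiltonianVectorField (F i) z
  have h1 : ∑ i, φ (a i • X i) = 0 :=
    (map_sum φ _ _).symm.trans ((congrArg φ ha).trans (map_zero φ))
  have h2 : ∀ i, φ (a i • X i) = -(a i * a i) := by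
    intro i
    rw [map_smul]
    have h3 : φ (X i) = -(A (R a) i) :=
      (Ω.form_hamiltonianVectorField (F i) z (R a)).trans (congrArg Neg.neg (hAi i (R a)))
    rw [h3, hAR a, smul_eq_mul, mul_neg]
  rw [Finset.sum_congr rfl fun i _ => h2 i, Finset.sum_neg_distrib, neg_eq_zero,
    Finset.sum_eq_zero_iff_of_nonneg fun i _ => mul_self_nonneg (a i)] at h1
  exact mul_self_eq_zero.1 (h1 i (Finset.mem_univ i))

end PartialIntegrability

theorem proposition2 {n k : ℕ} (hk : k < n)
    -- a `2n`-dimensional symplectic manifold `Z` with `k < n` functions in involution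
    {Z : Type*} [TopologicalSpace Z] [T2Space Z] [SecondCountableTopology Z]
    [ChartedSpace (EuclideanSpace ℝ (Fin (2 * n))) Z] [IsManifold (𝓡 (2 * n)) ∞ Z]
    (Ω : SymplecticForm (2 * n) Z) (F : Fin k → Z → ℝ) (hF : IsPartiallyIntegrable Ω F)
    -- the connected common level surface `W` and its open connected neighbourhood `UW`, on which
    -- `(F₁, …, F_k)` is a submersion
    (c : Fin k → ℝ) (W : Set Z) (hW : W = {z | ∀ i, F i z = c i}) (hWconn : IsConnected W)
    (UW : Set Z) (hUW : IsOpen UW) (hUWconn : IsConnected UW) (hWU : W ⊆ UW)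
    (hUWreg : ∀ z ∈ UW, IsSubmersionAt (𝓡 (2 * n)) 𝓘(ℝ, Fin k → ℝ) ∞ (fun z i => F i z) z)
    -- the characteristic foliation of `UW` is a fibred manifold `π₁ : UW → S`
    {S : Type*} [TopologicalSpace S] [T2Space S] [SecondCountableTopology S]
    [ChartedSpace (EuclideanSpace ℝ (Fin (2 * n - k))) S] [IsManifold (𝓡 (2 * n - k)) ∞ S]
    (π₁ : Z → S) (hπ₁ : IsCharacteristicFibration (e := 2 * n - k) Ω F UW π₁)
    -- the domain `N`, with (i) mutually diffeomorphic fibres and (ii) complete vector fields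
    (N : Set S) (hN : IsDomainSet N)
    (hfib : ∀ r ∈ N, ∀ r' ∈ N,
      AreDiffeomorphic (2 * n) (UW ∩ π₁ ⁻¹' {r}) (UW ∩ π₁ ⁻¹' {r'}))
    (hcomplete : ∀ i, IsCompleteOn (Ω.hamiltonianVectorField (F i)) (UW ∩ π₁ ⁻¹' N)) :
    ∃ m ≤ k, ∀ r₀ ∈ N, ∃ (N' : Opens S) (U : Opens Z) (p : U → N'),
      r₀ ∈ N' ∧ (N' : Set S) ⊆ N ∧ IsDomainSet (N' : Set S) ∧
      (U : Set Z) = UW ∩ π₁ ⁻¹' (N' : Set S) ∧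
      (∀ u : U, (p u : S) = π₁ u) ∧
      IsTrivialPrincipalBundle (𝓡 (2 * n - k)) (𝓡 (2 * n)) (Cylinder.model (k - m) m)
        (Cylinder (k - m) m) p := by
  classical
  set V : Set Z := UW ∩ π₁ ⁻¹' N with hVdef
  let X : Fin k → ∀ z : Z, TangentSpace (𝓡 (2 * n)) z := fun i => Ω.hamiltonianVectorField (F i)
  have hsub : ∀ z ∈ V, IsSubmersionAt (𝓡 (2 * n)) (𝓡 (2 * n - k)) ∞ π₁ z :=
    fun z hz => hπ₁.submersion z hz.1
  have hVo : IsOpen V := by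
    rw [isOpen_iff_mem_nhds]
    intro z hz
    exact Filter.inter_mem (hUW.mem_nhds hz.1)
      ((hsub z hz).contMDiffAt.continuousAt.preimage_mem_nhds (hN.1.mem_nhds hz.2))
  have hX : ∀ i, ManifoldFlow.IsSmoothField (X i) := fun i =>
    HamiltonianFields.isSmoothField_hamiltonianVectorField Ω (F i) (hF.smooth i)
  have hV : ∀ i, ManifoldFlow.IsCompleteField (X i) V := fun i u hu => hcomplete i u hu
  have hc : Pairwise fun i j => ∀ s t, Commute (ManifoldFlow.flowHom (hX i) (hV i) s)
      (ManifoldFlow.flowHom (hX j) (hV j) t) := fun i j _ s t => Equiv.ext fun z =>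
    ManifoldFlow.flow_comm (hX j) (hX i) (HamiltonianFields.fieldsCommute_hamiltonianVectorField Ω
      (F j) (F i) (hF.smooth j) (hF.smooth i) (hF.involution j i)) hVo (hV j) (hV i) _ _ z
  let action : AddAction (Fin k → ℝ) Z := ManifoldFlow.jointFlow hX hV hc
  have hA : IsLocallyFreeFibration (Fin k → ℝ) (EuclideanSpace ℝ (Fin (2 * n)))
      (EuclideanSpace ℝ (Fin (2 * n - k))) V π₁ := by
    refine ⟨ManifoldFlow.isLocallyFreeSmoothAction_jointFlow hX hV hc hVo
      (fun z hz => linearIndependent_hamiltonianVectorField Ω F (hUWreg z hz.1))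
      (fun z hz => (hsub z hz).contMDiffAt.mdifferentiableAt (by simp)) (fun i z hz => ?_),
      hVo, hsub, ?_⟩
    · have h1 : X i z ∈ (mfderiv (𝓡 (2 * n)) (𝓡 (2 * n - k)) π₁ z).toLinearMap.ker := by
        rw [hπ₁.vertical z hz.1]
        exact Submodule.subset_span ⟨i, rfl⟩
      exact h1
    -- The subtraction in `2 * n - k` is truncated; `k < n` ensures that it is a true difference.
    · rw [finrank_euclideanSpace_fin, finrank_euclideanSpace_fin, Module.finrank_fin_fun]
      omega
  have hfibre : ∀ r ∈ N, V ∩ π₁ ⁻¹' {r} = UW ∩ π₁ ⁻¹' {r} := by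
    intro r hr
    ext z
    constructor
    · rintro ⟨h1, h2⟩
      exact ⟨h1.1, h2⟩
    · rintro ⟨h1, h2⟩
      exact ⟨⟨h1, by rw [mem_preimage, h2]; exact hr⟩, h2⟩
  have hconn : ∀ r ∈ N, IsPreconnected (V ∩ π₁ ⁻¹' {r}) := by
    intro r hr
    rw [hfibre r hr]
    exact (hπ₁.connected r).isPreconnected
  have hpoint : ∀ r ∈ N, ∃ z ∈ V, π₁ z = r := by
    intro r hr
    obtain ⟨z, hz, rfl⟩ := hπ₁.surjOn (mem_univ r)
    exact ⟨z, ⟨hz, hr⟩, rfl⟩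
  obtain ⟨r₁, hr₁⟩ := hN.2.nonempty
  obtain ⟨z₁, hz₁, rfl⟩ := hpoint r₁ hr₁
  -- The torus dimension is the rank of the periods at an arbitrary point `z₁`.
  set m := Module.finrank ℤ (AddAction.stabilizer (Fin k → ℝ) z₁) with hm
  have hrank : ∀ z ∈ V, π₁ z ∈ N →
      Module.finrank ℤ (AddAction.stabilizer (Fin k → ℝ) z) = m := by
    intro z hz hzN
    -- Only the homeomorphism type of the fibres matters, since the rank is read off the fundamental
    -- group.
    obtain ⟨φ⟩ := (hfib _ hzN _ hr₁).nonempty_homeomorph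
    rw [← hfibre _ hzN, ← hfibre _ hr₁] at φ
    exact hA.finrank_stabilizer_eq hz hz₁ (hconn _ hzN) (hconn _ hr₁) φ
  have hmk : m ≤ k := by
    have := hA.discreteTopology_stabilizer hz₁
    rw [hm, ← AddSubgroup.finrank_span_eq_of_discreteTopology]
    exact (Submodule.finrank_le _).trans_eq (Module.finrank_fin_fun ℝ)
  refine ⟨m, hmk, fun r₀ hr₀ => ?_⟩
  obtain ⟨z₀, hz₀, rfl⟩ := hpoint r₀ hr₀
  obtain ⟨N', U, p, h1, h2, h3, h4, h5, h6⟩ :=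
    hA.exists_isTrivialPrincipalBundle hN.1 hconn hrank hz₀ hr₀
  rw [Module.finrank_fin_fun] at h6
  refine ⟨N', U, p, h1, h2, h3, h4.trans ?_, h5, h6⟩
  ext z
  exact ⟨fun h => ⟨h.1.1, h.2⟩, fun h => ⟨⟨h.1, h2 h.2⟩, h.2⟩⟩
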